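/- Write $(1-\partial_x^2)^{-1}p(x)=\frac12\int_{\mathbb R}e^{-|x-y|}p(y)\,dy$. The two-component Novikov system is $$u_t+uvu_x+\partial_xP_1+P_2=0,\qquad v_t+uvv_x+\partial_xS_1+S_2=0,$$ $$P_1=(1-\partial_x^2)^{-1}\bigl(u^2v+uu_xv_x+\tfrac12vu_x^2\bigr),\quad P_2=\tfrac12(1-\partial_x^2)^{-1}(u_x^2v_x),$$ $$S_1=(1-\partial_x^2)^{-1}\bigl(uv^2+vu_xv_x+\tfrac12uv_x^2\bigr),\quad S_2=\tfrac12(1-\partial_x^2)^{-1}(u_xv_x^2).$$ Let $T>0$ and $\alpha\in(0,1)$. A *smooth solution* on $[-T,T]$ with initial data $(u_0,v_0)$ is a pair $(u,v)$ of functions in $C^\infty([-T,T]\times\mathbb R)$ that satisfies the system pointwise, with $(u,v)(0,\cdot)=(u_0,v_0)$, such that $u,v,u_x,v_x,u_{xx},v_{xx}$ are bounded on $[-T,T]\times\mathbb R$ and, for every $t\in[-T,T]$, $u(t,\cdot),v(t,\cdot)\in H^1(\mathbb R)$ and $(u_xv_x)(t,\cdot)\in L^2(\mathbb R)$. Put $$E_{u_0}=\int_{\mathbb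 R}(u_0^2+u_{0,x}^2)\,dx,\qquad E_{v_0}=\int_{\mathbb R}(v_0^2+v_{0,x}^2)\,dx,$$ $$H_0=\int_{\mathbb R}\bigl(3u_0^2v_0^2+u_0^2v_{0,x}^2+u_{0,x}^2v_0^2+4u_0u_{0,x}v_0v_{0,x}-u_{0,x}^2v_{0,x}^2\bigr)\,dx.$$ A *tangent vector* along $(u,v)$ is a pair $(r,s)$ of functions in $C^\infty([-T,T]\times\mathbb R)$ for which there is a family $(u^\varepsilon,v^\varepsilon)$, $|\varepsilon|<\varepsilon_0$, of smooth solutions on $[-T,T]$ with $(u^0,v^0)=(u,v)$ and $$u^\varepsilon=u+\varepsilon r+o(\varepsilon),\quad u^\varepsilon_x=u_x+\varepsilon r_x+o(\varepsilon),\quad v^\varepsilon=v+\varepsilon s+o(\varepsilon),\quad v^\varepsilon_x=v_x+\varepsilon s_x+o(\varepsilon)$$ pointwise as $\varepsilon\to0$, where the difference quotients $(u^\varepsilon-u)/\varepsilon$, $(u^\varepsilon_x-u_x)/\varepsilon$, $(v^\varepsilon-v)/\varepsilon$, $(v^\varepsilon_x-v_x)/\varepsilon$ are bounded on $[-T,T]\times\mathbb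 R$ uniformly in small $\varepsilon\ne0$. Let $\mathcal A$ be the set of all bounded $h\in C^\infty([-T,T]\times\mathbb R)$ (horizontal shifts) that solve $$h_t+uvh_x=(u_xv+uv_x)h+us+vr .$$ With $D=(1+u_x^2)(1+v_x^2)$ and $$f_1=hD,\quad f_2=(r+u_xh)D,\quad f_3=(s+v_xh)D,\quad f_4=(r_x+u_{xx}h)(1+v_x^2),\quad f_5=(s_x+v_{xx}h)(1+u_x^2),$$ $$f_6=2u_x(1+v_x^2)(r_x+u_{xx}h)+2v_x(1+u_x^2)(s_x+v_{xx}h)+h_xD,$$ define, for $t\in[-T,T]$, $$\|(r,s)(t)\|_{(u,v)(t)}=\inf_{h\in\mathcal A}\ \sum_{i=1}^6\int_{\mathbb R}|f_i(t,x)|\,e^{-\alpha|x|}\,dx\in[0,\infty].$$ **Theorem.** There is a constant $C=C(T,E_{u_0},E_{v_0},H_0,\alpha)>0$, depending only on the indicated quantities, such that for every smooth solution $(u,v)$ on $[-T,T]$ with initial data $(u_0,v_0)$ and every tangent vector $(r,s)$ along $(u,v)$, $$\|(r,s)(t)\|_{(u,v)(t)}\le C\,\|(r,s)(0)\|_{(u_0,v_0)}\qquad\text{for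 all }t\in[-T,T].$$ -/

import Mathlib

open MeasureTheory Set
open scoped ContDiff

noncomputable section

namespace Novikov

/-- The operator `(1 - ∂ₓ²)⁻¹` on the real line: convolution with `e^{-|x|} / 2`. -/
def invHelmholtz (p : ℝ → ℝ) (x : ℝ) : ℝ :=
  (1 / 2) * ∫ y, Real.exp (-|x - y|) * p y

/-- `P₁ = (1 - ∂ₓ²)⁻¹ (u² v + u uₓ vₓ + v uₓ² / 2)` for functions `u`, `v` of `x`.
By the symmetry of the system, `S₁` is `P1 v u`. -/
def P1 (u v : ℝ → ℝ) : ℝ → ℝ :=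
  invHelmholtz fun y =>
    u y ^ 2 * v y + u y * deriv u y * deriv v y + (1 / 2) * v y * deriv u y ^ 2

/-- `P₂ = (1 - ∂ₓ²)⁻¹ (uₓ² vₓ) / 2`. By the symmetry of the system, `S₂` is `P2 v u`. -/
def P2 (u v : ℝ → ℝ) (x : ℝ) : ℝ :=
  (1 / 2) * invHelmholtz (fun y => deriv u y ^ 2 * deriv v y) x

/-- Membership of a pair of differentiable functions in the space `Σ`:
`f, g ∈ H¹(ℝ)` and `fₓ gₓ ∈ L²(ℝ)`. -/
structure MemSigma (f g : ℝ → ℝ) : Prop where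
  fst : MemLp f 2 volume
  fst_deriv : MemLp (deriv f) 2 volume
  snd : MemLp g 2 volume
  snd_deriv : MemLp (deriv g) 2 volume
  mul_deriv : MemLp (fun x => deriv f x * deriv g x) 2 volume

/-- The energy `E_f = ∫ (f² + fₓ²) dx`. -/
def energy (f : ℝ → ℝ) : ℝ :=
  ∫ x, (f x ^ 2 + deriv f x ^ 2)

/-- The energy `H = ∫ (3u²v² + u²vₓ² + uₓ²v² + 4 u uₓ v vₓ - uₓ²vₓ²) dx`. -/
def energyH (u v : ℝ → ℝ) : ℝ :=
  ∫ x, (3 * u x ^ 2 * v x ^ 2 + u x ^ 2 * deriv v x ^ 2 + deriv u x ^ 2 * v x ^ 2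
    + 4 * u x * deriv u x * v x * deriv v x - deriv u x ^ 2 * deriv v x ^ 2)

/-- `w(t, x)` is `C^∞` on the closed strip `[-T, T] × ℝ`. -/
def SmoothOnStrip (T : ℝ) (w : ℝ → ℝ → ℝ) : Prop :=
  ContDiffOn ℝ ∞ (fun p : ℝ × ℝ => w p.1 p.2) (Icc (-T) T ×ˢ univ)

/-- `w(t, x)` is bounded on the strip `[-T, T] × ℝ`. -/
def BoundedOnStrip (T : ℝ) (w : ℝ → ℝ → ℝ) : Prop :=
  ∃ M : ℝ, ∀ t ∈ Icc (-T) T, ∀ x, |w t x| ≤ M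

/-- `(u, v)` is a smooth solution on `[-T, T] × ℝ` of the Cauchy problem for the two-component
Novikov system
`u_t + u v uₓ + ∂ₓP₁ + P₂ = 0`, `v_t + u v vₓ + ∂ₓS₁ + S₂ = 0`, `(u, v)(0, ·) = (u₀, v₀)`.
Smooth means `C^∞`, with spatial derivatives up to the second order bounded on the strip, and
with values in `Σ`. Time derivatives at `t = ± T` are one-sided. -/
structure IsSmoothSolution (T : ℝ) (u₀ v₀ : ℝ → ℝ) (u v : ℝ → ℝ → ℝ) : Prop where
  init_u : u 0 = u₀
  init_v : v 0 = v₀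
  smooth_u : SmoothOnStrip T u
  smooth_v : SmoothOnStrip T v
  memSigma : ∀ t ∈ Icc (-T) T, MemSigma (u t) (v t)
  bdd_u : BoundedOnStrip T u
  bdd_v : BoundedOnStrip T v
  bdd_ux : BoundedOnStrip T fun t => deriv (u t)
  bdd_vx : BoundedOnStrip T fun t => deriv (v t)
  bdd_uxx : BoundedOnStrip T fun t => deriv (deriv (u t))
  bdd_vxx : BoundedOnStrip T fun t => deriv (deriv (v t))
  eq_u : ∀ t ∈ Icc (-T) T, ∀ x,
    HasDerivWithinAt (fun τ => u τ x)
      (-(u t x * v t x * deriv (u t) x + deriv (P1 (u t) (v t)) x + P2 (u t) (v t) x))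
      (Icc (-T) T) t
  eq_v : ∀ t ∈ Icc (-T) T, ∀ x,
    HasDerivWithinAt (fun τ => v τ x)
      (-(u t x * v t x * deriv (v t) x + deriv (P1 (v t) (u t)) x + P2 (v t) (u t) x))
      (Icc (-T) T) t

/-- `w^ε = w + ε ρ + o(ε)` and `w^ε_x = w_x + ε ρ_x + o(ε)` as `ε → 0`, pointwise on
`[-T, T] × ℝ`, with difference quotients that are uniformly bounded for small `ε`. -/
structure HasExpansion (T : ℝ) (wε : ℝ → ℝ → ℝ → ℝ) (w ρ : ℝ → ℝ → ℝ) : Prop where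
  at_zero : ∀ t ∈ Icc (-T) T, ∀ x, wε 0 t x = w t x
  expand : ∀ t ∈ Icc (-T) T, ∀ x, HasDerivAt (fun ε => wε ε t x) (ρ t x) 0
  expand_deriv : ∀ t ∈ Icc (-T) T, ∀ x,
    HasDerivAt (fun ε => deriv (wε ε t) x) (deriv (ρ t) x) 0
  quotient_bdd : ∃ L ε₀ : ℝ, 0 < ε₀ ∧ ∀ ε, |ε| < ε₀ → ∀ t ∈ Icc (-T) T, ∀ x,
    |wε ε t x - w t x| ≤ L * |ε| ∧ |deriv (wε ε t) x - deriv (w t) x| ≤ L * |ε|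

/-- `(r, s)` is a (smooth) tangent vector along `(u, v)`: there is a one-parameter family
`(u^ε, v^ε)` of smooth solutions on `[-T, T] × ℝ` with
`u^ε = u + ε r + o(ε)`, `v^ε = v + ε s + o(ε)`. -/
structure IsTangentVector (T : ℝ) (u v r s : ℝ → ℝ → ℝ) : Prop where
  smooth_r : SmoothOnStrip T r
  smooth_s : SmoothOnStrip T s
  family : ∃ (ε₀ : ℝ) (uε vε : ℝ → ℝ → ℝ → ℝ), 0 < ε₀ ∧
    (∀ ε, |ε| < ε₀ → IsSmoothSolution T (uε ε 0) (vε ε 0) (uε ε) (vε ε)) ∧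
    HasExpansion T uε u r ∧ HasExpansion T vε v s

/-- The set `𝒜` of smooth, uniformly bounded solutions `h` on `[-T, T] × ℝ` of
`h_t + u v hₓ = (uₓ v + u vₓ) h + u s + v r`. -/
def shifts (T : ℝ) (u v r s : ℝ → ℝ → ℝ) : Set (ℝ → ℝ → ℝ) :=
  {h | SmoothOnStrip T h ∧ BoundedOnStrip T h ∧
    ∀ t ∈ Icc (-T) T, ∀ x,
      HasDerivWithinAt (fun τ => h τ x)
        (-(u t x * v t x * deriv (h t) x)
          + (deriv (u t) x * v t x + u t x * deriv (v t) x) * h t x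
          + u t x * s t x + v t x * r t x)
        (Icc (-T) T) t}

/-- `D = (1 + uₓ²)(1 + vₓ²)`. -/
def D (u v : ℝ → ℝ) (x : ℝ) : ℝ :=
  (1 + deriv u x ^ 2) * (1 + deriv v x ^ 2)

/-- The functions `f₁, …, f₆` (indexed from `0`), for functions `u, v, r, s, h` of `x`. -/
def f (u v r s h : ℝ → ℝ) : Fin 6 → ℝ → ℝ :=
  ![fun x => h x * D u v x,
    fun x => (r x + deriv u x * h x) * D u v x,
    fun x => (s x + deriv v x * h x) * D u v x,
    fun x => (deriv r x + deriv (deriv u) x * h x) * (1 + deriv v x ^ 2),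
    fun x => (deriv s x + deriv (deriv v) x * h x) * (1 + deriv u x ^ 2),
    fun x => 2 * deriv u x * (1 + deriv v x ^ 2) * (deriv r x + deriv (deriv u) x * h x)
      + 2 * deriv v x * (1 + deriv u x ^ 2) * (deriv s x + deriv (deriv v) x * h x)
      + deriv h x * D u v x]

/-- `𝓘_α(|g|) = ∫ |g(x)| e^{-α|x|} dx`, as an extended nonnegative number. -/
def Ialpha (α : ℝ) (g : ℝ → ℝ) : ENNReal :=
  ∫⁻ x, ENNReal.ofReal (|g x| * Real.exp (-α * |x|))

/-- The norm `‖(r, s)(t)‖_{(u, v)(t)}` of a tangent vector: the infimum over the horizontal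
shifts `h ∈ 𝒜` of `∑ᵢ 𝓘_α(|fᵢ(t, ·)|)`. -/
def tangentNorm (α T : ℝ) (u v r s : ℝ → ℝ → ℝ) (t : ℝ) : ENNReal :=
  ⨅ h ∈ shifts T u v r s, ∑ i : Fin 6, Ialpha α (f (u t) (v t) (r t) (s t) (h t) i)

end Novikov

end

/-!
Both components of the system are transported with the velocity `u v`, up to nonlocal terms.
A tangent vector `(r, s)` satisfies the linearized equations (`IsTangentVector.materialDeriv`), but
an `L¹` estimate for `(r, s)` alone would involve `sup |uₓ|` and `sup |vₓ|`, which the conserved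
energies do not control. This is repaired by the horizontal shift `h`: its equation says that `h` is the variation of the characteristics of the flow, so that
`w = r + uₓ h` and `r_x + u_xx h` are the variations of `u` and `uₓ` *along the flow*. In these
variables the material derivatives contain only the variables themselves and nonlocal terms
(`ShiftedTangent.materialDeriv_shiftedVar`, `ShiftedTangent.materialDeriv_shiftedDeriv`), because
the linearized source differs from the shifted one by the exact derivative of `h` times the source
(`hasDerivAt_shift_mul_source1`), which the resolvent `(1 - ∂ₓ²)⁻¹` absorbs.

The densities `fᵢ` then satisfy balance laws `(fᵢ)_t + (u v fᵢ)_x = gᵢ` in which, with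
`Σ = ∑ᵢ |fᵢ|` and `D = (1 + uₓ²)(1 + vₓ²)`,
`|gᵢ| ≤ C (Σ + D (1 - ∂ₓ²)⁻¹ Σ)` (`ShiftedTangent.abs_balance_le`).
The point of the particular combination `f₆` is that replacing `h_x` by `f₆` cancels the terms of
highest order in `uₓ` and `vₓ`. The constant `C` may not depend on `sup |uₓ|` or `sup |vₓ|`; it
depends on a bound for `u`, `v` and the nonlocal terms, and these are controlled by the conserved
energies (`IsSmoothSolution.hasUniformBounds`). Conservation of `H` moreover bounds `∫ uₓ² vₓ²`,
and hence `∫ (D - 1)`, so that `Σ ↦ D (1 - ∂ₓ²)⁻¹ Σ` is bounded on `L¹` with an exponential weight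
of rate `α < 1` (`integral_mul_invHelmholtz_weight_le`).

A weighted `L¹` estimate for transport equations (`HasMaterialDeriv.integral_abs_weight_le`) and
a Grönwall argument (`le_two_pow_mul_of_le_add`) propagate `∫ Σ` for each fixed shift `h` whose
initial norm is finite; the theorem follows by taking the infimum over `h`. For the Grönwall
argument `∫ Σ` has to be finite at all times. Since `h_x` is not assumed to be bounded, this is
proved separately, from the boundedness of the material derivative of `h_x`
(`HasMaterialDeriv.integrable_weight_of_bounded`).

All conservation and balance laws are integrated against the smooth weight `e^{-δ √(1 + x²)}`,
because no decay of the solutions at infinity beyond integrability is available.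
-/

open MeasureTheory Set
open scoped ContDiff

noncomputable section

namespace Novikov

/-! ### The Helmholtz resolvent and its derivative -/

/-- Continuous functions that are integrable against the kernel `e^{-|x - y|}`. Boundedness is
not required: `hₓ` for a horizontal shift `h` need not be bounded. -/
structure Admissible (p : ℝ → ℝ) : Prop where
  cont : Continuous p
  int : Integrable fun y => Real.exp (-|y|) * p y

/-- The operator `∂ₓ (1 - ∂ₓ²)⁻¹`, written as an integral operator. -/
def dxInvHelmholtz (p : ℝ → ℝ) (x : ℝ) : ℝ :=
  (1 / 2) * ∫ y, (if y ≤ x then -1 else 1) * (Real.exp (-|x - y|) * p y)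

/-- `∫_{-∞}^x e^y p(y) dy`. -/
def leftPart (p : ℝ → ℝ) (x : ℝ) : ℝ := ∫ y in Iic x, Real.exp y * p y

/-- `∫_x^∞ e^{-y} p(y) dy`. -/
def rightPart (p : ℝ → ℝ) (x : ℝ) : ℝ := ∫ y in Ioi x, Real.exp (-y) * p y

lemma integrable_exp_neg_mul_abs {c : ℝ} (hc : 0 < c) :
    Integrable fun x : ℝ => Real.exp (-c * |x|) := by
  have h1 : IntegrableOn (fun x : ℝ => Real.exp (-c * |x|)) (Ioi 0) := by
    refine (integrableOn_exp_mul_Ioi (a := -c) (by linarith) 0).congr_fun ?_ measurableSet_Ioi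
    intro x hx
    simp only [mem_Ioi] at hx
    simp [abs_of_pos hx]
  have h2 : IntegrableOn (fun x : ℝ => Real.exp (-c * |x|)) (Iic 0) := by
    refine (integrableOn_exp_mul_Iic (a := c) hc 0).congr_fun ?_ measurableSet_Iic
    intro x hx
    simp only [mem_Iic] at hx
    simp [abs_of_nonpos hx]
  rw [← integrableOn_univ, ← Iic_union_Ioi (a := (0 : ℝ))]
  exact h2.union h1

lemma integral_exp_neg_mul_abs {c : ℝ} (hc : 0 < c) :
    ∫ x : ℝ, Real.exp (-c * |x|) = 2 / c := by
  have := integral_comp_abs (f := fun x => Real.exp (-c * x))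
  rw [this, integral_exp_mul_Ioi (by linarith)]
  simp
  field_simp

namespace Admissible

variable {p q : ℝ → ℝ}

lemma of_bounded (hp : Continuous p) {M : ℝ}
    (hM : ∀ x, |p x| ≤ M) : Admissible p where
  cont := hp
  int := by
    have h := integrable_exp_neg_mul_abs one_pos
    simp only [neg_mul, one_mul] at h
    exact h.mul_bdd (c := M) hp.aestronglyMeasurable (Filter.Eventually.of_forall hM)

lemma add (hp : Admissible p) (hq : Admissible q) : Admissible fun x => p x + q x where
  cont := hp.cont.add hq.cont
  int := by
    simp only [mul_add]
    exact hp.int.add hq.int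

lemma const_mul (c : ℝ) (hp : Admissible p) : Admissible fun x => c * p x where
  cont := hp.cont.const_mul c
  int := by
    refine (hp.int.const_mul c).congr (Filter.Eventually.of_forall fun x => ?_)
    simp only; ring

lemma sub (hp : Admissible p) (hq : Admissible q) : Admissible fun x => p x - q x where
  cont := hp.cont.sub hq.cont
  int := by
    simp only [mul_sub]
    exact hp.int.sub hq.int

lemma mul_bounded (hp : Admissible p) (hq : Continuous q) {M : ℝ} (hM : ∀ x, |q x| ≤ M) :
    Admissible fun x => p x * q x where
  cont := hp.cont.mul hq
  int := by
    simp only [← mul_assoc]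
    exact hp.int.mul_bdd (c := M) hq.aestronglyMeasurable (Filter.Eventually.of_forall hM)

lemma integrable_kernel (hp : Admissible p) (x : ℝ) :
    Integrable fun y => Real.exp (-|x - y|) * p y := by
  refine (hp.int.abs.const_mul (Real.exp |x|)).mono' ?_ (Filter.Eventually.of_forall fun y => ?_)
  · have := hp.cont
    fun_prop
  · rw [norm_mul, Real.norm_eq_abs, Real.norm_eq_abs, abs_of_pos (Real.exp_pos _), abs_mul,
      abs_of_pos (Real.exp_pos _), ← mul_assoc, ← Real.exp_add]
    gcongr
    have := abs_sub_abs_le_abs_sub y x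
    rw [abs_sub_comm] at this
    linarith

lemma integrable_kernel_sign (hp : Admissible p) (x : ℝ) :
    Integrable fun y => (if y ≤ x then (-1 : ℝ) else 1) * (Real.exp (-|x - y|) * p y) := by
  refine (hp.integrable_kernel x).bdd_mul (c := 1) ?_ (Filter.Eventually.of_forall fun y => ?_)
  · exact (Measurable.ite measurableSet_Iic measurable_const
      measurable_const).aestronglyMeasurable
  · split_ifs <;> simp

lemma integrableOn_left (hp : Admissible p) (x : ℝ) :
    IntegrableOn (fun y => Real.exp y * p y) (Iic x) := by
  refine ((hp.integrable_kernel x).const_mul (Real.exp x)).integrableOn.congr_fun ?_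
    measurableSet_Iic
  intro y hy
  simp only [mem_Iic] at hy
  simp only
  rw [abs_of_nonneg (by linarith), ← mul_assoc, ← Real.exp_add]
  congr 2
  ring

lemma integrableOn_right (hp : Admissible p) (x : ℝ) :
    IntegrableOn (fun y => Real.exp (-y) * p y) (Ioi x) := by
  refine ((hp.integrable_kernel x).const_mul (Real.exp (-x))).integrableOn.congr_fun ?_
    measurableSet_Ioi
  intro y hy
  simp only [mem_Ioi] at hy
  simp only
  rw [abs_of_neg (by linarith), ← mul_assoc, ← Real.exp_add]
  congr 2
  ring

lemma setIntegral_Iic (x : ℝ) :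
    ∫ y in Iic x, Real.exp (-|x - y|) * p y = Real.exp (-x) * leftPart p x := by
  rw [leftPart, ← integral_const_mul]
  refine setIntegral_congr_fun measurableSet_Iic fun y hy => ?_
  simp only [mem_Iic] at hy
  rw [abs_of_nonneg (by linarith), ← mul_assoc, ← Real.exp_add]
  congr 2
  ring

lemma setIntegral_Ioi (x : ℝ) :
    ∫ y in Ioi x, Real.exp (-|x - y|) * p y = Real.exp x * rightPart p x := by
  rw [rightPart, ← integral_const_mul]
  refine setIntegral_congr_fun measurableSet_Ioi fun y hy => ?_
  simp only [mem_Ioi] at hy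
  rw [abs_of_neg (by linarith), ← mul_assoc, ← Real.exp_add]
  congr 2
  ring

lemma invHelmholtz_eq (hp : Admissible p) (x : ℝ) :
    invHelmholtz p x
      = (1 / 2) * (Real.exp (-x) * leftPart p x + Real.exp x * rightPart p x) := by
  rw [invHelmholtz, ← setIntegral_univ, ← Iic_union_Ioi (a := x),
    setIntegral_union (Iic_disjoint_Ioi le_rfl) measurableSet_Ioi
      (hp.integrable_kernel x).integrableOn (hp.integrable_kernel x).integrableOn,
    setIntegral_Iic, setIntegral_Ioi]

lemma dxInvHelmholtz_eq (hp : Admissible p) (x : ℝ) :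
    dxInvHelmholtz p x
      = (1 / 2) * (Real.exp x * rightPart p x - Real.exp (-x) * leftPart p x) := by
  have e1 : ∫ y in Iic x, (if y ≤ x then (-1 : ℝ) else 1) * (Real.exp (-|x - y|) * p y)
      = -(Real.exp (-x) * leftPart p x) := by
    rw [← setIntegral_Iic, ← integral_neg]
    refine setIntegral_congr_fun measurableSet_Iic fun y hy => ?_
    simp only [mem_Iic] at hy
    simp [hy]
  have e2 : ∫ y in Ioi x, (if y ≤ x then (-1 : ℝ) else 1) * (Real.exp (-|x - y|) * p y)
      = Real.exp x * rightPart p x := by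
    rw [← setIntegral_Ioi]
    refine setIntegral_congr_fun measurableSet_Ioi fun y hy => ?_
    simp only [mem_Ioi] at hy
    simp [hy]
  rw [dxInvHelmholtz, ← setIntegral_univ, ← Iic_union_Ioi (a := x),
    setIntegral_union (Iic_disjoint_Ioi le_rfl) measurableSet_Ioi
      (hp.integrable_kernel_sign x).integrableOn (hp.integrable_kernel_sign x).integrableOn,
    e1, e2]
  ring

lemma hasDerivAt_leftPart (hp : Admissible p) (x : ℝ) :
    HasDerivAt (leftPart p) (Real.exp x * p x) x := by
  have e : leftPart p = fun x => leftPart p 0 + ∫ y in (0 : ℝ)..x, Real.exp y * p y := by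
    ext x
    rw [← intervalIntegral.integral_Iic_sub_Iic (hp.integrableOn_left 0) (hp.integrableOn_left x)]
    simp [leftPart]
  rw [e]
  have hc : Continuous fun y => Real.exp y * p y := by
    have := hp.cont
    fun_prop
  exact (hc.integral_hasStrictDerivAt 0 x).hasDerivAt.const_add _

lemma hasDerivAt_rightPart (hp : Admissible p) (x : ℝ) :
    HasDerivAt (rightPart p) (-(Real.exp (-x) * p x)) x := by
  have e : rightPart p = fun x => rightPart p 0 - ∫ y in (0 : ℝ)..x, Real.exp (-y) * p y := by
    ext x
    rw [← intervalIntegral.integral_Ioi_sub_Ioi' (hp.integrableOn_right 0)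
      (hp.integrableOn_right x)]
    simp [rightPart]
  rw [e]
  have hc : Continuous fun y => Real.exp (-y) * p y := by
    have := hp.cont
    fun_prop
  exact (hc.integral_hasStrictDerivAt 0 x).hasDerivAt.const_sub _

lemma hasDerivAt_invHelmholtz (hp : Admissible p) (x : ℝ) :
    HasDerivAt (invHelmholtz p) (dxInvHelmholtz p x) x := by
  rw [funext hp.invHelmholtz_eq, hp.dxInvHelmholtz_eq]
  have h1 := (hasDerivAt_neg x).exp.mul (hp.hasDerivAt_leftPart x)
  have h2 := (Real.hasDerivAt_exp x).mul (hp.hasDerivAt_rightPart x)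
  refine ((h1.add h2).const_mul (1 / 2)).congr_deriv ?_
  have e : Real.exp x * Real.exp (-x) = 1 := by rw [← Real.exp_add]; simp
  linear_combination (0 : ℝ) * e

lemma hasDerivAt_dxInvHelmholtz (hp : Admissible p) (x : ℝ) :
    HasDerivAt (dxInvHelmholtz p) (invHelmholtz p x - p x) x := by
  rw [funext hp.dxInvHelmholtz_eq, hp.invHelmholtz_eq]
  have h1 := (hasDerivAt_neg x).exp.mul (hp.hasDerivAt_leftPart x)
  have h2 := (Real.hasDerivAt_exp x).mul (hp.hasDerivAt_rightPart x)
  refine ((h2.sub h1).const_mul (1 / 2)).congr_deriv ?_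
  have e : Real.exp x * Real.exp (-x) = 1 := by rw [← Real.exp_add]; simp
  linear_combination (-p x) * e

lemma continuous_invHelmholtz (hp : Admissible p) : Continuous (invHelmholtz p) :=
  continuous_iff_continuousAt.2 fun x => (hp.hasDerivAt_invHelmholtz x).continuousAt

lemma continuous_dxInvHelmholtz (hp : Admissible p) : Continuous (dxInvHelmholtz p) :=
  continuous_iff_continuousAt.2 fun x => (hp.hasDerivAt_dxInvHelmholtz x).continuousAt

lemma leftPart_deriv (hp : Admissible p) (hq : Admissible q) (h : ∀ x, HasDerivAt p (q x) x)
    (x : ℝ) : leftPart q x = Real.exp x * p x - leftPart p x := by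
  have hd : ∀ y ∈ Iic x, HasDerivAt (fun y => Real.exp y * p y)
      (Real.exp y * p y + Real.exp y * q y) y := fun y _ => (Real.hasDerivAt_exp y).mul (h y)
  have hi := (hp.integrableOn_left x).add (hq.integrableOn_left x)
  have ht := tendsto_zero_of_hasDerivAt_of_integrableOn_Iic hd hi (hp.integrableOn_left x)
  have := integral_Iic_of_hasDerivAt_of_tendsto' hd hi ht
  rw [integral_add (hp.integrableOn_left x) (hq.integrableOn_left x)] at this
  simp only [leftPart]
  linarith

lemma rightPart_deriv (hp : Admissible p) (hq : Admissible q) (h : ∀ x, HasDerivAt p (q x) x)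
    (x : ℝ) : rightPart q x = rightPart p x - Real.exp (-x) * p x := by
  have hd : ∀ y ∈ Ici x, HasDerivAt (fun y => Real.exp (-y) * p y)
      (-(Real.exp (-y) * p y) + Real.exp (-y) * q y) y := fun y _ => by
    refine ((hasDerivAt_neg y).exp.mul (h y)).congr_deriv ?_
    ring
  have hn : IntegrableOn (fun y => -(Real.exp (-y) * p y)) (Ioi x) :=
    (hp.integrableOn_right x).neg
  have hi := hn.add (hq.integrableOn_right x)
  have ht := tendsto_zero_of_hasDerivAt_of_integrableOn_Ioi (a := x)
    (fun y hy => hd y (mem_Ici.2 (le_of_lt (mem_Ioi.1 hy)))) hi (hp.integrableOn_right x)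
  have := integral_Ioi_of_hasDerivAt_of_tendsto' hd hi ht
  rw [integral_add hn (hq.integrableOn_right x)] at this
  rw [integral_neg] at this
  simp only [rightPart]
  linarith

/-- Integration by parts against the kernel. -/
lemma invHelmholtz_deriv (hp : Admissible p) (hq : Admissible q)
    (h : ∀ x, HasDerivAt p (q x) x) (x : ℝ) : invHelmholtz q x = dxInvHelmholtz p x := by
  rw [hq.invHelmholtz_eq, hp.dxInvHelmholtz_eq, leftPart_deriv hp hq h, rightPart_deriv hp hq h]
  have e : Real.exp x * Real.exp (-x) = 1 := by rw [← Real.exp_add]; simp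
  ring

/-- Integration by parts against the differentiated kernel, whose jump produces `-p`. -/
lemma dxInvHelmholtz_deriv (hp : Admissible p) (hq : Admissible q)
    (h : ∀ x, HasDerivAt p (q x) x) (x : ℝ) :
    dxInvHelmholtz q x = invHelmholtz p x - p x := by
  rw [hq.dxInvHelmholtz_eq, hp.invHelmholtz_eq, leftPart_deriv hp hq h, rightPart_deriv hp hq h]
  have e : Real.exp x * Real.exp (-x) = 1 := by rw [← Real.exp_add]; simp
  linear_combination (-p x) * e

lemma invHelmholtz_sub (hp : Admissible p) (hq : Admissible q) (x : ℝ) :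
    invHelmholtz (fun y => p y - q y) x = invHelmholtz p x - invHelmholtz q x := by
  simp only [invHelmholtz, mul_sub]
  rw [integral_sub (hp.integrable_kernel x) (hq.integrable_kernel x)]
  ring

lemma dxInvHelmholtz_sub (hp : Admissible p) (hq : Admissible q) (x : ℝ) :
    dxInvHelmholtz (fun y => p y - q y) x = dxInvHelmholtz p x - dxInvHelmholtz q x := by
  simp only [dxInvHelmholtz, mul_sub]
  rw [integral_sub (hp.integrable_kernel_sign x) (hq.integrable_kernel_sign x)]
  ring

/-- The operators are dominated by the resolvent of a pointwise bound. -/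
lemma abs_invHelmholtz_le (hp : Admissible p) (hq : Admissible q) (h : ∀ x, |q x| ≤ p x)
    (x : ℝ) : |invHelmholtz q x| ≤ invHelmholtz p x := by
  rw [invHelmholtz, abs_mul, abs_of_pos (by norm_num : (0 : ℝ) < 1 / 2), invHelmholtz]
  gcongr
  refine abs_integral_le_integral_abs.trans
    (integral_mono (hq.integrable_kernel x).abs (hp.integrable_kernel x) fun y => ?_)
  simp only [abs_mul, abs_of_pos (Real.exp_pos _)]
  gcongr
  exact h y

lemma abs_dxInvHelmholtz_le (hp : Admissible p) (hq : Admissible q) (h : ∀ x, |q x| ≤ p x)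
    (x : ℝ) : |dxInvHelmholtz q x| ≤ invHelmholtz p x := by
  rw [dxInvHelmholtz, abs_mul, abs_of_pos (by norm_num : (0 : ℝ) < 1 / 2), invHelmholtz]
  gcongr
  refine abs_integral_le_integral_abs.trans
    (integral_mono (hq.integrable_kernel_sign x).abs (hp.integrable_kernel x) fun y => ?_)
  have : |(if y ≤ x then (-1 : ℝ) else 1)| = 1 := by split_ifs <;> simp
  simp only [abs_mul, abs_of_pos (Real.exp_pos _), this, one_mul]
  gcongr
  exact h y

end Admissible

lemma invHelmholtz_const_mul (c : ℝ) (p : ℝ → ℝ) (x : ℝ) :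
    invHelmholtz (fun y => c * p y) x = c * invHelmholtz p x := by
  simp only [invHelmholtz, mul_left_comm _ c, integral_const_mul]

lemma invHelmholtz_nonneg {p : ℝ → ℝ} (hp : ∀ x, 0 ≤ p x) (x : ℝ) : 0 ≤ invHelmholtz p x := by
  rw [invHelmholtz]
  have : 0 ≤ ∫ y, Real.exp (-|x - y|) * p y :=
    integral_nonneg fun y => mul_nonneg (Real.exp_pos _).le (hp y)
  positivity

lemma Admissible.of_integrable {p : ℝ → ℝ} (hp : Continuous p) (hi : Integrable p) :
    Admissible p where
  cont := hp
  int := by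
    refine hi.bdd_mul (c := 1) (by fun_prop) (Filter.Eventually.of_forall fun y => ?_)
    rw [Real.norm_eq_abs, abs_of_pos (Real.exp_pos _)]
    exact Real.exp_le_one_iff.2 (by simp)

lemma invHelmholtz_le_integral {p : ℝ → ℝ} (hp : Continuous p) (h0 : ∀ x, 0 ≤ p x)
    (hi : Integrable p) (x : ℝ) : invHelmholtz p x ≤ (1 / 2) * ∫ y, p y := by
  rw [invHelmholtz]
  have := integral_mono ((Admissible.of_integrable hp hi).integrable_kernel x) hi fun y =>
    mul_le_of_le_one_left (h0 y) (Real.exp_le_one_iff.2 (by simp))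
  linarith

lemma invHelmholtz_const (c x : ℝ) : invHelmholtz (fun _ => c) x = c := by
  have h := integral_sub_left_eq_self (fun y : ℝ => Real.exp (-1 * |y|)) volume x
  rw [integral_exp_neg_mul_abs one_pos] at h
  simp only [neg_mul, one_mul] at h
  rw [invHelmholtz, integral_mul_const, h]
  ring

/-! ### Smooth exponential weights -/

/-- The smooth weight `e^{-δ √(1 + x²)}`, comparable to `e^{-δ|x|}`. -/
def weight (δ x : ℝ) : ℝ := Real.exp (-δ * √(1 + x ^ 2))

lemma weight_pos (δ x : ℝ) : 0 < weight δ x := Real.exp_pos _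

@[fun_prop]
lemma continuous_weight (δ : ℝ) : Continuous (weight δ) := by
  unfold weight
  fun_prop

lemma abs_le_sqrt_one_add_sq (x : ℝ) : |x| ≤ √(1 + x ^ 2) :=
  Real.abs_le_sqrt (by linarith)

lemma sqrt_one_add_sq_le (x : ℝ) : √(1 + x ^ 2) ≤ 1 + |x| := by
  rw [Real.sqrt_le_left (by positivity)]
  nlinarith [abs_nonneg x, sq_abs x]

lemma sqrt_one_add_sq_sub_le (x y : ℝ) : √(1 + x ^ 2) ≤ √(1 + y ^ 2) + |x - y| := by
  rw [Real.sqrt_le_left (by positivity)]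
  have h1 := Real.sq_sqrt (show 0 ≤ 1 + y ^ 2 by positivity)
  have h2 := abs_le_sqrt_one_add_sq y
  have h3 : y * (x - y) ≤ √(1 + y ^ 2) * |x - y| := by
    calc y * (x - y) ≤ |y * (x - y)| := le_abs_self _
      _ = |y| * |x - y| := abs_mul _ _
      _ ≤ _ := by gcongr
  nlinarith [sq_abs (x - y)]

lemma weight_le {δ : ℝ} (hδ : 0 ≤ δ) (x : ℝ) : weight δ x ≤ Real.exp (-δ * |x|) := by
  rw [weight, Real.exp_le_exp]
  have := mul_le_mul_of_nonneg_left (abs_le_sqrt_one_add_sq x) hδ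
  linarith

lemma weight_le_one {δ : ℝ} (hδ : 0 ≤ δ) (x : ℝ) : weight δ x ≤ 1 :=
  Real.exp_le_one_iff.2 (by have := mul_nonneg hδ (Real.sqrt_nonneg (1 + x ^ 2)); linarith)

lemma le_weight {δ : ℝ} (hδ : 0 ≤ δ) (x : ℝ) :
    Real.exp (-δ * |x|) ≤ Real.exp δ * weight δ x := by
  rw [weight, ← Real.exp_add, Real.exp_le_exp]
  have := mul_le_mul_of_nonneg_left (sqrt_one_add_sq_le x) hδ
  linarith

lemma weight_le_mul {δ : ℝ} (hδ : 0 ≤ δ) (x y : ℝ) :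
    weight δ x ≤ Real.exp (δ * |x - y|) * weight δ y := by
  rw [weight, weight, ← Real.exp_add, Real.exp_le_exp]
  have := mul_le_mul_of_nonneg_left (sqrt_one_add_sq_sub_le y x) hδ
  rw [abs_sub_comm] at this
  linarith

lemma integrable_weight {δ : ℝ} (hδ : 0 < δ) : Integrable (weight δ) :=
  (integrable_exp_neg_mul_abs hδ).mono' (by fun_prop) (Filter.Eventually.of_forall fun x => by
    rw [Real.norm_eq_abs, abs_of_pos (weight_pos _ _)]
    exact weight_le hδ.le x)

/-- The derivative of `weight δ`. -/
def weightDeriv (δ x : ℝ) : ℝ := -δ * (x / √(1 + x ^ 2)) * weight δ x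

lemma hasDerivAt_weight (δ x : ℝ) : HasDerivAt (weight δ) (weightDeriv δ x) x := by
  have h0 : (1 : ℝ) + x ^ 2 ≠ 0 := by positivity
  have h1 : HasDerivAt (fun x : ℝ => 1 + x ^ 2) (2 * x) x := by
    simpa using (hasDerivAt_pow 2 x).const_add 1
  refine ((h1.sqrt h0).const_mul (-δ)).exp.congr_deriv ?_
  rw [weightDeriv, weight]
  have : √(1 + x ^ 2) ≠ 0 := by positivity
  field_simp

@[fun_prop]
lemma continuous_weightDeriv (δ : ℝ) : Continuous (weightDeriv δ) := by
  unfold weightDeriv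
  have : ∀ x : ℝ, √(1 + x ^ 2) ≠ 0 := fun x => by positivity
  fun_prop (disch := assumption)

lemma abs_weightDeriv_le {δ : ℝ} (hδ : 0 ≤ δ) (x : ℝ) :
    |weightDeriv δ x| ≤ δ * weight δ x := by
  rw [weightDeriv, abs_mul, abs_of_pos (weight_pos δ x)]
  refine mul_le_mul_of_nonneg_right ?_ (weight_pos δ x).le
  rw [abs_mul, abs_neg, abs_of_nonneg hδ, abs_div, abs_of_nonneg (Real.sqrt_nonneg _)]
  refine mul_le_of_le_one_right hδ ?_
  exact div_le_one_of_le₀ (abs_le_sqrt_one_add_sq x) (Real.sqrt_nonneg _)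

lemma Admissible.of_integrable_weight {δ : ℝ} (h0 : 0 ≤ δ) (h1 : δ ≤ 1) {p : ℝ → ℝ}
    (hp : Continuous p) (hi : Integrable fun x => p x * weight δ x) : Admissible p where
  cont := hp
  int := by
    refine (hi.abs.const_mul (Real.exp 1)).mono' (by fun_prop)
      (Filter.Eventually.of_forall fun x => ?_)
    rw [norm_mul, Real.norm_eq_abs, Real.norm_eq_abs, abs_of_pos (Real.exp_pos _), abs_mul,
      abs_of_pos (weight_pos δ x)]
    have : Real.exp (-|x|) ≤ Real.exp 1 * weight δ x := by
      calc Real.exp (-|x|) ≤ Real.exp (-δ * |x|) := by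
            rw [Real.exp_le_exp]; nlinarith [abs_nonneg x]
        _ ≤ Real.exp δ * weight δ x := le_weight h0 x
        _ ≤ _ := by gcongr; exact (weight_pos δ x).le
    calc _ ≤ Real.exp 1 * weight δ x * |p x| := by gcongr
      _ = _ := by ring

/-- If `d` is integrable, then the resolvent maps `L¹(ω)` to `L¹((1 + d) ω)` for each exponential
weight `ω` of rate less than one: by Tonelli this is the bound
`∫ (1 + d(x)) ω(x) e^{-|x - y|} dx ≤ (2 / (1 - δ) + ∫ d) ω(y)`. -/
lemma integral_mul_invHelmholtz_weight_le {δ Q : ℝ} (h0 : 0 ≤ δ) (h1 : δ < 1) {d g : ℝ → ℝ}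
    (hd : Continuous d) (hd0 : ∀ x, 0 ≤ d x) (hdi : Integrable d) (hdQ : ∫ x, d x ≤ Q)
    (hg : Continuous g) (hg0 : ∀ x, 0 ≤ g x) (hgi : Integrable fun x => g x * weight δ x) :
    Integrable (fun x => (1 + d x) * invHelmholtz g x * weight δ x) ∧
    ∫ x, (1 + d x) * invHelmholtz g x * weight δ x
      ≤ (2 / (1 - δ) + Q) / 2 * ∫ x, g x * weight δ x := by
  have hA := Admissible.of_integrable_weight h0 h1.le hg hgi
  have hc : 0 < 1 - δ := by linarith
  have hQ : 0 ≤ Q := (integral_nonneg hd0).trans hdQ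
  have hK0 : ∀ x, 0 ≤ invHelmholtz g x := invHelmholtz_nonneg hg0
  have hKc := hA.continuous_invHelmholtz
  have hnn : ∀ x, 0 ≤ (1 + d x) * invHelmholtz g x * weight δ x := fun x =>
    mul_nonneg (mul_nonneg (by linarith [hd0 x]) (hK0 x)) (weight_pos δ x).le
  have hG0 : 0 ≤ ∫ x, g x * weight δ x :=
    integral_nonneg fun x => mul_nonneg (hg0 x) (weight_pos δ x).le
  -- the kernel bound
  have hker : ∀ y, ∫⁻ x, ENNReal.ofReal ((1 + d x) * weight δ x * Real.exp (-|x - y|))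
      ≤ ENNReal.ofReal ((2 / (1 - δ) + Q) * weight δ y) := by
    intro y
    have hi1 : Integrable fun x : ℝ => Real.exp (-(1 - δ) * |x - y|) :=
      (integrable_exp_neg_mul_abs hc).comp_sub_right y
    have hi : Integrable fun x => (Real.exp (-(1 - δ) * |x - y|) + d x) * weight δ y :=
      (hi1.add hdi).mul_const _
    have hle : ∀ x, (1 + d x) * weight δ x * Real.exp (-|x - y|)
        ≤ (Real.exp (-(1 - δ) * |x - y|) + d x) * weight δ y := by
      intro x
      have e : weight δ x * Real.exp (-|x - y|)
          ≤ Real.exp (-(1 - δ) * |x - y|) * weight δ y := by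
        calc _ ≤ Real.exp (δ * |x - y|) * weight δ y * Real.exp (-|x - y|) := by
              gcongr; exact weight_le_mul h0 x y
          _ = _ := by rw [mul_right_comm, ← Real.exp_add]; congr 2; ring
      have e2 : Real.exp (-(1 - δ) * |x - y|) ≤ 1 := by
        rw [Real.exp_le_one_iff]
        nlinarith [abs_nonneg (x - y)]
      have e3 := weight_pos δ y
      calc _ = (1 + d x) * (weight δ x * Real.exp (-|x - y|)) := by ring
        _ ≤ (1 + d x) * (Real.exp (-(1 - δ) * |x - y|) * weight δ y) := by
            gcongr; linarith [hd0 x]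
        _ = Real.exp (-(1 - δ) * |x - y|) * weight δ y
            + d x * (Real.exp (-(1 - δ) * |x - y|) * weight δ y) := by ring
        _ ≤ Real.exp (-(1 - δ) * |x - y|) * weight δ y + d x * (1 * weight δ y) := by
            gcongr; exact hd0 x
        _ = _ := by ring
    calc _ ≤ ∫⁻ x, ENNReal.ofReal ((Real.exp (-(1 - δ) * |x - y|) + d x) * weight δ y) :=
          lintegral_mono fun x => ENNReal.ofReal_le_ofReal (hle x)
      _ = ENNReal.ofReal (∫ x, (Real.exp (-(1 - δ) * |x - y|) + d x) * weight δ y) :=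
          (ofReal_integral_eq_lintegral_ofReal hi (Filter.Eventually.of_forall fun x =>
            mul_nonneg (add_nonneg (Real.exp_pos _).le (hd0 x)) (weight_pos δ y).le)).symm
      _ ≤ _ := by
          apply ENNReal.ofReal_le_ofReal
          rw [integral_mul_const, integral_add hi1 hdi,
            integral_sub_right_eq_self (fun x => Real.exp (-(1 - δ) * |x|)) y,
            integral_exp_neg_mul_abs hc]
          gcongr
          exact (weight_pos δ y).le
  have hKl : ∀ x, ENNReal.ofReal (invHelmholtz g x)
      = ENNReal.ofReal (1 / 2) * ∫⁻ y, ENNReal.ofReal (Real.exp (-|x - y|) * g y) := by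
    intro x
    rw [invHelmholtz, ENNReal.ofReal_mul (by norm_num), ofReal_integral_eq_lintegral_ofReal
      (hA.integrable_kernel x) (Filter.Eventually.of_forall fun y =>
        mul_nonneg (Real.exp_pos _).le (hg0 y))]
  have hmain : ∫⁻ x, ENNReal.ofReal ((1 + d x) * invHelmholtz g x * weight δ x)
      ≤ ENNReal.ofReal ((2 / (1 - δ) + Q) / 2 * ∫ x, g x * weight δ x) := by
    calc _ = ∫⁻ x, ∫⁻ y, ENNReal.ofReal (1 / 2) *
          (ENNReal.ofReal ((1 + d x) * weight δ x * Real.exp (-|x - y|))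
            * ENNReal.ofReal (g y)) := by
          refine lintegral_congr fun x => ?_
          rw [mul_right_comm, ENNReal.ofReal_mul
            (mul_nonneg (by linarith [hd0 x]) (weight_pos δ x).le), hKl, mul_left_comm,
            lintegral_const_mul _ (by fun_prop), ← lintegral_const_mul _ (by fun_prop)]
          congr 1
          refine lintegral_congr fun y => ?_
          rw [ENNReal.ofReal_mul (Real.exp_pos _).le, ENNReal.ofReal_mul
            (mul_nonneg (by linarith [hd0 x]) (weight_pos δ x).le), mul_assoc]
      _ = ∫⁻ y, ∫⁻ x, ENNReal.ofReal (1 / 2) *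
          (ENNReal.ofReal ((1 + d x) * weight δ x * Real.exp (-|x - y|))
            * ENNReal.ofReal (g y)) :=
          lintegral_lintegral_swap (by fun_prop)
      _ ≤ ∫⁻ y, ENNReal.ofReal ((2 / (1 - δ) + Q) / 2 * (g y * weight δ y)) := by
          refine lintegral_mono fun y => ?_
          simp only
          rw [lintegral_const_mul _ (by fun_prop), lintegral_mul_const _ (by fun_prop)]
          calc _ ≤ ENNReal.ofReal (1 / 2) * (ENNReal.ofReal ((2 / (1 - δ) + Q) * weight δ y)
                * ENNReal.ofReal (g y)) := by gcongr; exact hker y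
            _ = _ := by
              rw [← ENNReal.ofReal_mul (by have := weight_pos δ y; positivity),
                ← ENNReal.ofReal_mul (by norm_num)]
              congr 1; ring
      _ = _ := by
          rw [← ofReal_integral_eq_lintegral_ofReal (hgi.const_mul _)
            (Filter.Eventually.of_forall fun y => by
              have := weight_pos δ y; have := hg0 y; positivity), integral_const_mul]
  have hint : Integrable (fun x => (1 + d x) * invHelmholtz g x * weight δ x) := by
    refine ⟨by fun_prop, ?_⟩
    rw [hasFiniteIntegral_iff_ofReal (Filter.Eventually.of_forall hnn)]
    exact hmain.trans_lt ENNReal.ofReal_lt_top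
  refine ⟨hint, ?_⟩
  rw [← ofReal_integral_eq_lintegral_ofReal hint (Filter.Eventually.of_forall hnn)] at hmain
  exact (ENNReal.ofReal_le_ofReal_iff (by positivity)).1 hmain

/-- The resolvent is bounded on `L¹(ω)`. -/
lemma integral_invHelmholtz_weight_le {δ : ℝ} (h0 : 0 ≤ δ) (h1 : δ < 1) {g : ℝ → ℝ}
    (hg : Continuous g) (hg0 : ∀ x, 0 ≤ g x) (hgi : Integrable fun x => g x * weight δ x) :
    Integrable (fun x => invHelmholtz g x * weight δ x) ∧
    ∫ x, invHelmholtz g x * weight δ x ≤ 1 / (1 - δ) * ∫ x, g x * weight δ x := by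
  have := integral_mul_invHelmholtz_weight_le h0 h1 (d := fun _ => 0) (Q := 0) continuous_const
    (fun _ => le_rfl) (integrable_zero _ _ _) (by simp) hg hg0 hgi
  simp only [add_zero, one_mul] at this
  refine ⟨this.1, this.2.trans_eq ?_⟩
  ring

/-! ### Calculus on the closed strip -/

/-- The closed strip `[-T, T] × ℝ`. -/
def strip (T : ℝ) : Set (ℝ × ℝ) := Icc (-T) T ×ˢ univ

lemma mem_strip {T t x : ℝ} (ht : t ∈ Icc (-T) T) : (t, x) ∈ strip T := ⟨ht, mem_univ x⟩

lemma uniqueDiffOn_strip {T : ℝ} (hT : 0 < T) : UniqueDiffOn ℝ (strip T) :=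
  (uniqueDiffOn_Icc (by linarith)).prod uniqueDiffOn_univ

namespace SmoothOnStrip

variable {T : ℝ} {w z : ℝ → ℝ → ℝ}

lemma congr (hw : SmoothOnStrip T w) (h : ∀ t ∈ Icc (-T) T, ∀ x, z t x = w t x) :
    SmoothOnStrip T z :=
  ContDiffOn.congr hw fun p hp => h p.1 hp.1 p.2

lemma add (hw : SmoothOnStrip T w) (hz : SmoothOnStrip T z) :
    SmoothOnStrip T fun t x => w t x + z t x := ContDiffOn.add hw hz

lemma sub (hw : SmoothOnStrip T w) (hz : SmoothOnStrip T z) :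
    SmoothOnStrip T fun t x => w t x - z t x := ContDiffOn.sub hw hz

lemma neg (hw : SmoothOnStrip T w) : SmoothOnStrip T fun t x => -w t x := ContDiffOn.neg hw

lemma mul (hw : SmoothOnStrip T w) (hz : SmoothOnStrip T z) :
    SmoothOnStrip T fun t x => w t x * z t x := ContDiffOn.mul hw hz

lemma const (c : ℝ) : SmoothOnStrip T fun _ _ => c := contDiffOn_const

lemma pow (hw : SmoothOnStrip T w) (n : ℕ) : SmoothOnStrip T fun t x => w t x ^ n :=
  ContDiffOn.pow hw n

lemma continuousOn (hw : SmoothOnStrip T w) :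
    ContinuousOn (fun p : ℝ × ℝ => w p.1 p.2) (strip T) := ContDiffOn.continuousOn hw

lemma slice (hw : SmoothOnStrip T w) {t : ℝ} (ht : t ∈ Icc (-T) T) : ContDiff ℝ ∞ (w t) := by
  rw [← contDiffOn_univ]
  exact ContDiffOn.comp (t := strip T) (g := fun p : ℝ × ℝ => w p.1 p.2) hw
    (f := fun x : ℝ => (t, x)) (by fun_prop) fun x _ => mem_strip ht

lemma continuous (hw : SmoothOnStrip T w) {t : ℝ} (ht : t ∈ Icc (-T) T) : Continuous (w t) :=
  (hw.slice ht).continuous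

lemma hasDerivAt (hw : SmoothOnStrip T w) {t : ℝ} (ht : t ∈ Icc (-T) T) (x : ℝ) :
    HasDerivAt (w t) (deriv (w t) x) x :=
  ((hw.slice ht).differentiable (by simp) x).hasDerivAt

lemma continuousOn_time (hw : SmoothOnStrip T w) (x : ℝ) :
    ContinuousOn (fun t => w t x) (Icc (-T) T) :=
  ContinuousOn.comp (t := strip T) (g := fun p : ℝ × ℝ => w p.1 p.2) hw.continuousOn
    (f := fun t : ℝ => (t, x)) (by fun_prop) fun t ht => mem_strip ht

lemma hasFDerivWithinAt (hw : SmoothOnStrip T w) {p : ℝ × ℝ} (hp : p ∈ strip T) :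
    HasFDerivWithinAt (fun p : ℝ × ℝ => w p.1 p.2)
      (fderivWithin ℝ (fun p : ℝ × ℝ => w p.1 p.2) (strip T) p) (strip T) p :=
  (ContDiffOn.differentiableOn hw (by simp) p hp).hasFDerivWithinAt

lemma deriv_eq (hw : SmoothOnStrip T w) {t : ℝ} (ht : t ∈ Icc (-T) T) (x : ℝ) :
    deriv (w t) x = fderivWithin ℝ (fun p : ℝ × ℝ => w p.1 p.2) (strip T) (t, x) (0, 1) := by
  have h1 : HasDerivWithinAt (fun x : ℝ => (t, x)) ((0 : ℝ), (1 : ℝ)) univ x :=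
    ((hasDerivAt_const x t).prodMk (hasDerivAt_id x)).hasDerivWithinAt
  have := (hw.hasFDerivWithinAt (mem_strip (x := x) ht)).comp_hasDerivWithinAt x h1
    fun y _ => mem_strip ht
  rw [hasDerivWithinAt_univ] at this
  exact this.deriv

lemma hasDerivWithinAt_time (hw : SmoothOnStrip T w) {t : ℝ} (ht : t ∈ Icc (-T) T) (x : ℝ) :
    HasDerivWithinAt (fun τ => w τ x)
      (fderivWithin ℝ (fun p : ℝ × ℝ => w p.1 p.2) (strip T) (t, x) (1, 0)) (Icc (-T) T) t := by
  have h1 : HasDerivWithinAt (fun τ : ℝ => (τ, x)) ((1 : ℝ), (0 : ℝ)) (Icc (-T) T) t :=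
    ((hasDerivAt_id t).prodMk (hasDerivAt_const t x)).hasDerivWithinAt
  exact (hw.hasFDerivWithinAt (mem_strip (x := x) ht)).comp_hasDerivWithinAt t h1
    fun y hy => mem_strip hy

lemma fderivWithin_apply (hT : 0 < T) (hw : SmoothOnStrip T w) (v : ℝ × ℝ) :
    SmoothOnStrip T fun t x =>
      fderivWithin ℝ (fun p : ℝ × ℝ => w p.1 p.2) (strip T) (t, x) v :=
  (ContDiffOn.fderivWithin (m := ∞) (n := ∞) hw (uniqueDiffOn_strip hT) (by simp)).clm_apply
    contDiffOn_const

lemma dx (hT : 0 < T) (hw : SmoothOnStrip T w) : SmoothOnStrip T fun t => deriv (w t) :=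
  (hw.fderivWithin_apply hT (0, 1)).congr fun _ ht x => hw.deriv_eq ht x

/-- A function that is the time derivative of a smooth function is smooth. -/
lemma of_hasDerivWithinAt (hT : 0 < T) (hw : SmoothOnStrip T w)
    (h : ∀ t ∈ Icc (-T) T, ∀ x, HasDerivWithinAt (fun τ => w τ x) (z t x) (Icc (-T) T) t) :
    SmoothOnStrip T z :=
  (hw.fderivWithin_apply hT (1, 0)).congr fun t ht x =>
    (uniqueDiffOn_Icc (by linarith) t ht).eq_deriv _ (h t ht x) (hw.hasDerivWithinAt_time ht x)

/-- Equality of mixed derivatives, up to the boundary of the strip. -/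
lemma hasDerivWithinAt_dx (hT : 0 < T) (hw : SmoothOnStrip T w)
    (h : ∀ t ∈ Icc (-T) T, ∀ x, HasDerivWithinAt (fun τ => w τ x) (z t x) (Icc (-T) T) t)
    {t : ℝ} (ht : t ∈ Icc (-T) T) (x : ℝ) :
    HasDerivWithinAt (fun τ => deriv (w τ) x) (deriv (z t) x) (Icc (-T) T) t := by
  set W : ℝ × ℝ → ℝ := fun p => w p.1 p.2 with hW
  have hU := uniqueDiffOn_strip hT
  have hmem := mem_strip (x := x) ht
  have hz : ∀ y, z t y = fderivWithin ℝ W (strip T) (t, y) (1, 0) := fun y =>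
    (uniqueDiffOn_Icc (by linarith) t ht).eq_deriv _ (h t ht y) (hw.hasDerivWithinAt_time ht y)
  have hd : DifferentiableWithinAt ℝ (fderivWithin ℝ W (strip T)) (strip T) (t, x) :=
    (ContDiffOn.fderivWithin (m := ∞) (n := ∞) hw hU (by simp)).differentiableOn (by simp) _ hmem
  have hsym : IsSymmSndFDerivWithinAt ℝ W (strip T) (t, x) := by
    refine ContDiffWithinAt.isSymmSndFDerivWithinAt (n := ∞) (ContDiffOn.contDiffWithinAt hw hmem)
      (by
        rw [minSmoothness_of_isRCLikeNormedField]
        exact WithTop.coe_le_coe.2 (le_top (a := (2 : ℕ∞)))) hU ?_ hmem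
    rw [strip, interior_prod_eq, interior_Icc, interior_univ, closure_prod_eq,
      closure_Ioo (by linarith)]
    exact ⟨ht, subset_closure (mem_univ _)⟩
  have e2 : ∀ v v' : ℝ × ℝ,
      fderivWithin ℝ (fun p => fderivWithin ℝ W (strip T) p v) (strip T) (t, x) v'
        = fderivWithin ℝ (fderivWithin ℝ W (strip T)) (strip T) (t, x) v' v := by
    intro v v'
    have := (hd.hasFDerivWithinAt.clm_apply
      (hasFDerivWithinAt_const v (t, x) (strip T))).fderivWithin (hU _ hmem)
    rw [this]
    simp
  have h1 := (hw.fderivWithin_apply hT (0, 1)).hasDerivWithinAt_time ht x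
  have h2 := (hw.fderivWithin_apply hT (1, 0)).deriv_eq ht x
  have e3 : deriv (z t) x
      = deriv (fun y => fderivWithin ℝ W (strip T) (t, y) (1, 0)) x := by
    rw [funext hz]
  rw [e3, h2]
  have e4 := e2 (1, 0) (0, 1)
  have e5 := e2 (0, 1) (1, 0)
  simp only [Prod.mk.eta] at *
  rw [e4, hsym, ← e5]
  exact h1.congr (fun τ hτ => hw.deriv_eq hτ x) (hw.deriv_eq ht x)

end SmoothOnStrip

namespace BoundedOnStrip

variable {T : ℝ} {w z : ℝ → ℝ → ℝ}

lemma add (hw : BoundedOnStrip T w) (hz : BoundedOnStrip T z) :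
    BoundedOnStrip T fun t x => w t x + z t x := by
  obtain ⟨M, hM⟩ := hw
  obtain ⟨N, hN⟩ := hz
  exact ⟨M + N, fun t ht x => (abs_add_le _ _).trans (add_le_add (hM t ht x) (hN t ht x))⟩

lemma mul (hw : BoundedOnStrip T w) (hz : BoundedOnStrip T z) :
    BoundedOnStrip T fun t x => w t x * z t x := by
  obtain ⟨M, hM⟩ := hw
  obtain ⟨N, hN⟩ := hz
  refine ⟨M * N, fun t ht x => ?_⟩
  rw [abs_mul]
  exact mul_le_mul (hM t ht x) (hN t ht x) (abs_nonneg _) ((abs_nonneg _).trans (hM t ht x))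

lemma const (c : ℝ) : BoundedOnStrip T fun _ _ => c := ⟨|c|, fun _ _ _ => le_rfl⟩

lemma pow (hw : BoundedOnStrip T w) (n : ℕ) : BoundedOnStrip T fun t x => w t x ^ n := by
  obtain ⟨M, hM⟩ := hw
  refine ⟨M ^ n, fun t ht x => ?_⟩
  rw [abs_pow]
  exact pow_le_pow_left₀ (abs_nonneg _) (hM t ht x) n

lemma abs (hw : BoundedOnStrip T w) : BoundedOnStrip T fun t x => |w t x| := by
  obtain ⟨M, hM⟩ := hw
  exact ⟨M, fun t ht x => by rw [abs_abs]; exact hM t ht x⟩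

lemma exists_one_le (hw : BoundedOnStrip T w) :
    ∃ M, 1 ≤ M ∧ ∀ t ∈ Icc (-T) T, ∀ x, |w t x| ≤ M := by
  obtain ⟨M, hM⟩ := hw
  exact ⟨max 1 M, le_max_left _ _, fun t ht x => (hM t ht x).trans (le_max_right _ _)⟩

lemma admissible (hw : BoundedOnStrip T w) (hs : SmoothOnStrip T w) {t : ℝ}
    (ht : t ∈ Icc (-T) T) : Admissible (w t) := by
  obtain ⟨M, hM⟩ := hw
  exact Admissible.of_bounded (hs.continuous ht) (hM t ht)

lemma invHelmholtz (hw : BoundedOnStrip T w) (hs : SmoothOnStrip T w) :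
    BoundedOnStrip T fun t => invHelmholtz (w t) := by
  obtain ⟨M, hM⟩ := id hw
  refine ⟨M, fun t ht x => ?_⟩
  rw [← invHelmholtz_const M x]
  exact Admissible.abs_invHelmholtz_le (Admissible.of_bounded continuous_const fun _ => le_rfl)
    (hw.admissible hs ht) (hM t ht) x

lemma dxInvHelmholtz (hw : BoundedOnStrip T w) (hs : SmoothOnStrip T w) :
    BoundedOnStrip T fun t => dxInvHelmholtz (w t) := by
  obtain ⟨M, hM⟩ := id hw
  refine ⟨M, fun t ht x => ?_⟩
  rw [← invHelmholtz_const M x]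
  exact Admissible.abs_dxInvHelmholtz_le (Admissible.of_bounded continuous_const fun _ => le_rfl)
    (hw.admissible hs ht) (hM t ht) x

end BoundedOnStrip

/-- `w` is smooth on the strip and `w_t + a w_x = g` there: the derivative of `w` along the flow
of the velocity field `a` is `g`. -/
structure HasMaterialDeriv (T : ℝ) (a w g : ℝ → ℝ → ℝ) : Prop where
  smooth : SmoothOnStrip T w
  hasDerivWithinAt : ∀ t ∈ Icc (-T) T, ∀ x,
    HasDerivWithinAt (fun τ => w τ x) (-(a t x * deriv (w t) x) + g t x) (Icc (-T) T) t

namespace HasMaterialDeriv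

variable {T : ℝ} {a w g z k : ℝ → ℝ → ℝ}

lemma congr (h : HasMaterialDeriv T a w g)
    (hg : ∀ t ∈ Icc (-T) T, ∀ x, k t x = g t x) : HasMaterialDeriv T a w k where
  smooth := h.smooth
  hasDerivWithinAt t ht x := (h.hasDerivWithinAt t ht x).congr_deriv (by rw [hg t ht x])

lemma add (h : HasMaterialDeriv T a w g) (h' : HasMaterialDeriv T a z k) :
    HasMaterialDeriv T a (fun t x => w t x + z t x) fun t x => g t x + k t x where
  smooth := h.smooth.add h'.smooth
  hasDerivWithinAt t ht x := by
    refine ((h.hasDerivWithinAt t ht x).add (h'.hasDerivWithinAt t ht x)).congr_deriv ?_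
    rw [((h.smooth.hasDerivAt ht x).fun_add (h'.smooth.hasDerivAt ht x)).deriv]
    ring

lemma sub (h : HasMaterialDeriv T a w g) (h' : HasMaterialDeriv T a z k) :
    HasMaterialDeriv T a (fun t x => w t x - z t x) fun t x => g t x - k t x where
  smooth := h.smooth.sub h'.smooth
  hasDerivWithinAt t ht x := by
    refine ((h.hasDerivWithinAt t ht x).sub (h'.hasDerivWithinAt t ht x)).congr_deriv ?_
    rw [((h.smooth.hasDerivAt ht x).fun_sub (h'.smooth.hasDerivAt ht x)).deriv]
    ring

lemma mul (h : HasMaterialDeriv T a w g) (h' : HasMaterialDeriv T a z k) :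
    HasMaterialDeriv T a (fun t x => w t x * z t x) fun t x => g t x * z t x + w t x * k t x where
  smooth := h.smooth.mul h'.smooth
  hasDerivWithinAt t ht x := by
    refine ((h.hasDerivWithinAt t ht x).mul (h'.hasDerivWithinAt t ht x)).congr_deriv ?_
    rw [((h.smooth.hasDerivAt ht x).fun_mul (h'.smooth.hasDerivAt ht x)).deriv]
    ring

lemma const (c : ℝ) : HasMaterialDeriv T a (fun _ _ => c) fun _ _ => 0 where
  smooth := SmoothOnStrip.const c
  hasDerivWithinAt t ht x := by simpa using hasDerivWithinAt_const t _ c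

lemma smooth_right (hT : 0 < T) (ha : SmoothOnStrip T a) (h : HasMaterialDeriv T a w g) :
    SmoothOnStrip T g :=
  ((h.smooth.of_hasDerivWithinAt hT h.hasDerivWithinAt).add (ha.mul (h.smooth.dx hT))).congr
    fun t _ x => by ring

/-- Commutation of the material derivative with `∂ₓ`. -/
lemma dx (hT : 0 < T) (ha : SmoothOnStrip T a) (h : HasMaterialDeriv T a w g) :
    HasMaterialDeriv T a (fun t => deriv (w t))
      fun t x => deriv (g t) x - deriv (a t) x * deriv (w t) x where
  smooth := h.smooth.dx hT
  hasDerivWithinAt t ht x := by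
    refine (h.smooth.hasDerivWithinAt_dx hT h.hasDerivWithinAt ht x).congr_deriv ?_
    rw [(((ha.hasDerivAt ht x).fun_mul ((h.smooth.dx hT).hasDerivAt ht x)).fun_neg.fun_add
      ((h.smooth_right hT ha).hasDerivAt ht x)).deriv]
    ring

end HasMaterialDeriv

/-! ### Weighted balance laws -/

/-- The fundamental theorem of calculus for one-sided derivatives at `± T`. -/
lemma integral_time_eq_sub {T : ℝ} {z zt : ℝ → ℝ}
    (hd : ∀ t ∈ Icc (-T) T, HasDerivWithinAt z (zt t) (Icc (-T) T) t)
    (hc : ContinuousOn zt (Icc (-T) T)) {s t : ℝ} (hs : s ∈ Icc (-T) T)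
    (ht : t ∈ Icc (-T) T) : ∫ τ in s..t, zt τ = z t - z s := by
  have hsub : uIcc s t ⊆ Icc (-T) T := ordConnected_Icc.uIcc_subset hs ht
  refine intervalIntegral.integral_eq_sub_of_hasDeriv_right
    (fun τ hτ => ((hd τ (hsub hτ)).continuousWithinAt.mono hsub)) (fun τ hτ => ?_)
    (hc.mono hsub).intervalIntegrable
  have h1 : Icc (-T) T ∈ nhds τ :=
    Filter.mem_of_superset (Ioo_mem_nhds hτ.1 hτ.2) (Ioo_subset_Icc_self.trans hsub)
  exact ((hd τ (hsub (Ioo_subset_Icc_self hτ))).hasDerivAt h1).hasDerivWithinAt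

/-- `∫_{-R}^R φ(x) (1 - (x/R)²) dx` exhausts the integral of `φ`. -/
lemma tendsto_integral_cutoff {φ : ℝ → ℝ} (hφ : Integrable φ) :
    Filter.Tendsto (fun R : ℝ => ∫ x in (-R)..R, φ x * (1 - (x / R) ^ 2)) Filter.atTop
      (nhds (∫ x, φ x)) := by
  have h1 : Filter.Tendsto
      (fun R : ℝ => ∫ x, (Ioc (-R) R).indicator (fun x => φ x * (1 - (x / R) ^ 2)) x)
      Filter.atTop (nhds (∫ x, φ x)) := by
    refine tendsto_integral_filter_of_dominated_convergence (fun x => |φ x|) ?_ ?_ hφ.abs ?_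
    · filter_upwards with R
      refine AEStronglyMeasurable.indicator ?_ measurableSet_Ioc
      exact hφ.aestronglyMeasurable.mul (by fun_prop)
    · filter_upwards [Filter.eventually_gt_atTop 0] with R hR
      filter_upwards with x
      by_cases hx : x ∈ Ioc (-R) R
      · rw [indicator_of_mem hx, norm_mul, Real.norm_eq_abs, Real.norm_eq_abs]
        refine mul_le_of_le_one_right (abs_nonneg _) ?_
        have h2 : (x / R) ^ 2 ≤ 1 := by
          rw [div_pow, div_le_one (by positivity)]
          nlinarith [hx.1, hx.2]
        rw [abs_of_nonneg (by linarith)]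
        nlinarith [sq_nonneg (x / R)]
      · rw [indicator_of_notMem hx]
        simp
    · filter_upwards with x
      have h3 : Filter.Tendsto (fun R : ℝ => φ x * (1 - (x / R) ^ 2)) Filter.atTop
          (nhds (φ x * (1 - 0 ^ 2))) := by
        have : Filter.Tendsto (fun R : ℝ => x / R) Filter.atTop (nhds 0) :=
          Filter.Tendsto.const_div_atTop Filter.tendsto_id x
        exact ((this.pow 2).const_sub 1).const_mul _
      rw [show φ x * (1 - (0 : ℝ) ^ 2) = φ x by ring] at h3
      refine h3.congr' ?_
      filter_upwards [Filter.eventually_gt_atTop |x|] with R hR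
      rw [indicator_of_mem]
      have := abs_lt.1 hR
      exact ⟨this.1, this.2.le⟩
  refine h1.congr' ?_
  filter_upwards [Filter.eventually_ge_atTop 0] with R hR
  rw [intervalIntegral.integral_of_le (by linarith), integral_indicator measurableSet_Ioc]

lemma intervalIntegral_abs_le_integral_abs {φ ψ : ℝ → ℝ} {R : ℝ} (hR : 0 ≤ R)
    (hφ : Continuous φ) (hψ : Integrable ψ) (h0 : ∀ x, 0 ≤ ψ x)
    (h : ∀ x ∈ Icc (-R) R, |φ x| ≤ ψ x) :
    |∫ x in (-R)..R, φ x| ≤ ∫ x, ψ x := by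
  calc |∫ x in (-R)..R, φ x| ≤ ∫ x in (-R)..R, |φ x| :=
        intervalIntegral.abs_integral_le_integral_abs (by linarith)
    _ ≤ ∫ x in (-R)..R, ψ x :=
        intervalIntegral.integral_mono_on (by linarith) (hφ.abs.intervalIntegrable _ _)
          hψ.intervalIntegrable h
    _ = ∫ x in Ioc (-R) R, ψ x := intervalIntegral.integral_of_le (by linarith)
    _ ≤ ∫ x, ψ x := setIntegral_le_integral hψ (Filter.Eventually.of_forall h0)

/-- Spatial part of the balance law: if `qt + Φ' = G`, then the integral of `qt` against the
truncated weight is controlled by the weighted `L¹` norms of `Φ` and `G`. -/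
lemma abs_intervalIntegral_cutoff_le {δ A B R : ℝ} (hδ : 0 ≤ δ) (hR : 0 < R)
    {qt Φ G : ℝ → ℝ} (hqt : Continuous qt) (hG : Continuous G)
    (hΦ : ∀ x, HasDerivAt Φ (G x - qt x) x)
    (hΦi : Integrable fun x => Φ x * weight δ x) (hΦA : ∫ x, |Φ x| * weight δ x ≤ A)
    (hGi : Integrable fun x => G x * weight δ x) (hGB : ∫ x, |G x| * weight δ x ≤ B) :
    |∫ x in (-R)..R, qt x * (weight δ x * (1 - (x / R) ^ 2))|
      ≤ (δ + 2 / R) * A + B := by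
  have hΦc : Continuous Φ := continuous_iff_continuousAt.2 fun x => (hΦ x).continuousAt
  set ψ : ℝ → ℝ := fun x => weight δ x * (1 - (x / R) ^ 2) with hψdef
  set ψ' : ℝ → ℝ := fun x =>
    weightDeriv δ x * (1 - (x / R) ^ 2) + weight δ x * (-(2 * (x / R) * (1 / R))) with hψ'def
  have hψ : ∀ x, HasDerivAt ψ (ψ' x) x := by
    intro x
    refine (hasDerivAt_weight δ x).mul ?_
    refine ((((hasDerivAt_id x).div_const R).pow 2).const_sub 1).congr_deriv ?_
    simp
  have hψc : Continuous ψ := by fun_prop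
  have hψ'c : Continuous ψ' := by fun_prop
  have hle : ∀ x ∈ Icc (-R) R, 0 ≤ 1 - (x / R) ^ 2 ∧ 1 - (x / R) ^ 2 ≤ 1 := by
    intro x hx
    have h2 : (x / R) ^ 2 ≤ 1 := by
      rw [div_pow, div_le_one (by positivity)]
      nlinarith [hx.1, hx.2]
    exact ⟨by linarith, by nlinarith [sq_nonneg (x / R)]⟩
  have hψle : ∀ x ∈ Icc (-R) R, |ψ x| ≤ weight δ x := by
    intro x hx
    have := hle x hx
    rw [hψdef, abs_mul, abs_of_pos (weight_pos δ x), abs_of_nonneg this.1]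
    exact mul_le_of_le_one_right (weight_pos δ x).le this.2
  have hψ'le : ∀ x ∈ Icc (-R) R, |ψ' x| ≤ (δ + 2 / R) * weight δ x := by
    intro x hx
    have h1 := hle x hx
    have h2 : |x / R| ≤ 1 := by
      rw [abs_div, abs_of_pos hR, div_le_one hR]
      exact abs_le.2 hx
    have h3 := abs_weightDeriv_le hδ x
    have h4 := weight_pos δ x
    calc |ψ' x| ≤ |weightDeriv δ x * (1 - (x / R) ^ 2)|
          + |weight δ x * (-(2 * (x / R) * (1 / R)))| := abs_add_le _ _
      _ = |weightDeriv δ x| * (1 - (x / R) ^ 2) + weight δ x * (2 * |x / R| * (1 / R)) := by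
          rw [abs_mul, abs_mul, abs_of_nonneg h1.1, abs_of_pos h4, abs_neg, abs_mul, abs_mul,
            abs_of_pos (by positivity : 0 < 1 / R), abs_two]
      _ ≤ (δ * weight δ x) * 1 + weight δ x * (2 * 1 * (1 / R)) := by
          gcongr
          exacts [h1.1, h1.2]
      _ = _ := by ring
  -- integration by parts; the boundary terms vanish
  have hibp := intervalIntegral.integral_mul_deriv_eq_deriv_mul (a := -R) (b := R)
    (u := Φ) (v := ψ) (fun x _ => hΦ x) (fun x _ => hψ x)
    ((hG.sub hqt).intervalIntegrable _ _) (hψ'c.intervalIntegrable _ _)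
  have hb1 : ψ R = 0 := by simp [hψdef, hR.ne']
  have hb2 : ψ (-R) = 0 := by simp [hψdef, hR.ne']
  rw [hb1, hb2] at hibp
  have e : ∫ x in (-R)..R, qt x * ψ x
      = (∫ x in (-R)..R, G x * ψ x) + ∫ x in (-R)..R, Φ x * ψ' x := by
    have : ∫ x in (-R)..R, (G x - qt x) * ψ x
        = (∫ x in (-R)..R, G x * ψ x) - ∫ x in (-R)..R, qt x * ψ x := by
      simp only [sub_mul]
      exact intervalIntegral.integral_sub ((hG.mul hψc).intervalIntegrable _ _)
        ((hqt.mul hψc).intervalIntegrable _ _)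
    linarith
  have hG1 : |∫ x in (-R)..R, G x * ψ x| ≤ B := by
    refine (intervalIntegral_abs_le_integral_abs hR.le (hG.mul hψc)
      (ψ := fun x => |G x| * weight δ x) ?_ ?_ ?_).trans hGB
    · exact hGi.abs.congr (Filter.Eventually.of_forall fun x => by
        simp [abs_mul, abs_of_pos (weight_pos δ x)])
    · exact fun x => mul_nonneg (abs_nonneg _) (weight_pos δ x).le
    · intro x hx
      rw [Pi.mul_apply, abs_mul]
      gcongr
      exact hψle x hx
  have hΦ1 : |∫ x in (-R)..R, Φ x * ψ' x| ≤ (δ + 2 / R) * A := by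
    refine (intervalIntegral_abs_le_integral_abs hR.le (hΦc.mul hψ'c)
      (ψ := fun x => (δ + 2 / R) * (|Φ x| * weight δ x)) ?_ ?_ ?_).trans ?_
    · refine Integrable.const_mul ?_ _
      exact hΦi.abs.congr (Filter.Eventually.of_forall fun x => by
        simp [abs_mul, abs_of_pos (weight_pos δ x)])
    · intro x
      have := weight_pos δ x
      positivity
    · intro x hx
      rw [Pi.mul_apply, abs_mul]
      calc |Φ x| * |ψ' x| ≤ |Φ x| * ((δ + 2 / R) * weight δ x) := by
            gcongr; exact hψ'le x hx
        _ = _ := by ring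
    · rw [integral_const_mul]
      gcongr
  rw [e]
  refine (abs_add_le _ _).trans ?_
  linarith

/-- A balance law `q_t + Φ_x = G` on the strip, tested against an exponential weight: the change
of `∫ q ω` is controlled by the elapsed time and the weighted `L¹` norms of flux and source. -/
lemma abs_integral_weight_sub_le {T δ A B : ℝ} (hδ : 0 ≤ δ) {q qt Φ G : ℝ → ℝ → ℝ}
    (hq : ContinuousOn (fun p : ℝ × ℝ => q p.1 p.2) (strip T))
    (hqt : ContinuousOn (fun p : ℝ × ℝ => qt p.1 p.2) (strip T))
    (hd : ∀ t ∈ Icc (-T) T, ∀ x,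
      HasDerivWithinAt (fun τ => q τ x) (qt t x) (Icc (-T) T) t)
    (hG : ∀ t ∈ Icc (-T) T, Continuous (G t))
    (hΦ : ∀ t ∈ Icc (-T) T, ∀ x, HasDerivAt (Φ t) (G t x - qt t x) x)
    (hqi : ∀ t ∈ Icc (-T) T, Integrable fun x => q t x * weight δ x)
    {s t : ℝ} (hs : s ∈ Icc (-T) T) (ht : t ∈ Icc (-T) T)
    (hΦA : ∀ τ ∈ uIcc s t, Integrable (fun x => Φ τ x * weight δ x) ∧
      ∫ x, |Φ τ x| * weight δ x ≤ A)
    (hGB : ∀ τ ∈ uIcc s t, Integrable (fun x => G τ x * weight δ x) ∧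
      ∫ x, |G τ x| * weight δ x ≤ B) :
    |(∫ x, q t x * weight δ x) - ∫ x, q s x * weight δ x| ≤ |t - s| * (δ * A + B) := by
  have hsub : uIcc s t ⊆ Icc (-T) T := ordConnected_Icc.uIcc_subset hs ht
  have hslice : ∀ {z : ℝ → ℝ → ℝ}, ContinuousOn (fun p : ℝ × ℝ => z p.1 p.2) (strip T) →
      ∀ τ ∈ Icc (-T) T, Continuous (z τ) := by
    intro z hz τ hτ
    rw [← continuousOn_univ]
    exact ContinuousOn.comp (t := strip T) (g := fun p : ℝ × ℝ => z p.1 p.2) hz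
      (f := fun x : ℝ => (τ, x)) (by fun_prop) fun x _ => mem_strip hτ
  -- the estimate with the compactly supported weight
  have key : ∀ R : ℝ, 0 < R →
      |(∫ x in (-R)..R, q t x * weight δ x * (1 - (x / R) ^ 2))
        - ∫ x in (-R)..R, q s x * weight δ x * (1 - (x / R) ^ 2)|
      ≤ ((δ + 2 / R) * A + B) * |t - s| := by
    intro R hR
    set ψ : ℝ → ℝ := fun x => weight δ x * (1 - (x / R) ^ 2) with hψdef
    have hψc : Continuous ψ := by fun_prop
    have hftc : ∀ x, ∫ τ in s..t, qt τ x = q t x - q s x := fun x =>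
      integral_time_eq_sub (fun τ hτ => hd τ hτ x)
        (ContinuousOn.comp (t := strip T) (g := fun p : ℝ × ℝ => qt p.1 p.2) hqt
          (f := fun t : ℝ => (t, x)) (by fun_prop) fun t ht => mem_strip ht) hs ht
    have hFc : ContinuousOn (fun p : ℝ × ℝ => qt p.2 p.1 * ψ p.1)
        (uIcc (-R) R ×ˢ uIcc s t) := by
      refine ContinuousOn.mul ?_ (by fun_prop)
      exact ContinuousOn.comp (t := strip T) (g := fun p : ℝ × ℝ => qt p.1 p.2) hqt
        (f := fun p : ℝ × ℝ => (p.2, p.1)) (by fun_prop)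
        fun p hp => mem_strip (hsub hp.2)
    have hFi : IntegrableOn (Function.uncurry fun x τ => qt τ x * ψ x)
        (uIoc (-R) R ×ˢ uIoc s t) := by
      have : IntegrableOn (fun p : ℝ × ℝ => qt p.2 p.1 * ψ p.1) (uIcc (-R) R ×ˢ uIcc s t) :=
        hFc.integrableOn_compact (isCompact_uIcc.prod isCompact_uIcc)
      exact this.mono_set (prod_mono uIoc_subset_uIcc uIoc_subset_uIcc)
    have e : (∫ x in (-R)..R, q t x * weight δ x * (1 - (x / R) ^ 2))
        - (∫ x in (-R)..R, q s x * weight δ x * (1 - (x / R) ^ 2))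
        = ∫ τ in s..t, ∫ x in (-R)..R, qt τ x * ψ x := by
      rw [← intervalIntegral_intervalIntegral_swap hFi, ← intervalIntegral.integral_sub]
      · refine intervalIntegral.integral_congr fun x _ => ?_
        simp only [intervalIntegral.integral_mul_const]
        rw [hftc x, hψdef]
        ring
      · have := hslice hq t ht
        exact Continuous.intervalIntegrable (by fun_prop) _ _
      · have := hslice hq s hs
        exact Continuous.intervalIntegrable (by fun_prop) _ _
    rw [e]
    refine intervalIntegral.norm_integral_le_of_norm_le_const (f := fun τ =>
      ∫ x in (-R)..R, qt τ x * ψ x) fun τ hτ => ?_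
    have hτ' := uIoc_subset_uIcc hτ
    exact abs_intervalIntegral_cutoff_le hδ hR (hslice hqt τ (hsub hτ')) (hG τ (hsub hτ'))
      (hΦ τ (hsub hτ')) (hΦA τ hτ').1 (hΦA τ hτ').2 (hGB τ hτ').1 (hGB τ hτ').2
  have hl := ((tendsto_integral_cutoff (hqi t ht)).sub (tendsto_integral_cutoff (hqi s hs))).abs
  have hr : Filter.Tendsto (fun R : ℝ => ((δ + 2 / R) * A + B) * |t - s|) Filter.atTop
      (nhds (((δ + 0) * A + B) * |t - s|)) := by
    have : Filter.Tendsto (fun R : ℝ => 2 / R) Filter.atTop (nhds 0) :=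
      Filter.Tendsto.const_div_atTop Filter.tendsto_id 2
    exact (((this.const_add δ).mul_const A).add_const B).mul_const _
  have := le_of_tendsto_of_tendsto hl hr
    (by filter_upwards [Filter.eventually_gt_atTop 0] with R hR using key R hR)
  calc _ ≤ _ := this
    _ = _ := by ring

/-! ### Transport equations in weighted `L¹` and a Grönwall argument -/

lemma integrable_mul_weight_of_bounded {δ : ℝ} (hδ : 0 < δ) {p : ℝ → ℝ} (hp : Continuous p)
    {M : ℝ} (hM : ∀ x, |p x| ≤ M) : Integrable fun x => p x * weight δ x :=
  (integrable_weight hδ).bdd_mul (c := M) hp.aestronglyMeasurable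
    (Filter.Eventually.of_forall hM)

lemma integrable_mul_weight_of_le {δ : ℝ} {p q : ℝ → ℝ} (hp : Continuous p)
    (hq : Integrable fun x => q x * weight δ x) (h : ∀ x, |p x| ≤ q x) :
    Integrable fun x => p x * weight δ x := by
  refine hq.mono' (by fun_prop) (Filter.Eventually.of_forall fun x => ?_)
  rw [norm_mul, Real.norm_eq_abs, Real.norm_eq_abs, abs_of_pos (weight_pos δ x)]
  exact mul_le_mul_of_nonneg_right (h x) (weight_pos δ x).le

lemma integrable_abs_mul_weight {δ : ℝ} {p : ℝ → ℝ}
    (hp : Integrable fun x => p x * weight δ x) : Integrable fun x => |p x| * weight δ x :=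
  hp.abs.congr (Filter.Eventually.of_forall fun x => by
    simp [abs_mul, abs_of_pos (weight_pos δ x)])

lemma integral_mul_weight_mono {δ : ℝ} {p q : ℝ → ℝ}
    (hp : Integrable fun x => p x * weight δ x) (hq : Integrable fun x => q x * weight δ x)
    (h : ∀ x, p x ≤ q x) : ∫ x, p x * weight δ x ≤ ∫ x, q x * weight δ x :=
  integral_mono hp hq fun x => mul_le_mul_of_nonneg_right (h x) (weight_pos δ x).le

/-- Balance law for a function `F = β(w)` of a transported quantity `w`, where `F` satisfies
`F_t + a F_x = k`. -/
lemma HasMaterialDeriv.abs_integral_weight_sub_le {T δ A₀ S B : ℝ} (hT : 0 < T) (hδ : 0 ≤ δ)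
    {a F k : ℝ → ℝ → ℝ} (hF : HasMaterialDeriv T a F k) (ha : SmoothOnStrip T a)
    (hA₀ : ∀ t ∈ Icc (-T) T, ∀ x, |a t x| ≤ A₀)
    (hFi : ∀ t ∈ Icc (-T) T, Integrable fun x => F t x * weight δ x)
    {s t : ℝ} (hs : s ∈ Icc (-T) T) (ht : t ∈ Icc (-T) T)
    (hFS : ∀ τ ∈ uIcc s t, ∫ x, |F τ x| * weight δ x ≤ S)
    (hkB : ∀ τ ∈ uIcc s t,
      Integrable (fun x => (k τ x + deriv (a τ) x * F τ x) * weight δ x) ∧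
      ∫ x, |k τ x + deriv (a τ) x * F τ x| * weight δ x ≤ B) :
    |(∫ x, F t x * weight δ x) - ∫ x, F s x * weight δ x| ≤ |t - s| * (δ * (A₀ * S) + B) := by
  have hsub : uIcc s t ⊆ Icc (-T) T := ordConnected_Icc.uIcc_subset hs ht
  have hk := hF.smooth_right hT ha
  have hqt : SmoothOnStrip T fun t x => -(a t x * deriv (F t) x) + k t x :=
    (ha.mul (hF.smooth.dx hT)).neg.add hk
  refine Novikov.abs_integral_weight_sub_le (Φ := fun t x => a t x * F t x)
    (G := fun t x => k t x + deriv (a t) x * F t x) hδ hF.smooth.continuousOn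
    hqt.continuousOn hF.hasDerivWithinAt
    (fun t ht => (hk.add ((ha.dx hT).mul hF.smooth)).continuous ht)
    (fun t ht x => ?_) hFi hs ht (fun τ hτ => ?_) hkB
  · refine ((ha.hasDerivAt ht x).fun_mul (hF.smooth.hasDerivAt ht x)).congr_deriv ?_
    ring
  · have hτ' := hsub hτ
    have hi := (integrable_abs_mul_weight (hFi τ hτ')).const_mul A₀
    simp only [← mul_assoc] at hi
    have hle : ∀ x, |a τ x * F τ x| ≤ A₀ * |F τ x| := fun x => by
      rw [abs_mul]; gcongr; exact hA₀ τ hτ' x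
    have hint := integrable_mul_weight_of_le ((ha.mul hF.smooth).continuous hτ') hi hle
    refine ⟨hint, ?_⟩
    calc _ ≤ ∫ x, A₀ * |F τ x| * weight δ x :=
          integral_mul_weight_mono (integrable_abs_mul_weight hint) hi hle
      _ = A₀ * ∫ x, |F τ x| * weight δ x := by simp only [mul_assoc, integral_const_mul]
      _ ≤ A₀ * S := by
          gcongr
          · exact (abs_nonneg _).trans (hA₀ τ hτ' 0)
          · exact hFS τ hτ

lemma HasMaterialDeriv.comp {T : ℝ} {a w g : ℝ → ℝ → ℝ} (h : HasMaterialDeriv T a w g)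
    {β β' : ℝ → ℝ} (hβ : ContDiff ℝ ∞ β) (hβ' : ∀ y, HasDerivAt β (β' y) y) :
    HasMaterialDeriv T a (fun t x => β (w t x)) fun t x => β' (w t x) * g t x where
  smooth := hβ.comp_contDiffOn h.smooth
  hasDerivWithinAt t ht x := by
    refine ((hβ' (w t x)).comp_hasDerivWithinAt t (h.hasDerivWithinAt t ht x)).congr_deriv ?_
    have e : deriv (fun y => β (w t y)) x = _ :=
      ((hβ' (w t x)).comp x (h.smooth.hasDerivAt ht x)).deriv
    rw [e]
    ring

lemma contDiff_sqrt_sq_add {η : ℝ} (hη : 0 < η) :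
    ContDiff ℝ ∞ fun y : ℝ => √(y ^ 2 + η ^ 2) :=
  ContDiff.sqrt (by fun_prop) fun y => by positivity

lemma hasDerivAt_sqrt_sq_add {η : ℝ} (hη : 0 < η) (y : ℝ) :
    HasDerivAt (fun y : ℝ => √(y ^ 2 + η ^ 2)) (y / √(y ^ 2 + η ^ 2)) y := by
  have h1 : HasDerivAt (fun y : ℝ => y ^ 2 + η ^ 2) (2 * y) y := by
    simpa using (hasDerivAt_pow 2 y).add_const (η ^ 2)
  refine (h1.sqrt (by positivity)).congr_deriv ?_
  have : √(y ^ 2 + η ^ 2) ≠ 0 := by positivity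
  field_simp

/-- Weighted `L¹` estimate for the transport equation `w_t + a w_x = g`, that is
`w_t + (a w)_x = g + a_x w`. The modulus is regularized as `√(w² + η²)`. -/
lemma HasMaterialDeriv.integral_abs_weight_le {T δ A₀ A₁ S B : ℝ} (hT : 0 < T) (hδ : 0 < δ)
    {a w g : ℝ → ℝ → ℝ} (hw : HasMaterialDeriv T a w g) (ha : SmoothOnStrip T a)
    (hA₀ : ∀ t ∈ Icc (-T) T, ∀ x, |a t x| ≤ A₀)
    (hA₁ : ∀ t ∈ Icc (-T) T, ∀ x, |deriv (a t) x| ≤ A₁)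
    (hwi : ∀ t ∈ Icc (-T) T, Integrable fun x => w t x * weight δ x)
    {s t : ℝ} (hs : s ∈ Icc (-T) T) (ht : t ∈ Icc (-T) T)
    (hwS : ∀ τ ∈ uIcc s t, ∫ x, |w τ x| * weight δ x ≤ S)
    (hgB : ∀ τ ∈ uIcc s t,
      Integrable (fun x => (g τ x + deriv (a τ) x * w τ x) * weight δ x) ∧
      ∫ x, |g τ x + deriv (a τ) x * w τ x| * weight δ x ≤ B) :
    ∫ x, |w t x| * weight δ x
      ≤ (∫ x, |w s x| * weight δ x) + |t - s| * (δ * (A₀ * S) + B) := by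
  have hsub : uIcc s t ⊆ Icc (-T) T := ordConnected_Icc.uIcc_subset hs ht
  set I := ∫ x, weight δ x with hI
  have hA₁0 : 0 ≤ A₁ := (abs_nonneg _).trans (hA₁ t ht 0)
  have hωi := integrable_weight hδ
  -- the estimate for the regularized modulus
  have key : ∀ η : ℝ, 0 < η → ∫ x, |w t x| * weight δ x
      ≤ ((∫ x, |w s x| * weight δ x) + η * I)
        + |t - s| * (δ * (A₀ * (S + η * I)) + (B + A₁ * (η * I))) := by
    intro η hη
    set β : ℝ → ℝ := fun y => √(y ^ 2 + η ^ 2) with hβ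
    have hβpos : ∀ y, 0 < β y := fun y => by simp only [hβ]; positivity
    have hβsq : ∀ y, β y ^ 2 = y ^ 2 + η ^ 2 := fun y => Real.sq_sqrt (by positivity)
    have hβge : ∀ y, |y| ≤ β y := fun y => Real.abs_le_sqrt (by nlinarith [sq_nonneg η])
    have hβη : ∀ y, η ≤ β y := fun y => by
      have := Real.abs_le_sqrt (show η ^ 2 ≤ y ^ 2 + η ^ 2 by nlinarith [sq_nonneg y])
      rwa [abs_of_pos hη] at this
    have hβle : ∀ y, β y ≤ |y| + η := fun y => by
      simp only [hβ]
      rw [Real.sqrt_le_left (by positivity)]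
      nlinarith [abs_nonneg y, sq_abs y]
    have hF := hw.comp (contDiff_sqrt_sq_add hη) (hasDerivAt_sqrt_sq_add hη)
    have hbd : ∀ τ ∈ Icc (-T) T, Integrable fun x => (|w τ x| + η) * weight δ x := by
      intro τ hτ
      simp only [add_mul]
      exact (integrable_abs_mul_weight (hwi τ hτ)).add (hωi.const_mul η)
    have hbde : ∀ τ ∈ Icc (-T) T, ∫ x, (|w τ x| + η) * weight δ x
        = (∫ x, |w τ x| * weight δ x) + η * I := by
      intro τ hτ
      simp only [add_mul]
      rw [integral_add (integrable_abs_mul_weight (hwi τ hτ)) (hωi.const_mul η),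
        integral_const_mul]
    have hFabs : ∀ τ x, |β (w τ x)| = β (w τ x) := fun τ x => abs_of_pos (hβpos _)
    have hFi : ∀ τ ∈ Icc (-T) T, Integrable fun x => β (w τ x) * weight δ x := fun τ hτ =>
      integrable_mul_weight_of_le (hF.smooth.continuous hτ) (hbd τ hτ) fun x => by
        rw [hFabs]; exact hβle _
    have hFle : ∀ τ ∈ Icc (-T) T, ∫ x, β (w τ x) * weight δ x
        ≤ (∫ x, |w τ x| * weight δ x) + η * I := by
      intro τ hτ
      rw [← hbde τ hτ]
      exact integral_mul_weight_mono (hFi τ hτ) (hbd τ hτ) fun x => hβle _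
    -- the source term for the regularized modulus
    have hsrc : ∀ y g₀ a₁ : ℝ, |a₁| ≤ A₁ →
        |y / β y * g₀ + a₁ * β y| ≤ |g₀ + a₁ * y| + A₁ * η := by
      intro y g₀ a₁ h1
      have e : y / β y * g₀ + a₁ * β y = y / β y * (g₀ + a₁ * y) + a₁ * (η ^ 2 / β y) := by
        have := hβpos y
        field_simp
        rw [hβsq]
        ring
      rw [e]
      refine (abs_add_le _ _).trans (add_le_add ?_ ?_)
      · rw [abs_mul]
        refine mul_le_of_le_one_left (abs_nonneg _) ?_
        rw [abs_div, abs_of_pos (hβpos y)]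
        exact div_le_one_of_le₀ (hβge y) (hβpos y).le
      · rw [abs_mul]
        refine mul_le_mul h1 ?_ (abs_nonneg _) hA₁0
        rw [abs_of_nonneg (div_nonneg (sq_nonneg _) (hβpos y).le), div_le_iff₀ (hβpos y), sq]
        exact mul_le_mul_of_nonneg_left (hβη y) hη.le
    have hmain := hF.abs_integral_weight_sub_le (S := S + η * I) (B := B + A₁ * (η * I)) hT hδ.le
      ha hA₀ hFi hs ht ?_ ?_
    · have h1 := (abs_le.1 hmain).2
      have h2 := hFle s hs
      have h3 : ∫ x, |w t x| * weight δ x ≤ ∫ x, β (w t x) * weight δ x :=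
        integral_mul_weight_mono (integrable_abs_mul_weight (hwi t ht)) (hFi t ht)
          fun x => hβge _
      linarith
    · intro τ hτ
      change ∫ x, |β (w τ x)| * weight δ x ≤ _
      simp only [hFabs]
      exact (hFle τ (hsub hτ)).trans (by linarith [hwS τ hτ])
    · intro τ hτ
      obtain ⟨hi, hB⟩ := hgB τ hτ
      have hτ' := hsub hτ
      have hbi : Integrable fun x =>
          (|g τ x + deriv (a τ) x * w τ x| + A₁ * η) * weight δ x := by
        simp only [add_mul]
        exact (integrable_abs_mul_weight hi).add (hωi.const_mul (A₁ * η))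
      have hle := fun x => hsrc (w τ x) (g τ x) (deriv (a τ) x) (hA₁ τ hτ' x)
      have hGi := integrable_mul_weight_of_le (p := fun x =>
        w τ x / β (w τ x) * g τ x + deriv (a τ) x * β (w τ x))
        (((hF.smooth_right hT ha).add ((ha.dx hT).mul hF.smooth)).continuous hτ') hbi hle
      refine ⟨hGi, ?_⟩
      calc _ ≤ ∫ x, (|g τ x + deriv (a τ) x * w τ x| + A₁ * η) * weight δ x :=
            integral_mul_weight_mono (integrable_abs_mul_weight hGi) hbi hle
        _ = (∫ x, |g τ x + deriv (a τ) x * w τ x| * weight δ x) + A₁ * η * I := by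
            simp only [add_mul]
            rw [integral_add (integrable_abs_mul_weight hi) (hωi.const_mul (A₁ * η)),
              integral_const_mul]
        _ ≤ _ := by linarith
  have hlim : Filter.Tendsto (fun η : ℝ => ((∫ x, |w s x| * weight δ x) + η * I)
        + |t - s| * (δ * (A₀ * (S + η * I)) + (B + A₁ * (η * I)))) (nhdsWithin 0 (Ioi 0))
      (nhds (((∫ x, |w s x| * weight δ x) + 0 * I)
        + |t - s| * (δ * (A₀ * (S + 0 * I)) + (B + A₁ * (0 * I))))) := by
    refine Filter.Tendsto.mono_left (Continuous.tendsto ?_ 0) nhdsWithin_le_nhds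
    fun_prop
  have := ge_of_tendsto hlim (by filter_upwards [self_mem_nhdsWithin] with η hη using key η hη)
  simpa using this

/-- A Grönwall inequality for bounded, possibly discontinuous functions: if over each time interval
`N` grows at most by its supremum times `C` times the length of the interval, then it grows at most
by a factor `2ⁿ`, where `C T ≤ n / 2`. -/
lemma le_two_pow_mul_of_le_add {T C : ℝ} (hC : 0 ≤ C) {n : ℕ} (hn : 0 < n)
    (hCn : 2 * C * T ≤ n) {N : ℝ → ℝ} {S₀ : ℝ} (hN : ∀ t ∈ Icc (-T) T, N t ≤ S₀)
    (h0 : ∀ t ∈ Icc (-T) T, 0 ≤ N t)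
    (h : ∀ s ∈ Icc (-T) T, ∀ t ∈ Icc (-T) T, ∀ S, (∀ τ ∈ uIcc s t, N τ ≤ S) →
      N t ≤ N s + |t - s| * (C * S)) :
    ∀ t ∈ Icc (-T) T, N t ≤ 2 ^ n * N 0 := by
  have hnR : (0 : ℝ) < n := by exact_mod_cast hn
  -- one step of length `T / n`
  have step : ∀ s ∈ Icc (-T) T, ∀ t ∈ Icc (-T) T, |t - s| ≤ T / n → N t ≤ 2 * N s := by
    intro s hs t ht hst
    have hsub : uIcc s t ⊆ Icc (-T) T := ordConnected_Icc.uIcc_subset hs ht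
    have hbdd : BddAbove (N '' uIcc s t) := ⟨S₀, by
      rintro _ ⟨τ, hτ, rfl⟩
      exact hN τ (hsub hτ)⟩
    set S := sSup (N '' uIcc s t) with hS
    have hle : ∀ τ ∈ uIcc s t, N τ ≤ S := fun τ hτ => le_csSup hbdd ⟨τ, hτ, rfl⟩
    have hS0 : 0 ≤ S := (h0 s hs).trans (hle s left_mem_uIcc)
    have h1 : ∀ τ ∈ uIcc s t, N τ ≤ N s + S / 2 := by
      intro τ hτ
      have hsubτ : uIcc s τ ⊆ uIcc s t := uIcc_subset_uIcc_left hτ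
      have h2 := h s hs τ (hsub hτ) S fun σ hσ => hle σ (hsubτ hσ)
      have h3 : |τ - s| ≤ T / n := by
        have := abs_sub_left_of_mem_uIcc hτ
        exact this.trans hst
      have h4 : |τ - s| * (C * S) ≤ T / n * (C * S) := by gcongr
      have h5 : T / n * C ≤ 1 / 2 := by
        rw [div_mul_eq_mul_div, div_le_iff₀ hnR]
        linarith
      nlinarith
    have h6 : S ≤ N s + S / 2 := csSup_le (nonempty_uIcc.image N) (by
      rintro _ ⟨τ, hτ, rfl⟩
      exact h1 τ hτ)
    linarith [hle t right_mem_uIcc]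
  intro t ht
  have ind : ∀ k : ℕ, k ≤ n → N (k / n * t) ≤ 2 ^ k * N 0 := by
    have hmem : ∀ k : ℕ, k ≤ n → (k / n * t : ℝ) ∈ Icc (-T) T := by
      intro k hk
      have h1 : |(k / n * t : ℝ)| ≤ T := by
        rw [abs_mul, abs_of_nonneg (by positivity)]
        have h2 : (k / n : ℝ) ≤ 1 := by
          rw [div_le_one hnR]; exact_mod_cast hk
        exact (mul_le_of_le_one_left (abs_nonneg t) h2).trans (abs_le.2 ht)
      exact abs_le.1 h1
    intro k
    induction k with
    | zero => intro _; simp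
    | succ k ih =>
      intro hk
      have h1 := step _ (hmem k (by omega)) _ (hmem (k + 1) hk) (by
        have e : ((k + 1 : ℕ) / n * t : ℝ) - k / n * t = t / n := by
          push_cast; ring
        rw [e, abs_div, abs_of_pos hnR]
        gcongr
        exact abs_le.2 ht)
      have h2 := ih (by omega)
      calc _ ≤ _ := h1
        _ ≤ 2 * (2 ^ k * N 0) := by linarith
        _ = _ := by ring
  have := ind n le_rfl
  rwa [div_self hnR.ne', one_mul] at this

/-! ### Smooth solutions and their conserved energies -/

/-- The density `u² v + u uₓ vₓ + v uₓ² / 2`, so that `P₁` is its image under the resolvent. -/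
def source1 (u v : ℝ → ℝ) (y : ℝ) : ℝ :=
  u y ^ 2 * v y + u y * deriv u y * deriv v y + (1 / 2) * v y * deriv u y ^ 2

/-- The density `uₓ² vₓ`, so that `P₂` is half its image under the resolvent. -/
def source2 (u v : ℝ → ℝ) (y : ℝ) : ℝ := deriv u y ^ 2 * deriv v y

/-- The nonlocal term `∂ₓP₁ + P₂` of the equation for `u`. -/
def nonlocalU (u v : ℝ → ℝ) (x : ℝ) : ℝ :=
  dxInvHelmholtz (source1 u v) x + (1 / 2) * invHelmholtz (source2 u v) x

/-- The nonlocal term `P₁ + ∂ₓP₂` of the equation for `uₓ`. -/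
def nonlocalV (u v : ℝ → ℝ) (x : ℝ) : ℝ :=
  invHelmholtz (source1 u v) x + (1 / 2) * dxInvHelmholtz (source2 u v) x

/-- The velocity `u v` by which both components are transported. -/
def velocity (u v : ℝ → ℝ → ℝ) (t x : ℝ) : ℝ := u t x * v t x

lemma velocity_comm (u v : ℝ → ℝ → ℝ) : velocity v u = velocity u v := by
  ext t x
  exact mul_comm _ _

/-- The energy density `u² + uₓ²`. -/
def energyDensity (u : ℝ → ℝ) (x : ℝ) : ℝ := u x ^ 2 + deriv u x ^ 2

lemma energyDensity_nonneg (u : ℝ → ℝ) (x : ℝ) : 0 ≤ energyDensity u x := by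
  unfold energyDensity
  positivity

lemma hasDerivAt_nonlocalU {u v : ℝ → ℝ} (h1 : Admissible (source1 u v))
    (h2 : Admissible (source2 u v)) (x : ℝ) :
    HasDerivAt (nonlocalU u v) (nonlocalV u v x - source1 u v x) x := by
  refine ((h1.hasDerivAt_dxInvHelmholtz x).add
    ((h2.hasDerivAt_invHelmholtz x).const_mul (1 / 2))).congr_deriv ?_
  rw [nonlocalV]
  ring

lemma hasDerivAt_nonlocalV {u v : ℝ → ℝ} (h1 : Admissible (source1 u v))
    (h2 : Admissible (source2 u v)) (x : ℝ) :
    HasDerivAt (nonlocalV u v) (nonlocalU u v x - (1 / 2) * source2 u v x) x := by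
  refine ((h1.hasDerivAt_invHelmholtz x).add
    ((h2.hasDerivAt_dxInvHelmholtz x).const_mul (1 / 2))).congr_deriv ?_
  rw [nonlocalU]
  ring

lemma abs_source1_le {M a b c d : ℝ} (ha : |a| ≤ M) (hb : |b| ≤ M) (hd : |d| ≤ M) :
    |a ^ 2 * b + a * c * d + (1 / 2) * b * c ^ 2| ≤ 2 * M * (a ^ 2 + c ^ 2) := by
  have hM : 0 ≤ M := (abs_nonneg _).trans ha
  have h1 : |a ^ 2 * b| ≤ a ^ 2 * M := by
    rw [abs_mul, abs_of_nonneg (sq_nonneg a)]; gcongr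
  have h2 : |a * c * d| ≤ (a ^ 2 + c ^ 2) / 2 * M := by
    rw [abs_mul]
    refine mul_le_mul ?_ hd (abs_nonneg _) (by positivity)
    rw [abs_mul]
    nlinarith [sq_nonneg (|a| - |c|), sq_abs a, sq_abs c]
  have h3 : |(1 / 2) * b * c ^ 2| ≤ (1 / 2) * M * c ^ 2 := by
    rw [abs_mul, abs_mul, abs_of_nonneg (sq_nonneg c), abs_of_pos (by norm_num : (0 : ℝ) < 1 / 2)]
    gcongr
  have := abs_add_three (a ^ 2 * b) (a * c * d) ((1 / 2) * b * c ^ 2)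
  have h4 : 0 ≤ M * a ^ 2 := by positivity
  have h5 : 0 ≤ M * c ^ 2 := by positivity
  nlinarith

lemma abs_source2_le {M a c d : ℝ} (hd : |d| ≤ M) :
    |c ^ 2 * d| ≤ 2 * M * (a ^ 2 + c ^ 2) := by
  have hM : 0 ≤ M := (abs_nonneg _).trans hd
  rw [abs_mul, abs_of_nonneg (sq_nonneg c)]
  have h1 : c ^ 2 * |d| ≤ c ^ 2 * M := by gcongr
  have h2 : 0 ≤ M * a ^ 2 := by positivity
  have h3 : 0 ≤ M * c ^ 2 := by positivity
  nlinarith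

/-- A square-integrable `C¹` function with square-integrable derivative is bounded by its
`H¹` norm. -/
lemma sq_le_energy {f : ℝ → ℝ} (hf : Differentiable ℝ f) (hfc : Continuous (deriv f))
    (hi : Integrable (energyDensity f)) (x : ℝ) : f x ^ 2 ≤ ∫ y, energyDensity f y := by
  have hd : ∀ y, HasDerivAt (fun y => f y ^ 2) (2 * f y * deriv f y) y := fun y => by
    simpa using (hf y).hasDerivAt.fun_pow 2
  have hc : Continuous fun y => 2 * f y * deriv f y := by
    have := hf.continuous
    fun_prop
  have h1 : ∀ y, f x ^ 2 ≤ f y ^ 2 + ∫ z, energyDensity f z := by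
    intro y
    have e : ∫ z in y..x, 2 * f z * deriv f z = f x ^ 2 - f y ^ 2 :=
      intervalIntegral.integral_eq_sub_of_hasDerivAt (fun z _ => hd z)
        (hc.intervalIntegrable _ _)
    have h2 : |∫ z in y..x, 2 * f z * deriv f z| ≤ ∫ z, energyDensity f z := by
      refine (intervalIntegral.norm_integral_le_integral_norm_uIoc (f := fun z =>
        2 * f z * deriv f z)).trans ?_
      have hle : ∀ z, ‖2 * f z * deriv f z‖ ≤ energyDensity f z := fun z => by
        rw [Real.norm_eq_abs, abs_mul, abs_mul, abs_two, energyDensity]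
        nlinarith [sq_nonneg (|f z| - |deriv f z|), sq_abs (f z), sq_abs (deriv f z)]
      have hint : Integrable fun z => ‖2 * f z * deriv f z‖ :=
        hi.mono' hc.norm.aestronglyMeasurable (Filter.Eventually.of_forall fun z => by
          rw [norm_norm]; exact hle z)
      calc _ ≤ ∫ z, ‖2 * f z * deriv f z‖ :=
            setIntegral_le_integral hint (Filter.Eventually.of_forall fun z => norm_nonneg _)
        _ ≤ _ := integral_mono hint hi hle
    have := (abs_le.1 h2).2
    linarith
  by_contra hcon
  push Not at hcon
  -- otherwise `f²` would be bounded below by a positive constant, which is not integrable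
  have hpos : 0 < f x ^ 2 - ∫ y, energyDensity f y := by linarith
  have hconst : Integrable fun _ : ℝ => f x ^ 2 - ∫ y, energyDensity f y := by
    refine hi.mono' aestronglyMeasurable_const (Filter.Eventually.of_forall fun y => ?_)
    rw [Real.norm_eq_abs, abs_of_pos hpos, energyDensity]
    nlinarith [h1 y, sq_nonneg (deriv f y)]
  rw [integrable_const_iff] at hconst
  rcases hconst with h | h
  · exact hpos.ne' h
  · simp [isFiniteMeasure_iff] at h

lemma tendsto_integral_weight {φ : ℝ → ℝ} (hφ : Integrable φ) :
    Filter.Tendsto (fun δ : ℝ => ∫ x, φ x * weight δ x) (nhdsWithin 0 (Ioi 0))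
      (nhds (∫ x, φ x)) := by
  refine tendsto_integral_filter_of_dominated_convergence (fun x => |φ x|) ?_ ?_ hφ.abs ?_
  · filter_upwards with δ using hφ.aestronglyMeasurable.mul (by fun_prop)
  · filter_upwards [self_mem_nhdsWithin] with δ hδ
    filter_upwards with x
    rw [norm_mul, Real.norm_eq_abs, Real.norm_eq_abs, abs_of_pos (weight_pos δ x)]
    exact mul_le_of_le_one_right (abs_nonneg _) (weight_le_one (le_of_lt hδ) x)
  · filter_upwards with x
    have h1 : Continuous fun δ : ℝ => φ x * weight δ x := by
      unfold weight
      fun_prop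
    have h2 := (h1.tendsto 0).mono_left (nhdsWithin_le_nhds (s := Ioi 0))
    simpa [weight] using h2

lemma integral_weight_le {δ : ℝ} (hδ : 0 ≤ δ) {φ : ℝ → ℝ} (hφ : Integrable φ)
    (hc : Continuous φ) (h0 : ∀ x, 0 ≤ φ x) :
    Integrable (fun x => φ x * weight δ x) ∧ ∫ x, φ x * weight δ x ≤ ∫ x, φ x := by
  have hle : ∀ x, φ x * weight δ x ≤ φ x := fun x =>
    mul_le_of_le_one_right (h0 x) (weight_le_one hδ x)
  have hi : Integrable fun x => φ x * weight δ x :=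
    hφ.mono' (by fun_prop) (Filter.Eventually.of_forall fun x => by
      rw [Real.norm_eq_abs, abs_of_nonneg (mul_nonneg (h0 x) (weight_pos δ x).le)]
      exact hle x)
  exact ⟨hi, integral_mono hi hφ hle⟩

namespace MemSigma

variable {f g : ℝ → ℝ}

lemma symm (h : MemSigma f g) : MemSigma g f where
  fst := h.snd
  fst_deriv := h.snd_deriv
  snd := h.fst
  snd_deriv := h.fst_deriv
  mul_deriv := by simpa only [mul_comm] using h.mul_deriv

lemma integrable_energyDensity (h : MemSigma f g) : Integrable (energyDensity f) :=
  h.fst.integrable_sq.add h.fst_deriv.integrable_sq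

lemma integrable_mul_deriv_sq (h : MemSigma f g) :
    Integrable fun x => deriv f x ^ 2 * deriv g x ^ 2 := by
  simpa only [mul_pow] using h.mul_deriv.integrable_sq

end MemSigma

namespace IsSmoothSolution

variable {T : ℝ} {u₀ v₀ : ℝ → ℝ} {u v : ℝ → ℝ → ℝ}

/-- The system is invariant under exchanging the two components. -/
lemma symm (h : IsSmoothSolution T u₀ v₀ u v) : IsSmoothSolution T v₀ u₀ v u where
  init_u := h.init_v
  init_v := h.init_u
  smooth_u := h.smooth_v
  smooth_v := h.smooth_u
  memSigma t ht := (h.memSigma t ht).symm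
  bdd_u := h.bdd_v
  bdd_v := h.bdd_u
  bdd_ux := h.bdd_vx
  bdd_vx := h.bdd_ux
  bdd_uxx := h.bdd_vxx
  bdd_vxx := h.bdd_uxx
  eq_u t ht x := by simpa only [mul_comm (v t x) (u t x)] using h.eq_v t ht x
  eq_v t ht x := by simpa only [mul_comm (v t x) (u t x)] using h.eq_u t ht x

lemma smooth_source1 (hT : 0 < T) (h : IsSmoothSolution T u₀ v₀ u v) :
    SmoothOnStrip T fun t => source1 (u t) (v t) :=
  (((h.smooth_u.pow 2).mul h.smooth_v).add
    ((h.smooth_u.mul (h.smooth_u.dx hT)).mul (h.smooth_v.dx hT))).add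
    (((SmoothOnStrip.const (1 / 2)).mul h.smooth_v).mul ((h.smooth_u.dx hT).pow 2))

lemma smooth_source2 (hT : 0 < T) (h : IsSmoothSolution T u₀ v₀ u v) :
    SmoothOnStrip T fun t => source2 (u t) (v t) :=
  ((h.smooth_u.dx hT).pow 2).mul (h.smooth_v.dx hT)

lemma bdd_source1 (h : IsSmoothSolution T u₀ v₀ u v) :
    BoundedOnStrip T fun t => source1 (u t) (v t) :=
  (((h.bdd_u.pow 2).mul h.bdd_v).add ((h.bdd_u.mul h.bdd_ux).mul h.bdd_vx)).add
    (((BoundedOnStrip.const (1 / 2)).mul h.bdd_v).mul (h.bdd_ux.pow 2))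

lemma bdd_source2 (h : IsSmoothSolution T u₀ v₀ u v) :
    BoundedOnStrip T fun t => source2 (u t) (v t) :=
  (h.bdd_ux.pow 2).mul h.bdd_vx

lemma admissible_source1 (hT : 0 < T) (h : IsSmoothSolution T u₀ v₀ u v) {t : ℝ}
    (ht : t ∈ Icc (-T) T) : Admissible (source1 (u t) (v t)) :=
  h.bdd_source1.admissible (h.smooth_source1 hT) ht

lemma admissible_source2 (hT : 0 < T) (h : IsSmoothSolution T u₀ v₀ u v) {t : ℝ}
    (ht : t ∈ Icc (-T) T) : Admissible (source2 (u t) (v t)) :=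
  h.bdd_source2.admissible (h.smooth_source2 hT) ht

lemma bdd_nonlocalU (hT : 0 < T) (h : IsSmoothSolution T u₀ v₀ u v) :
    BoundedOnStrip T fun t => nonlocalU (u t) (v t) :=
  (h.bdd_source1.dxInvHelmholtz (h.smooth_source1 hT)).add
    ((BoundedOnStrip.const (1 / 2)).mul (h.bdd_source2.invHelmholtz (h.smooth_source2 hT)))

lemma bdd_nonlocalV (hT : 0 < T) (h : IsSmoothSolution T u₀ v₀ u v) :
    BoundedOnStrip T fun t => nonlocalV (u t) (v t) :=
  (h.bdd_source1.invHelmholtz (h.smooth_source1 hT)).add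
    ((BoundedOnStrip.const (1 / 2)).mul (h.bdd_source2.dxInvHelmholtz (h.smooth_source2 hT)))

lemma smooth_velocity (h : IsSmoothSolution T u₀ v₀ u v) : SmoothOnStrip T (velocity u v) :=
  h.smooth_u.mul h.smooth_v

lemma deriv_velocity (h : IsSmoothSolution T u₀ v₀ u v) {t : ℝ} (ht : t ∈ Icc (-T) T) (x : ℝ) :
    deriv (velocity u v t) x = deriv (u t) x * v t x + u t x * deriv (v t) x :=
  ((h.smooth_u.hasDerivAt ht x).mul (h.smooth_v.hasDerivAt ht x)).deriv

lemma materialDeriv (hT : 0 < T) (h : IsSmoothSolution T u₀ v₀ u v) :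
    HasMaterialDeriv T (velocity u v) u fun t x => -nonlocalU (u t) (v t) x where
  smooth := h.smooth_u
  hasDerivWithinAt t ht x := by
    refine (h.eq_u t ht x).congr_deriv ?_
    have e : deriv (P1 (u t) (v t)) x = dxInvHelmholtz (source1 (u t) (v t)) x :=
      ((h.admissible_source1 hT ht).hasDerivAt_invHelmholtz x).deriv
    have e2 : P2 (u t) (v t) x = (1 / 2) * invHelmholtz (source2 (u t) (v t)) x := rfl
    rw [e, e2, nonlocalU, velocity]
    ring

lemma materialDeriv_dx (hT : 0 < T) (h : IsSmoothSolution T u₀ v₀ u v) :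
    HasMaterialDeriv T (velocity u v) (fun t => deriv (u t)) fun t x =>
      u t x ^ 2 * v t x - (1 / 2) * v t x * deriv (u t) x ^ 2 - nonlocalV (u t) (v t) x := by
  refine ((h.materialDeriv hT).dx hT h.smooth_velocity).congr fun t ht x => ?_
  rw [h.deriv_velocity ht, (hasDerivAt_nonlocalU (h.admissible_source1 hT ht)
    (h.admissible_source2 hT ht) x).fun_neg.deriv, source1]
  ring

/-- A common bound for the solution, its first derivatives and the nonlocal terms. Unlike the
bounds in `hasUniformBounds` it is not controlled by the energies. -/
lemma exists_bound (hT : 0 < T) (h : IsSmoothSolution T u₀ v₀ u v) :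
    ∃ M, 1 ≤ M ∧ ∀ t ∈ Icc (-T) T, ∀ x, |u t x| ≤ M ∧ |v t x| ≤ M ∧ |deriv (u t) x| ≤ M ∧
      |deriv (v t) x| ≤ M ∧ |nonlocalU (u t) (v t) x| ≤ M ∧ |nonlocalV (u t) (v t) x| ≤ M := by
  have hb := (((h.bdd_u.abs.add h.bdd_v.abs).add h.bdd_ux.abs).add h.bdd_vx.abs).add
    ((h.bdd_nonlocalU hT).abs.add (h.bdd_nonlocalV hT).abs)
  obtain ⟨M, hM1, hM⟩ := hb.exists_one_le
  refine ⟨M, hM1, fun t ht x => ?_⟩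
  have h1 := (le_abs_self _).trans (hM t ht x)
  have := abs_nonneg (u t x)
  have := abs_nonneg (v t x)
  have := abs_nonneg (deriv (u t) x)
  have := abs_nonneg (deriv (v t) x)
  have := abs_nonneg (nonlocalU (u t) (v t) x)
  have := abs_nonneg (nonlocalV (u t) (v t) x)
  refine ⟨?_, ?_, ?_, ?_, ?_, ?_⟩ <;> linarith

lemma smooth_energyDensity (hT : 0 < T) (h : IsSmoothSolution T u₀ v₀ u v) :
    SmoothOnStrip T fun t => energyDensity (u t) :=
  (h.smooth_u.pow 2).add ((h.smooth_u.dx hT).pow 2)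

/-- The nonlocal terms are dominated by the resolvent of the energy density. -/
lemma abs_nonlocal_le (hT : 0 < T) (h : IsSmoothSolution T u₀ v₀ u v) {M t : ℝ}
    (ht : t ∈ Icc (-T) T) (hM : ∀ x, |u t x| ≤ M ∧ |v t x| ≤ M ∧ |deriv (v t) x| ≤ M)
    (x : ℝ) :
    |nonlocalU (u t) (v t) x| ≤ 3 * M * invHelmholtz (energyDensity (u t)) x ∧
    |nonlocalV (u t) (v t) x| ≤ 3 * M * invHelmholtz (energyDensity (u t)) x := by
  have hA : Admissible (energyDensity (u t)) :=
    Admissible.of_integrable ((h.smooth_energyDensity hT).continuous ht)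
      (h.memSigma t ht).integrable_energyDensity
  have hA2 := hA.const_mul (2 * M)
  have h1 : ∀ y, |source1 (u t) (v t) y| ≤ 2 * M * energyDensity (u t) y := fun y =>
    abs_source1_le (hM y).1 (hM y).2.1 (hM y).2.2
  have h2 : ∀ y, |source2 (u t) (v t) y| ≤ 2 * M * energyDensity (u t) y := fun y =>
    abs_source2_le (hM y).2.2
  have e := invHelmholtz_const_mul (2 * M) (energyDensity (u t)) x
  have a1 := hA2.abs_invHelmholtz_le (h.admissible_source1 hT ht) h1 x
  have a2 := hA2.abs_dxInvHelmholtz_le (h.admissible_source1 hT ht) h1 x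
  have a3 := hA2.abs_invHelmholtz_le (h.admissible_source2 hT ht) h2 x
  have a4 := hA2.abs_dxInvHelmholtz_le (h.admissible_source2 hT ht) h2 x
  rw [e] at a1 a2 a3 a4
  constructor
  · refine (abs_add_le _ _).trans ?_
    rw [abs_mul, abs_of_pos (by norm_num : (0 : ℝ) < 1 / 2)]
    linarith
  · refine (abs_add_le _ _).trans ?_
    rw [abs_mul, abs_of_pos (by norm_num : (0 : ℝ) < 1 / 2)]
    linarith

/-- The local conservation law for the energy density `u² + uₓ²`, with flux
`u v uₓ² + 2 u (P₁ + ∂ₓP₂)`, shows that the energy of `u` is controlled by its initial value. -/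
lemma integral_energyDensity_le (hT : 0 < T) (h : IsSmoothSolution T u₀ v₀ u v) :
    ∀ t ∈ Icc (-T) T, ∫ x, energyDensity (u t) x ≤ 2 * energy u₀ := by
  obtain ⟨M, hM1, hM⟩ := h.exists_bound hT
  have hM0 : 0 ≤ M := by linarith
  set C : ℝ := M ^ 2 + 12 * M ^ 2 with hC
  have hC0 : 0 ≤ C := by positivity
  have hu := h.materialDeriv hT
  have hux := h.materialDeriv_dx hT
  have hq := (hu.mul hu).add (hux.mul hux)
  have hqe : ∀ t x, u t x * u t x + deriv (u t) x * deriv (u t) x = energyDensity (u t) x :=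
    fun t x => by rw [energyDensity]; ring
  have hS := h.smooth_velocity
  have hE0 : energy u₀ = ∫ x, energyDensity (u 0) x := by rw [h.init_u]; rfl
  have hEi : ∀ t ∈ Icc (-T) T, Integrable (energyDensity (u t)) := fun t ht =>
    (h.memSigma t ht).integrable_energyDensity
  have hEc : ∀ t ∈ Icc (-T) T, Continuous (energyDensity (u t)) := fun t ht =>
    (h.smooth_energyDensity hT).continuous ht
  have hEw : ∀ δ : ℝ, 0 ≤ δ → ∀ t ∈ Icc (-T) T,
      Integrable fun x => energyDensity (u t) x * weight δ x := fun δ hδ t ht =>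
    (integral_weight_le hδ (hEi t ht) (hEc t ht) (energyDensity_nonneg _)).1
  have h0mem : (0 : ℝ) ∈ Icc (-T) T := ⟨by linarith, hT.le⟩
  -- the estimate for small weights
  have key : ∀ δ : ℝ, 0 < δ → δ ≤ 1 / 2 → 2 * (δ * C) * T ≤ 1 → ∀ t ∈ Icc (-T) T,
      ∫ x, energyDensity (u t) x * weight δ x
        ≤ 2 ^ 1 * ∫ x, energyDensity (u 0) x * weight δ x := by
    intro δ hδ hδ2 hδC
    refine le_two_pow_mul_of_le_add (C := δ * C) (n := 1)
      (N := fun t => ∫ x, energyDensity (u t) x * weight δ x)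
      (S₀ := 2 * M ^ 2 * ∫ x, weight δ x) (by positivity) one_pos (by simpa using hδC) ?_ ?_ ?_
    · intro t ht
      rw [← integral_const_mul]
      refine integral_mul_weight_mono (hEw δ hδ.le t ht) ((integrable_weight hδ).const_mul _)
        fun x => ?_
      obtain ⟨b1, -, b3, -⟩ := hM t ht x
      rw [energyDensity, ← sq_abs (u t x), ← sq_abs (deriv (u t) x)]
      nlinarith [abs_nonneg (u t x), abs_nonneg (deriv (u t) x)]
    · intro t ht
      exact integral_nonneg fun x =>
        mul_nonneg (energyDensity_nonneg _ _) (weight_pos δ x).le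
    · intro s hs t ht S hSle
      have hsub : uIcc s t ⊆ Icc (-T) T := ordConnected_Icc.uIcc_subset hs ht
      have hqt := ((hS.mul (hq.smooth.dx hT)).neg.add (hq.smooth_right hT hS)).continuousOn
      have hlaw := Novikov.abs_integral_weight_sub_le (δ := δ) (A := C * S) (B := 0)
        (Φ := fun t x => u t x * v t x * deriv (u t) x ^ 2
          + 2 * u t x * nonlocalV (u t) (v t) x)
        (G := fun _ _ => 0) hδ.le hq.smooth.continuousOn hqt hq.hasDerivWithinAt
        (fun t ht => continuous_const) ?_ ?_ hs ht ?_ ?_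
      · simp only [hqe] at hlaw
        have := (abs_le.1 hlaw).2
        linarith
      · intro t ht x
        have d0 := h.smooth_u.hasDerivAt ht x
        have d1 := h.smooth_v.hasDerivAt ht x
        have d2 := (h.smooth_u.dx hT).hasDerivAt ht x
        have d3 := hasDerivAt_nonlocalV (h.admissible_source1 hT ht)
          (h.admissible_source2 hT ht) x
        refine (((d0.fun_mul d1).fun_mul (d2.fun_pow 2)).fun_add
          ((d0.const_mul 2).fun_mul d3)).congr_deriv ?_
        rw [((d0.fun_mul d0).fun_add (d2.fun_mul d2)).deriv, velocity, source2]
        push_cast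
        ring
      · intro t ht
        simp only [hqe]
        exact hEw δ hδ.le t ht
      · intro τ hτ
        have hτ' := hsub hτ
        obtain ⟨k1, k2⟩ := integral_invHelmholtz_weight_le hδ.le (by linarith) (hEc τ hτ')
          (energyDensity_nonneg _) (hEw δ hδ.le τ hτ')
        have hbound : ∀ x, |u τ x * v τ x * deriv (u τ) x ^ 2
            + 2 * u τ x * nonlocalV (u τ) (v τ) x|
            ≤ M ^ 2 * energyDensity (u τ) x
              + 6 * M ^ 2 * invHelmholtz (energyDensity (u τ)) x := by
          intro x
          obtain ⟨b1, b2, b3, -⟩ := hM τ hτ' x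
          have b4 := (h.abs_nonlocal_le hT hτ' (fun x =>
            ⟨(hM τ hτ' x).1, (hM τ hτ' x).2.1, (hM τ hτ' x).2.2.2.1⟩) x).2
          refine (abs_add_le _ _).trans (add_le_add ?_ ?_)
          · rw [abs_mul, abs_mul, abs_of_nonneg (sq_nonneg (deriv (u τ) x)), sq M]
            have : deriv (u τ) x ^ 2 ≤ energyDensity (u τ) x := by
              rw [energyDensity]; nlinarith [sq_nonneg (u τ x)]
            gcongr
          · rw [abs_mul, abs_mul, abs_two]
            calc 2 * |u τ x| * |nonlocalV (u τ) (v τ) x|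
                ≤ 2 * M * (3 * M * invHelmholtz (energyDensity (u τ)) x) := by gcongr
              _ = _ := by ring
        have hri : Integrable fun x => (M ^ 2 * energyDensity (u τ) x
              + 6 * M ^ 2 * invHelmholtz (energyDensity (u τ)) x) * weight δ x := by
          simp only [add_mul, mul_assoc]
          exact (((hEw δ hδ.le τ hτ').const_mul _)).add ((k1.const_mul _).const_mul _)
        have hΦc : Continuous fun x => u τ x * v τ x * deriv (u τ) x ^ 2
            + 2 * u τ x * nonlocalV (u τ) (v τ) x := by
          have c1 := h.smooth_u.continuous hτ'
          have c2 := h.smooth_v.continuous hτ'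
          have c3 := (h.smooth_u.dx hT).continuous hτ'
          have c4 : Continuous (nonlocalV (u τ) (v τ)) := continuous_iff_continuousAt.2 fun x =>
            (hasDerivAt_nonlocalV (h.admissible_source1 hT hτ')
              (h.admissible_source2 hT hτ') x).continuousAt
          fun_prop
        have hΦi := integrable_mul_weight_of_le hΦc hri hbound
        refine ⟨hΦi, (integral_mul_weight_mono (integrable_abs_mul_weight hΦi) hri
          hbound).trans ?_⟩
        have e : ∫ x, (M ^ 2 * energyDensity (u τ) x
              + 6 * M ^ 2 * invHelmholtz (energyDensity (u τ)) x) * weight δ x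
            = M ^ 2 * (∫ x, energyDensity (u τ) x * weight δ x)
              + 6 * M ^ 2 * ∫ x, invHelmholtz (energyDensity (u τ)) x * weight δ x := by
          rw [← integral_const_mul, ← integral_const_mul,
            ← integral_add ((hEw δ hδ.le τ hτ').const_mul _) (k1.const_mul _)]
          refine integral_congr_ae (Filter.Eventually.of_forall fun x => ?_)
          simp only
          ring
        have hN0 : 0 ≤ ∫ x, energyDensity (u τ) x * weight δ x :=
          integral_nonneg fun x => mul_nonneg (energyDensity_nonneg _ _) (weight_pos δ x).le
        have k3 : 1 / (1 - δ) ≤ 2 := by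
          rw [div_le_iff₀ (by linarith)]; linarith
        have k4 : ∫ x, invHelmholtz (energyDensity (u τ)) x * weight δ x
            ≤ 2 * ∫ x, energyDensity (u τ) x * weight δ x :=
          k2.trans (mul_le_mul_of_nonneg_right k3 hN0)
        rw [e]
        calc _ ≤ M ^ 2 * (∫ x, energyDensity (u τ) x * weight δ x)
              + 6 * M ^ 2 * (2 * ∫ x, energyDensity (u τ) x * weight δ x) := by gcongr
          _ = C * ∫ x, energyDensity (u τ) x * weight δ x := by rw [hC]; ring
          _ ≤ C * S := by gcongr; exact hSle τ hτ
      · intro τ hτ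
        simp
  intro t ht
  rw [hE0]
  refine le_of_tendsto_of_tendsto (tendsto_integral_weight (hEi t ht))
    ((tendsto_integral_weight (hEi 0 h0mem)).const_mul 2) ?_
  have hpos : 0 < 1 / (2 * C * T + 1) := by positivity
  have hsmall : ∀ᶠ δ : ℝ in nhdsWithin 0 (Ioi 0), δ < min (1 / 2) (1 / (2 * C * T + 1)) :=
    nhdsWithin_le_nhds (Iio_mem_nhds (lt_min (by norm_num) hpos))
  filter_upwards [self_mem_nhdsWithin, hsmall] with δ hδ hδ'
  have h1 : δ < 1 / (2 * C * T + 1) := hδ'.trans_le (min_le_right _ _)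
  rw [lt_div_iff₀ (by positivity)] at h1
  have h2 : 0 < δ := hδ
  simpa using key δ hδ (hδ'.le.trans (min_le_left _ _)) (by nlinarith) t ht

end IsSmoothSolution

/-- The density of `energyH`. -/
def energyHDensity (u v : ℝ → ℝ) (x : ℝ) : ℝ :=
  3 * u x ^ 2 * v x ^ 2 + u x ^ 2 * deriv v x ^ 2 + deriv u x ^ 2 * v x ^ 2
    + 4 * u x * deriv u x * v x * deriv v x - deriv u x ^ 2 * deriv v x ^ 2

lemma abs_mul_le_half_sq_add (a c : ℝ) : |a * c| ≤ (a ^ 2 + c ^ 2) / 2 := by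
  rw [abs_mul]
  nlinarith [sq_nonneg (|a| - |c|), sq_abs a, sq_abs c]

lemma sq_le_sq_of_abs_le {a M : ℝ} (h : |a| ≤ M) : a ^ 2 ≤ M ^ 2 := by
  rw [← sq_abs a]
  gcongr

lemma abs_energyHDensity_le {M a b c d : ℝ} (hb : |b| ≤ M) (hd : |d| ≤ M) :
    |3 * a ^ 2 * b ^ 2 + a ^ 2 * d ^ 2 + c ^ 2 * b ^ 2 + 4 * a * c * b * d - c ^ 2 * d ^ 2|
      ≤ 6 * M ^ 2 * (a ^ 2 + c ^ 2) := by
  have hM : 0 ≤ M := (abs_nonneg _).trans hb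
  have h1 : a ^ 2 * b ^ 2 ≤ a ^ 2 * M ^ 2 :=
    mul_le_mul_of_nonneg_left (sq_le_sq_of_abs_le hb) (sq_nonneg a)
  have h2 : a ^ 2 * d ^ 2 ≤ a ^ 2 * M ^ 2 :=
    mul_le_mul_of_nonneg_left (sq_le_sq_of_abs_le hd) (sq_nonneg a)
  have h3 : c ^ 2 * b ^ 2 ≤ c ^ 2 * M ^ 2 :=
    mul_le_mul_of_nonneg_left (sq_le_sq_of_abs_le hb) (sq_nonneg c)
  have h4 : c ^ 2 * d ^ 2 ≤ c ^ 2 * M ^ 2 :=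
    mul_le_mul_of_nonneg_left (sq_le_sq_of_abs_le hd) (sq_nonneg c)
  have h5 : |(a * c) * (b * d)| ≤ (a ^ 2 + c ^ 2) / 2 * (M * M) := by
    rw [abs_mul, abs_mul b d]
    have := abs_mul_le_half_sq_add a c
    gcongr
  have h6 := abs_le.1 h5
  have p1 : 0 ≤ a ^ 2 * b ^ 2 := by positivity
  have p2 : 0 ≤ a ^ 2 * d ^ 2 := by positivity
  have p3 : 0 ≤ c ^ 2 * b ^ 2 := by positivity
  have p4 : 0 ≤ c ^ 2 * d ^ 2 := by positivity
  have p5 : 0 ≤ a ^ 2 * M ^ 2 := by positivity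
  have p6 : 0 ≤ c ^ 2 * M ^ 2 := by positivity
  rw [abs_le]
  constructor <;> nlinarith [h6.1, h6.2]

lemma abs_energyHFlux_le {M a b c d U V W Z X Y : ℝ} (hM : 1 ≤ M) (ha : |a| ≤ M) (hb : |b| ≤ M)
    (hd : |d| ≤ M) (hU : |U| ≤ M) (hV : |V| ≤ M) (hX : |V| ≤ 3 * M * X)
    (hW : |W| ≤ 3 * M * Y) (hZ : |Z| ≤ 3 * M * Y) :
    |a * b * (3 * a ^ 2 * b ^ 2 + a ^ 2 * d ^ 2 + c ^ 2 * b ^ 2 + 4 * a * c * b * d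
        - c ^ 2 * d ^ 2)
      - 4 * (U * W - V * Z) + 2 * a * b ^ 2 * V + 2 * a ^ 2 * b * Z - 3 * a ^ 3 * b ^ 3|
      ≤ 30 * M ^ 4 * ((a ^ 2 + c ^ 2) + (X + Y)) := by
  have hM0 : 0 ≤ M := by linarith
  have hMp : 0 < M := by linarith
  have hX0 : 0 ≤ X := by
    have : 0 ≤ 3 * M * X := (abs_nonneg _).trans hX
    exact nonneg_of_mul_nonneg_right this (by positivity)
  have hY0 : 0 ≤ Y := by
    have : 0 ≤ 3 * M * Y := (abs_nonneg _).trans hW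
    exact nonneg_of_mul_nonneg_right this (by positivity)
  set q := 3 * a ^ 2 * b ^ 2 + a ^ 2 * d ^ 2 + c ^ 2 * b ^ 2 + 4 * a * c * b * d
        - c ^ 2 * d ^ 2 with hq
  have h1 : |a * b * q| ≤ M * M * (6 * M ^ 2 * (a ^ 2 + c ^ 2)) := by
    rw [abs_mul, abs_mul]
    have := abs_energyHDensity_le (a := a) (c := c) hb hd
    gcongr
  have h2 : |U * W| ≤ M * (3 * M * Y) := by rw [abs_mul]; gcongr
  have h3 : |V * Z| ≤ M * (3 * M * Y) := by rw [abs_mul]; gcongr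
  have h4 : |a * b ^ 2 * V| ≤ M * M ^ 2 * (3 * M * X) := by
    rw [abs_mul, abs_mul, abs_pow]; gcongr
  have h5 : |a ^ 2 * b * Z| ≤ M ^ 2 * M * (3 * M * Y) := by
    rw [abs_mul, abs_mul, abs_pow]; gcongr
  have h6 : |a ^ 2 * (a * b ^ 3)| ≤ a ^ 2 * (M * M ^ 3) := by
    rw [abs_mul, abs_of_nonneg (sq_nonneg a), abs_mul, abs_pow]
    gcongr
  have e1 : M * (3 * M * Y) ≤ 3 * M ^ 4 * Y := by
    have : M ^ 2 ≤ M ^ 4 := pow_le_pow_right₀ hM (by norm_num)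
    nlinarith [mul_le_mul_of_nonneg_right this hY0]
  have p1 : 0 ≤ M ^ 4 * a ^ 2 := by positivity
  have p2 : 0 ≤ M ^ 4 * c ^ 2 := by positivity
  have p3 : 0 ≤ M ^ 4 * X := by positivity
  have p4 : 0 ≤ M ^ 4 * Y := by positivity
  rw [abs_le] at h1 h2 h3 h4 h5 h6 ⊢
  constructor
  · linarith [h1.1, h2.2, h3.1, h4.1, h5.1, h6.2]
  · linarith [h1.2, h2.1, h3.2, h4.2, h5.2, h6.1]

namespace IsSmoothSolution

variable {T : ℝ} {u₀ v₀ : ℝ → ℝ} {u v : ℝ → ℝ → ℝ}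

lemma continuous_nonlocalU (hT : 0 < T) (h : IsSmoothSolution T u₀ v₀ u v) {t : ℝ}
    (ht : t ∈ Icc (-T) T) : Continuous (nonlocalU (u t) (v t)) :=
  continuous_iff_continuousAt.2 fun x => (hasDerivAt_nonlocalU (h.admissible_source1 hT ht)
    (h.admissible_source2 hT ht) x).continuousAt

lemma continuous_nonlocalV (hT : 0 < T) (h : IsSmoothSolution T u₀ v₀ u v) {t : ℝ}
    (ht : t ∈ Icc (-T) T) : Continuous (nonlocalV (u t) (v t)) :=
  continuous_iff_continuousAt.2 fun x => (hasDerivAt_nonlocalV (h.admissible_source1 hT ht)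
    (h.admissible_source2 hT ht) x).continuousAt

lemma smooth_energyHDensity (hT : 0 < T) (h : IsSmoothSolution T u₀ v₀ u v) :
    SmoothOnStrip T fun t => energyHDensity (u t) (v t) := by
  have h1 := h.smooth_u
  have h2 := h.smooth_v
  have h3 := h1.dx hT
  have h4 := h2.dx hT
  exact ((((((SmoothOnStrip.const 3).mul (h1.pow 2)).mul (h2.pow 2)).add
    ((h1.pow 2).mul (h4.pow 2))).add ((h3.pow 2).mul (h2.pow 2))).add
    (((((SmoothOnStrip.const 4).mul h1).mul h3).mul h2).mul h4)).sub
    ((h3.pow 2).mul (h4.pow 2))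

lemma integrable_energyHDensity (hT : 0 < T) (h : IsSmoothSolution T u₀ v₀ u v) {t : ℝ}
    (ht : t ∈ Icc (-T) T) : Integrable (energyHDensity (u t) (v t)) := by
  obtain ⟨M, hM1, hM⟩ := h.exists_bound hT
  refine ((h.memSigma t ht).integrable_energyDensity.const_mul (6 * M ^ 2)).mono'
    ((h.smooth_energyHDensity hT).continuous ht).aestronglyMeasurable
    (Filter.Eventually.of_forall fun x => ?_)
  exact abs_energyHDensity_le (hM t ht x).2.1 (hM t ht x).2.2.2.1

/-- Conservation of `H`: writing `U, V` for the nonlocal terms of `u` and `W, Z` for those of `v`,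
the density `q` of `H` satisfies a local conservation law with flux
`u v q - 4 (U W - V Z) + 2 u v² V + 2 u² v Z - 3 u³ v³`. -/
lemma integral_energyHDensity (hT : 0 < T) (h : IsSmoothSolution T u₀ v₀ u v) :
    ∀ t ∈ Icc (-T) T, ∫ x, energyHDensity (u t) (v t) x = energyH u₀ v₀ := by
  obtain ⟨M₁, hM₁1, hM₁⟩ := h.exists_bound hT
  obtain ⟨M₂, hM₂1, hM₂⟩ := h.symm.exists_bound hT
  set M := max M₁ M₂ with hMdef
  have hM1 : 1 ≤ M := hM₁1.trans (le_max_left _ _)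
  have hb : ∀ t ∈ Icc (-T) T, ∀ x, |u t x| ≤ M ∧ |v t x| ≤ M ∧ |deriv (u t) x| ≤ M ∧
      |deriv (v t) x| ≤ M ∧ |nonlocalU (u t) (v t) x| ≤ M ∧ |nonlocalV (u t) (v t) x| ≤ M := by
    intro t ht x
    obtain ⟨b1, b2, b3, b4, b5, b6⟩ := hM₁ t ht x
    have := le_max_left M₁ M₂
    exact ⟨b1.trans this, b2.trans this, b3.trans this, b4.trans this, b5.trans this,
      b6.trans this⟩
  have h0mem : (0 : ℝ) ∈ Icc (-T) T := ⟨by linarith, hT.le⟩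
  have hu := h.materialDeriv hT
  have hux := h.materialDeriv_dx hT
  have hv := h.symm.materialDeriv hT
  have hvx := h.symm.materialDeriv_dx hT
  rw [velocity_comm] at hv hvx
  have hq := ((((HasMaterialDeriv.const 3).mul ((hu.mul hu).mul (hv.mul hv))).add
    ((hu.mul hu).mul (hvx.mul hvx))).add ((hux.mul hux).mul (hv.mul hv))).add
    ((HasMaterialDeriv.const 4).mul ((hu.mul hux).mul (hv.mul hvx))) |>.sub
    ((hux.mul hux).mul (hvx.mul hvx))
  have hqe : ∀ t x, 3 * (u t x * u t x * (v t x * v t x))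
      + u t x * u t x * (deriv (v t) x * deriv (v t) x)
      + deriv (u t) x * deriv (u t) x * (v t x * v t x)
      + 4 * (u t x * deriv (u t) x * (v t x * deriv (v t) x))
      - deriv (u t) x * deriv (u t) x * (deriv (v t) x * deriv (v t) x)
      = energyHDensity (u t) (v t) x :=
    fun t x => by rw [energyHDensity]; ring
  have hS := h.smooth_velocity
  have hqt := ((hS.mul (hq.smooth.dx hT)).neg.add (hq.smooth_right hT hS)).continuousOn
  have hHi : ∀ t ∈ Icc (-T) T, Integrable (energyHDensity (u t) (v t)) := fun t ht =>
    h.integrable_energyHDensity hT ht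
  have hEi : ∀ t ∈ Icc (-T) T, Integrable (energyDensity (u t)) := fun t ht =>
    (h.memSigma t ht).integrable_energyDensity
  have hFi : ∀ t ∈ Icc (-T) T, Integrable (energyDensity (v t)) := fun t ht =>
    (h.symm.memSigma t ht).integrable_energyDensity
  have hEc : ∀ t ∈ Icc (-T) T, Continuous (energyDensity (u t)) := fun t ht =>
    (h.smooth_energyDensity hT).continuous ht
  have hFc : ∀ t ∈ Icc (-T) T, Continuous (energyDensity (v t)) := fun t ht =>
    (h.symm.smooth_energyDensity hT).continuous ht
  set A : ℝ := 30 * M ^ 4 * (2 * energy u₀ + (2 * (2 * energy u₀) + 2 * (2 * energy v₀))) with hA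
  have key : ∀ δ : ℝ, 0 < δ → δ ≤ 1 / 2 → ∀ t ∈ Icc (-T) T,
      |(∫ x, energyHDensity (u t) (v t) x * weight δ x)
        - ∫ x, energyHDensity (u 0) (v 0) x * weight δ x| ≤ |t| * (δ * A) := by
    intro δ hδ hδ2 t ht
    have hsub : uIcc 0 t ⊆ Icc (-T) T := ordConnected_Icc.uIcc_subset h0mem ht
    have hlaw := Novikov.abs_integral_weight_sub_le (δ := δ) (A := A) (B := 0)
      (Φ := fun t x => u t x * v t x * (3 * u t x ^ 2 * v t x ^ 2
          + u t x ^ 2 * deriv (v t) x ^ 2 + deriv (u t) x ^ 2 * v t x ^ 2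
          + 4 * u t x * deriv (u t) x * v t x * deriv (v t) x
          - deriv (u t) x ^ 2 * deriv (v t) x ^ 2)
        - 4 * (nonlocalU (u t) (v t) x * nonlocalU (v t) (u t) x
          - nonlocalV (u t) (v t) x * nonlocalV (v t) (u t) x)
        + 2 * u t x * v t x ^ 2 * nonlocalV (u t) (v t) x
        + 2 * u t x ^ 2 * v t x * nonlocalV (v t) (u t) x - 3 * u t x ^ 3 * v t x ^ 3)
      (G := fun _ _ => 0) hδ.le hq.smooth.continuousOn hqt hq.hasDerivWithinAt
      (fun t ht => continuous_const) ?_ ?_ h0mem ht ?_ ?_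
    · simp only [hqe] at hlaw
      simpa using hlaw
    · intro t ht x
      have d0 := h.smooth_u.hasDerivAt ht x
      have d1 := h.smooth_v.hasDerivAt ht x
      have d2 := (h.smooth_u.dx hT).hasDerivAt ht x
      have d3 := (h.smooth_v.dx hT).hasDerivAt ht x
      have dU := hasDerivAt_nonlocalU (h.admissible_source1 hT ht)
        (h.admissible_source2 hT ht) x
      have dV := hasDerivAt_nonlocalV (h.admissible_source1 hT ht)
        (h.admissible_source2 hT ht) x
      have dW := hasDerivAt_nonlocalU (h.symm.admissible_source1 hT ht)
        (h.symm.admissible_source2 hT ht) x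
      have dZ := hasDerivAt_nonlocalV (h.symm.admissible_source1 hT ht)
        (h.symm.admissible_source2 hT ht) x
      have dq := (((((d0.fun_pow 2).const_mul 3).fun_mul (d1.fun_pow 2)).fun_add
        ((d0.fun_pow 2).fun_mul (d3.fun_pow 2))).fun_add
        ((d2.fun_pow 2).fun_mul (d1.fun_pow 2))).fun_add
        ((((d0.const_mul 4).fun_mul d2).fun_mul d1).fun_mul d3) |>.fun_sub
        ((d2.fun_pow 2).fun_mul (d3.fun_pow 2))
      have dΦ := (((((d0.fun_mul d1).fun_mul dq).fun_sub
        (((dU.fun_mul dW).fun_sub (dV.fun_mul dZ)).const_mul 4)).fun_add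
        (((d0.const_mul 2).fun_mul (d1.fun_pow 2)).fun_mul dV)).fun_add
        ((((d0.fun_pow 2).const_mul 2).fun_mul d1).fun_mul dZ)).fun_sub
        (((d0.fun_pow 3).const_mul 3).fun_mul (d1.fun_pow 3))
      refine dΦ.congr_deriv ?_
      simp only [hqe]
      rw [show deriv (fun x => energyHDensity (u t) (v t) x) x = _ from dq.deriv]
      simp only [velocity, source1, source2]
      push_cast
      ring
    · intro t ht
      simp only [hqe]
      refine (hHi t ht).mul_bdd (c := 1) (by fun_prop) (Filter.Eventually.of_forall fun x => ?_)
      rw [Real.norm_eq_abs, abs_of_pos (weight_pos δ x)]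
      exact weight_le_one hδ.le x
    · intro τ hτ
      have hτ' := hsub hτ
      obtain ⟨w1, w2⟩ := integral_weight_le hδ.le (hEi τ hτ') (hEc τ hτ')
        (energyDensity_nonneg _)
      obtain ⟨w3, w4⟩ := integral_weight_le hδ.le (hFi τ hτ') (hFc τ hτ')
        (energyDensity_nonneg _)
      obtain ⟨k1, k2⟩ := integral_invHelmholtz_weight_le hδ.le (by linarith) (hEc τ hτ')
        (energyDensity_nonneg _) w1
      obtain ⟨k3, k4⟩ := integral_invHelmholtz_weight_le hδ.le (by linarith) (hFc τ hτ')
        (energyDensity_nonneg _) w3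
      have hbound : ∀ x, |u τ x * v τ x * (3 * u τ x ^ 2 * v τ x ^ 2
          + u τ x ^ 2 * deriv (v τ) x ^ 2 + deriv (u τ) x ^ 2 * v τ x ^ 2
          + 4 * u τ x * deriv (u τ) x * v τ x * deriv (v τ) x
          - deriv (u τ) x ^ 2 * deriv (v τ) x ^ 2)
        - 4 * (nonlocalU (u τ) (v τ) x * nonlocalU (v τ) (u τ) x
          - nonlocalV (u τ) (v τ) x * nonlocalV (v τ) (u τ) x)
        + 2 * u τ x * v τ x ^ 2 * nonlocalV (u τ) (v τ) x
        + 2 * u τ x ^ 2 * v τ x * nonlocalV (v τ) (u τ) x - 3 * u τ x ^ 3 * v τ x ^ 3|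
          ≤ 30 * M ^ 4 * (energyDensity (u τ) x + (invHelmholtz (energyDensity (u τ)) x
            + invHelmholtz (energyDensity (v τ)) x)) := by
        intro x
        obtain ⟨b1, b2, b3, b4, b5, b6⟩ := hb τ hτ' x
        have a1 := h.abs_nonlocal_le hT hτ' (fun x =>
          ⟨(hb τ hτ' x).1, (hb τ hτ' x).2.1, (hb τ hτ' x).2.2.2.1⟩) x
        have a2 := h.symm.abs_nonlocal_le hT hτ' (fun x =>
          ⟨(hb τ hτ' x).2.1, (hb τ hτ' x).1, (hb τ hτ' x).2.2.1⟩) x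
        exact abs_energyHFlux_le hM1 b1 b2 b4 b5 b6 a1.2 a2.1 a2.2
      have hri : Integrable fun x => 30 * M ^ 4 * (energyDensity (u τ) x
            + (invHelmholtz (energyDensity (u τ)) x
            + invHelmholtz (energyDensity (v τ)) x)) * weight δ x := by
        simp only [mul_assoc _ _ (weight δ _), add_mul]
        exact ((w1.add (k1.add k3)).const_mul _)
      have hΦc : Continuous fun x => u τ x * v τ x * (3 * u τ x ^ 2 * v τ x ^ 2
          + u τ x ^ 2 * deriv (v τ) x ^ 2 + deriv (u τ) x ^ 2 * v τ x ^ 2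
          + 4 * u τ x * deriv (u τ) x * v τ x * deriv (v τ) x
          - deriv (u τ) x ^ 2 * deriv (v τ) x ^ 2)
        - 4 * (nonlocalU (u τ) (v τ) x * nonlocalU (v τ) (u τ) x
          - nonlocalV (u τ) (v τ) x * nonlocalV (v τ) (u τ) x)
        + 2 * u τ x * v τ x ^ 2 * nonlocalV (u τ) (v τ) x
        + 2 * u τ x ^ 2 * v τ x * nonlocalV (v τ) (u τ) x - 3 * u τ x ^ 3 * v τ x ^ 3 := by
        have c1 := h.smooth_u.continuous hτ'
        have c2 := h.smooth_v.continuous hτ'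
        have c3 := (h.smooth_u.dx hT).continuous hτ'
        have c4 := (h.smooth_v.dx hT).continuous hτ'
        have c5 := h.continuous_nonlocalU hT hτ'
        have c6 := h.continuous_nonlocalV hT hτ'
        have c7 := h.symm.continuous_nonlocalU hT hτ'
        have c8 := h.symm.continuous_nonlocalV hT hτ'
        fun_prop
      have hΦi := integrable_mul_weight_of_le hΦc hri hbound
      refine ⟨hΦi, (integral_mul_weight_mono (integrable_abs_mul_weight hΦi) hri
        hbound).trans ?_⟩
      have e : ∫ x, 30 * M ^ 4 * (energyDensity (u τ) x
            + (invHelmholtz (energyDensity (u τ)) x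
            + invHelmholtz (energyDensity (v τ)) x)) * weight δ x
          = 30 * M ^ 4 * ((∫ x, energyDensity (u τ) x * weight δ x)
            + ((∫ x, invHelmholtz (energyDensity (u τ)) x * weight δ x)
            + ∫ x, invHelmholtz (energyDensity (v τ)) x * weight δ x)) := by
        have k13 : Integrable fun x => invHelmholtz (energyDensity (u τ)) x * weight δ x
            + invHelmholtz (energyDensity (v τ)) x * weight δ x := k1.add k3
        rw [← integral_add k1 k3, ← integral_add w1 k13, ← integral_const_mul]
        refine integral_congr_ae (Filter.Eventually.of_forall fun x => ?_)
        simp only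
        ring
      have s1 := h.integral_energyDensity_le hT τ hτ'
      have s2 := h.symm.integral_energyDensity_le hT τ hτ'
      have k5 : 1 / (1 - δ) ≤ 2 := by
        rw [div_le_iff₀ (by linarith)]; linarith
      have n1 : 0 ≤ ∫ x, energyDensity (u τ) x * weight δ x :=
        integral_nonneg fun x => mul_nonneg (energyDensity_nonneg _ _) (weight_pos δ x).le
      have n2 : 0 ≤ ∫ x, energyDensity (v τ) x * weight δ x :=
        integral_nonneg fun x => mul_nonneg (energyDensity_nonneg _ _) (weight_pos δ x).le
      have k6 := k2.trans (mul_le_mul_of_nonneg_right k5 n1)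
      have k7 := k4.trans (mul_le_mul_of_nonneg_right k5 n2)
      rw [e, hA]
      gcongr <;> linarith
    · intro τ hτ
      simp
  intro t ht
  have hE0 : energyH u₀ v₀ = ∫ x, energyHDensity (u 0) (v 0) x := by
    rw [h.init_u, h.init_v]; rfl
  rw [hE0]
  have hl := ((tendsto_integral_weight (hHi t ht)).sub
    (tendsto_integral_weight (hHi 0 h0mem))).abs
  have hr : Filter.Tendsto (fun δ : ℝ => |t| * (δ * A)) (nhdsWithin 0 (Ioi 0))
      (nhds (|t| * (0 * A))) := by
    refine Filter.Tendsto.mono_left (Continuous.tendsto ?_ 0) nhdsWithin_le_nhds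
    fun_prop
  have hle := le_of_tendsto_of_tendsto hl hr (by
    have : ∀ᶠ δ : ℝ in nhdsWithin 0 (Ioi 0), δ < 1 / 2 :=
      nhdsWithin_le_nhds (Iio_mem_nhds (by norm_num))
    filter_upwards [self_mem_nhdsWithin, this] with δ hδ hδ2 using key δ hδ hδ2.le t ht)
  rw [zero_mul, mul_zero] at hle
  have := abs_eq_zero.1 (le_antisymm hle (abs_nonneg _))
  linarith

end IsSmoothSolution

/-- Bounds for `(u, v)` and the nonlocal terms of the system that are uniform on the strip:
`m` bounds the functions pointwise, and `Q` bounds the integrals of `uₓ² + vₓ² + uₓ² vₓ²`. -/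
structure HasUniformBounds (T m Q : ℝ) (u v : ℝ → ℝ → ℝ) : Prop where
  u_le : ∀ t ∈ Icc (-T) T, ∀ x, |u t x| ≤ m
  v_le : ∀ t ∈ Icc (-T) T, ∀ x, |v t x| ≤ m
  U_le : ∀ t ∈ Icc (-T) T, ∀ x, |nonlocalU (u t) (v t) x| ≤ m
  V_le : ∀ t ∈ Icc (-T) T, ∀ x, |nonlocalV (u t) (v t) x| ≤ m
  U_le' : ∀ t ∈ Icc (-T) T, ∀ x, |nonlocalU (v t) (u t) x| ≤ m
  V_le' : ∀ t ∈ Icc (-T) T, ∀ x, |nonlocalV (v t) (u t) x| ≤ m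
  integrable : ∀ t ∈ Icc (-T) T, Integrable fun x =>
    deriv (u t) x ^ 2 + deriv (v t) x ^ 2 + deriv (u t) x ^ 2 * deriv (v t) x ^ 2
  integral_le : ∀ t ∈ Icc (-T) T, ∫ x, (deriv (u t) x ^ 2 + deriv (v t) x ^ 2
    + deriv (u t) x ^ 2 * deriv (v t) x ^ 2) ≤ Q

namespace IsSmoothSolution

variable {T : ℝ} {u₀ v₀ : ℝ → ℝ} {u v : ℝ → ℝ → ℝ}

lemma sq_le (hT : 0 < T) (h : IsSmoothSolution T u₀ v₀ u v) {t : ℝ} (ht : t ∈ Icc (-T) T)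
    (x : ℝ) : u t x ^ 2 ≤ 2 * energy u₀ :=
  (sq_le_energy (fun x => (h.smooth_u.hasDerivAt ht x).differentiableAt)
    ((h.smooth_u.dx hT).continuous ht) (h.memSigma t ht).integrable_energyDensity x).trans
    (h.integral_energyDensity_le hT t ht)

/-- Conservation of `H` turns the energy bounds into a bound for `∫ uₓ² vₓ²`. -/
lemma integral_mul_deriv_sq_le (hT : 0 < T) (h : IsSmoothSolution T u₀ v₀ u v) {L : ℝ}
    (hL : 1 ≤ L) (hu : energy u₀ ≤ L) (hv : energy v₀ ≤ L) (hH : -energyH u₀ v₀ ≤ L) {t : ℝ}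
    (ht : t ∈ Icc (-T) T) : ∫ x, deriv (u t) x ^ 2 * deriv (v t) x ^ 2 ≤ 37 * L ^ 2 := by
  have hσ := h.memSigma t ht
  have i1 := hσ.integrable_mul_deriv_sq
  have i2 := h.integrable_energyHDensity hT ht
  have i3 := hσ.integrable_energyDensity
  have i4 := hσ.symm.integrable_energyDensity
  have hle : ∀ x, deriv (u t) x ^ 2 * deriv (v t) x ^ 2
      ≤ 8 * L * (energyDensity (u t) x + energyDensity (v t) x)
        - energyHDensity (u t) (v t) x := by
    intro x
    have a1 : u t x ^ 2 ≤ 2 * L := (h.sq_le hT ht x).trans (by linarith)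
    have a2 : v t x ^ 2 ≤ 2 * L := (h.symm.sq_le hT ht x).trans (by linarith)
    rw [energyHDensity, energyDensity, energyDensity]
    have b1 := mul_le_mul_of_nonneg_right a1 (sq_nonneg (v t x))
    have b2 := mul_le_mul_of_nonneg_right a1 (sq_nonneg (deriv (v t) x))
    have b3 := mul_le_mul_of_nonneg_right a2 (sq_nonneg (deriv (u t) x))
    have b4 := sq_nonneg (u t x * deriv (v t) x - v t x * deriv (u t) x)
    have b5 : 0 ≤ L * u t x ^ 2 := by positivity
    have b6 : 0 ≤ L * v t x ^ 2 := by positivity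
    have b7 : 0 ≤ L * deriv (u t) x ^ 2 := by positivity
    have b8 : 0 ≤ L * deriv (v t) x ^ 2 := by positivity
    nlinarith
  have i34 : Integrable fun x => 8 * L * (energyDensity (u t) x + energyDensity (v t) x) :=
    (i3.add i4).const_mul (8 * L)
  have hmono := integral_mono i1 (i34.sub i2) hle
  simp only [Pi.sub_apply] at hmono
  rw [integral_sub i34 i2, integral_const_mul, integral_add i3 i4,
    h.integral_energyHDensity hT t ht] at hmono
  have s1 := h.integral_energyDensity_le hT t ht
  have s2 := h.symm.integral_energyDensity_le hT t ht
  nlinarith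

/-- The nonlocal terms are bounded by the conserved energies. -/
lemma abs_nonlocal_le_energy (hT : 0 < T) (h : IsSmoothSolution T u₀ v₀ u v) {L : ℝ}
    (hL : 1 ≤ L) (hu : energy u₀ ≤ L) (hv : energy v₀ ≤ L) (hH : -energyH u₀ v₀ ≤ L) {t : ℝ}
    (ht : t ∈ Icc (-T) T) (x : ℝ) :
    |nonlocalU (u t) (v t) x| ≤ 20 * L ^ 2 ∧ |nonlocalV (u t) (v t) x| ≤ 20 * L ^ 2 := by
  have hσ := h.memSigma t ht
  have i1 := hσ.integrable_mul_deriv_sq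
  have i3 := hσ.integrable_energyDensity
  have i4 := hσ.symm.integrable_energyDensity
  have hs1 := h.integral_energyDensity_le hT t ht
  have hs2 := h.symm.integral_energyDensity_le hT t ht
  have hs3 := h.integral_mul_deriv_sq_le hT hL hu hv hH ht
  have c1 := (h.smooth_energyDensity hT).continuous ht
  have c2 := (h.symm.smooth_energyDensity hT).continuous ht
  have c3 := (h.smooth_u.dx hT).continuous ht
  have c4 := (h.smooth_v.dx hT).continuous ht
  have habs : ∀ y, |u t y| ≤ 2 * L ∧ |v t y| ≤ 2 * L := by
    intro y
    have a1 : u t y ^ 2 ≤ 2 * L := (h.sq_le hT ht y).trans (by linarith)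
    have a2 : v t y ^ 2 ≤ 2 * L := (h.symm.sq_le hT ht y).trans (by linarith)
    exact ⟨abs_le_of_sq_le_sq (by nlinarith) (by linarith),
      abs_le_of_sq_le_sq (by nlinarith) (by linarith)⟩
  -- pointwise bounds for the two densities
  have p1 : ∀ y, |source1 (u t) (v t) y|
      ≤ 2 * L * (energyDensity (u t) y + energyDensity (v t) y) := by
    intro y
    obtain ⟨a1, a2⟩ := habs y
    have e1 : |u t y ^ 2 * v t y| ≤ u t y ^ 2 * (2 * L) := by
      rw [abs_mul, abs_of_nonneg (sq_nonneg (u t y))]; gcongr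
    have e2 : |u t y * (deriv (u t) y * deriv (v t) y)|
        ≤ 2 * L * ((deriv (u t) y ^ 2 + deriv (v t) y ^ 2) / 2) := by
      rw [abs_mul]
      have := abs_mul_le_half_sq_add (deriv (u t) y) (deriv (v t) y)
      gcongr
    have e3 : |v t y * deriv (u t) y ^ 2| ≤ 2 * L * deriv (u t) y ^ 2 := by
      rw [abs_mul, abs_of_nonneg (sq_nonneg (deriv (u t) y))]; gcongr
    have e4 : 0 ≤ L * v t y ^ 2 := by positivity
    have e5 : 0 ≤ L * deriv (v t) y ^ 2 := by positivity
    rw [abs_le] at e1 e2 e3 ⊢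
    rw [source1, energyDensity, energyDensity]
    constructor
    · linarith [e1.1, e2.1, e3.1]
    · linarith [e1.2, e2.2, e3.2]
  have p2 : ∀ y, |source2 (u t) (v t) y|
      ≤ (energyDensity (u t) y + deriv (u t) y ^ 2 * deriv (v t) y ^ 2) / 2 := by
    intro y
    have := abs_mul_le_half_sq_add (deriv (u t) y) (deriv (u t) y * deriv (v t) y)
    rw [source2, energyDensity]
    calc _ = |deriv (u t) y * (deriv (u t) y * deriv (v t) y)| := by congr 1; ring
      _ ≤ _ := this
      _ ≤ _ := by nlinarith [sq_nonneg (u t y)]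
  have g1i : Integrable fun y => 2 * L * (energyDensity (u t) y + energyDensity (v t) y) :=
    (i3.add i4).const_mul _
  have g2i : Integrable fun y =>
      (energyDensity (u t) y + deriv (u t) y ^ 2 * deriv (v t) y ^ 2) / 2 :=
    (i3.add i1).div_const _
  have g1c : Continuous fun y => 2 * L * (energyDensity (u t) y + energyDensity (v t) y) := by
    fun_prop
  have g2c : Continuous fun y =>
      (energyDensity (u t) y + deriv (u t) y ^ 2 * deriv (v t) y ^ 2) / 2 := by fun_prop
  have A1 := Admissible.of_integrable g1c g1i
  have A2 := Admissible.of_integrable g2c g2i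
  have k1 := invHelmholtz_le_integral g1c (fun y => (abs_nonneg _).trans (p1 y)) g1i x
  have k2 := invHelmholtz_le_integral g2c (fun y => (abs_nonneg _).trans (p2 y)) g2i x
  have I1 : ∫ y, 2 * L * (energyDensity (u t) y + energyDensity (v t) y) ≤ 8 * L ^ 2 := by
    rw [integral_const_mul, integral_add i3 i4]
    nlinarith
  have I2 : ∫ y, (energyDensity (u t) y + deriv (u t) y ^ 2 * deriv (v t) y ^ 2) / 2
      ≤ 20 * L ^ 2 := by
    rw [integral_div, integral_add i3 i1]
    nlinarith
  have B1 := A1.abs_invHelmholtz_le (h.admissible_source1 hT ht) p1 x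
  have B2 := A1.abs_dxInvHelmholtz_le (h.admissible_source1 hT ht) p1 x
  have B3 := A2.abs_invHelmholtz_le (h.admissible_source2 hT ht) p2 x
  have B4 := A2.abs_dxInvHelmholtz_le (h.admissible_source2 hT ht) p2 x
  constructor
  · refine (abs_add_le _ _).trans ?_
    rw [abs_mul, abs_of_pos (by norm_num : (0 : ℝ) < 1 / 2)]
    nlinarith
  · refine (abs_add_le _ _).trans ?_
    rw [abs_mul, abs_of_pos (by norm_num : (0 : ℝ) < 1 / 2)]
    nlinarith

/-- The bounds for a smooth solution that depend on the conserved energies only. -/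
lemma hasUniformBounds (hT : 0 < T) (h : IsSmoothSolution T u₀ v₀ u v) {L : ℝ}
    (hL : 1 ≤ L) (hu : energy u₀ ≤ L) (hv : energy v₀ ≤ L) (hH : -energyH u₀ v₀ ≤ L) :
    HasUniformBounds T (20 * L ^ 2) (41 * L ^ 2) u v := by
  have hHsymm : energyH v₀ u₀ = energyH u₀ v₀ := by
    unfold energyH
    congr 1
    ext x
    ring
  have habs : ∀ t ∈ Icc (-T) T, ∀ y, |u t y| ≤ 20 * L ^ 2 ∧ |v t y| ≤ 20 * L ^ 2 := by
    intro t ht y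
    have a1 : u t y ^ 2 ≤ 2 * L := (h.sq_le hT ht y).trans (by linarith)
    have a2 : v t y ^ 2 ≤ 2 * L := (h.symm.sq_le hT ht y).trans (by linarith)
    have a3 : |u t y| ≤ 2 * L := abs_le_of_sq_le_sq (by nlinarith) (by linarith)
    have a4 : |v t y| ≤ 2 * L := abs_le_of_sq_le_sq (by nlinarith) (by linarith)
    constructor <;> nlinarith
  have hint : ∀ t ∈ Icc (-T) T, Integrable fun x => energyDensity (u t) x
      + energyDensity (v t) x + deriv (u t) x ^ 2 * deriv (v t) x ^ 2 := fun t ht =>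
    ((h.memSigma t ht).integrable_energyDensity.add
      (h.symm.memSigma t ht).integrable_energyDensity).add
      (h.memSigma t ht).integrable_mul_deriv_sq
  have hle : ∀ t x, deriv (u t) x ^ 2 + deriv (v t) x ^ 2
      + deriv (u t) x ^ 2 * deriv (v t) x ^ 2 ≤ energyDensity (u t) x
      + energyDensity (v t) x + deriv (u t) x ^ 2 * deriv (v t) x ^ 2 := fun t x => by
    rw [energyDensity, energyDensity]
    nlinarith [sq_nonneg (u t x), sq_nonneg (v t x)]
  have hint' : ∀ t ∈ Icc (-T) T, Integrable fun x => deriv (u t) x ^ 2 + deriv (v t) x ^ 2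
      + deriv (u t) x ^ 2 * deriv (v t) x ^ 2 := fun t ht => by
    have c3 := (h.smooth_u.dx hT).continuous ht
    have c4 := (h.smooth_v.dx hT).continuous ht
    refine (hint t ht).mono' (by fun_prop) (Filter.Eventually.of_forall fun x => ?_)
    rw [Real.norm_eq_abs, abs_of_nonneg (by positivity)]
    exact hle t x
  exact {
    u_le := fun t ht x => (habs t ht x).1
    v_le := fun t ht x => (habs t ht x).2
    U_le := fun t ht x => (h.abs_nonlocal_le_energy hT hL hu hv hH ht x).1
    V_le := fun t ht x => (h.abs_nonlocal_le_energy hT hL hu hv hH ht x).2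
    U_le' := fun t ht x =>
      (h.symm.abs_nonlocal_le_energy hT hL hv hu (by rwa [hHsymm]) ht x).1
    V_le' := fun t ht x =>
      (h.symm.abs_nonlocal_le_energy hT hL hv hu (by rwa [hHsymm]) ht x).2
    integrable := hint'
    integral_le := fun t ht => by
      refine (integral_mono (hint' t ht) (hint t ht) (hle t)).trans ?_
      have i3 := (h.memSigma t ht).integrable_energyDensity
      have i4 := (h.symm.memSigma t ht).integrable_energyDensity
      have i34 : Integrable fun x => energyDensity (u t) x + energyDensity (v t) x := i3.add i4
      rw [integral_add i34 (h.memSigma t ht).integrable_mul_deriv_sq, integral_add i3 i4]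
      have s1 := h.integral_energyDensity_le hT t ht
      have s2 := h.symm.integral_energyDensity_le hT t ht
      have s3 := h.integral_mul_deriv_sq_le hT hL hu hv hH ht
      nlinarith }

end IsSmoothSolution

/-! ### Linearization of the system -/

/-- Differentiation under the integral sign at `ε = 0` for integrands that are Lipschitz at `0`. -/
lemma hasDerivAt_integral_of_lip {α : Type*} [MeasurableSpace α] {μ : Measure α}
    {F : ℝ → α → ℝ} {F' bound : α → ℝ} {ε₀ : ℝ} (hε₀ : 0 < ε₀)
    (hF : ∀ ε, |ε| < ε₀ → Integrable (F ε) μ) (hb : Integrable bound μ)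
    (hlip : ∀ ε, |ε| < ε₀ → ∀ᵐ a ∂μ, |F ε a - F 0 a| ≤ bound a * |ε|)
    (hd : ∀ᵐ a ∂μ, HasDerivAt (fun ε => F ε a) (F' a) 0) :
    HasDerivAt (fun ε => ∫ a, F ε a ∂μ) (∫ a, F' a ∂μ) 0 := by
  have h0 : Integrable (F 0) μ := hF 0 (by simpa using hε₀)
  have hev : ∀ᶠ ε : ℝ in nhdsWithin 0 {0}ᶜ, |ε| < ε₀ := by
    refine nhdsWithin_le_nhds ?_
    have := Metric.ball_mem_nhds (0 : ℝ) hε₀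
    filter_upwards [this] with ε hε
    simpa using hε
  rw [hasDerivAt_iff_tendsto_slope]
  have hlim : Filter.Tendsto (fun ε : ℝ => ∫ a, ε⁻¹ * (F ε a - F 0 a) ∂μ) (nhdsWithin 0 {0}ᶜ)
      (nhds (∫ a, F' a ∂μ)) := by
    refine tendsto_integral_filter_of_dominated_convergence bound ?_ ?_ hb ?_
    · filter_upwards [hev] with ε hε
      exact (((hF ε hε).sub h0).const_mul _).aestronglyMeasurable
    · filter_upwards [hev, self_mem_nhdsWithin] with ε hε hne
      filter_upwards [hlip ε hε] with a ha
      have hpos : 0 < |ε| := abs_pos.2 hne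
      rw [norm_mul, Real.norm_eq_abs, Real.norm_eq_abs, abs_inv, inv_mul_le_iff₀ hpos]
      linarith
    · filter_upwards [hd] with a ha
      have := hasDerivAt_iff_tendsto_slope.1 ha
      refine this.congr fun ε => ?_
      simp [slope_def_field, div_eq_inv_mul]
  refine hlim.congr' ?_
  filter_upwards [hev] with ε hε
  rw [integral_const_mul, integral_sub (hF ε hε) h0, slope_def_field, sub_zero, div_eq_inv_mul]

/-- First-order expansion `w^ε = w + ε ρ + o(ε)` on the strip, with uniformly bounded difference
quotients, for a family of functions that are bounded and continuous in `x`. This class is stable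
under products and under the nonlocal operators. -/
structure UniformExpansion (T : ℝ) (wε : ℝ → ℝ → ℝ → ℝ) (w ρ : ℝ → ℝ → ℝ) : Prop where
  at_zero : ∀ t ∈ Icc (-T) T, ∀ x, wε 0 t x = w t x
  expand : ∀ t ∈ Icc (-T) T, ∀ x, HasDerivAt (fun ε => wε ε t x) (ρ t x) 0
  bdd : BoundedOnStrip T w
  lip : ∃ L ε₀ : ℝ, 0 ≤ L ∧ 0 < ε₀ ∧ ∀ ε, |ε| < ε₀ → ∀ t ∈ Icc (-T) T,
    Continuous (wε ε t) ∧ ∀ x, |wε ε t x - w t x| ≤ L * |ε|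

namespace UniformExpansion

variable {T : ℝ} {wε zε : ℝ → ℝ → ℝ → ℝ} {w z ρ σ : ℝ → ℝ → ℝ}

lemma bdd_right (h : UniformExpansion T wε w ρ) : BoundedOnStrip T ρ := by
  obtain ⟨L, ε₀, hL, hε₀, hlip⟩ := h.lip
  refine ⟨L, fun t ht x => ?_⟩
  refine (h.expand t ht x).le_of_lip' hL ?_
  have := Metric.ball_mem_nhds (0 : ℝ) hε₀
  filter_upwards [this] with ε hε
  rw [h.at_zero t ht x, sub_zero, Real.norm_eq_abs, Real.norm_eq_abs]
  exact (hlip ε (by simpa using hε) t ht).2 x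

/-- The members of the family are uniformly bounded for small `ε`. -/
lemma exists_bound (h : UniformExpansion T wε w ρ) : ∃ M L ε₀ : ℝ, 0 ≤ M ∧ 0 ≤ L ∧ 0 < ε₀ ∧
    ∀ ε, |ε| < ε₀ → ∀ t ∈ Icc (-T) T, Continuous (wε ε t) ∧
      ∀ x, |wε ε t x| ≤ M ∧ |w t x| ≤ M ∧ |wε ε t x - w t x| ≤ L * |ε| := by
  obtain ⟨L, ε₀, hL, hε₀, hlip⟩ := h.lip
  obtain ⟨M, hM1, hM⟩ := h.bdd.exists_one_le
  refine ⟨M + L * ε₀, L, ε₀, by positivity, hL, hε₀, fun ε hε t ht =>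
    ⟨(hlip ε hε t ht).1, fun x => ?_⟩⟩
  have h1 := (hlip ε hε t ht).2 x
  have h2 := hM t ht x
  have h3 : L * |ε| ≤ L * ε₀ := by gcongr
  have h4 : |wε ε t x| ≤ |wε ε t x - w t x| + |w t x| := by
    simpa using abs_add_le (wε ε t x - w t x) (w t x)
  have h5 : 0 ≤ L * ε₀ := by positivity
  exact ⟨by linarith, by linarith, h1⟩

lemma congr {ρ' : ℝ → ℝ → ℝ} (h : UniformExpansion T wε w ρ)
    (hρ : ∀ t ∈ Icc (-T) T, ∀ x, ρ' t x = ρ t x) : UniformExpansion T wε w ρ' where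
  at_zero := h.at_zero
  expand t ht x := by rw [hρ t ht x]; exact h.expand t ht x
  bdd := h.bdd
  lip := h.lip

lemma const (c : ℝ) : UniformExpansion T (fun _ _ _ => c) (fun _ _ => c) fun _ _ => 0 where
  at_zero _ _ _ := rfl
  expand _ _ _ := hasDerivAt_const _ _
  bdd := BoundedOnStrip.const c
  lip := ⟨0, 1, le_rfl, one_pos, fun _ _ _ _ => ⟨continuous_const, fun _ => by simp⟩⟩

lemma add (h : UniformExpansion T wε w ρ) (h' : UniformExpansion T zε z σ) :
    UniformExpansion T (fun ε t x => wε ε t x + zε ε t x) (fun t x => w t x + z t x)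
      fun t x => ρ t x + σ t x where
  at_zero t ht x := by rw [h.at_zero t ht, h'.at_zero t ht]
  expand t ht x := (h.expand t ht x).fun_add (h'.expand t ht x)
  bdd := h.bdd.add h'.bdd
  lip := by
    obtain ⟨L, ε₀, hL, hε₀, hlip⟩ := h.lip
    obtain ⟨L', ε₀', hL', hε₀', hlip'⟩ := h'.lip
    refine ⟨L + L', min ε₀ ε₀', by positivity, lt_min hε₀ hε₀', fun ε hε t ht => ?_⟩
    have a1 := hlip ε (hε.trans_le (min_le_left _ _)) t ht
    have a2 := hlip' ε (hε.trans_le (min_le_right _ _)) t ht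
    refine ⟨a1.1.add a2.1, fun x => ?_⟩
    calc |wε ε t x + zε ε t x - (w t x + z t x)|
        = |(wε ε t x - w t x) + (zε ε t x - z t x)| := by congr 1; ring
      _ ≤ _ := abs_add_le _ _
      _ ≤ L * |ε| + L' * |ε| := add_le_add (a1.2 x) (a2.2 x)
      _ = _ := by ring

lemma mul (h : UniformExpansion T wε w ρ) (h' : UniformExpansion T zε z σ) :
    UniformExpansion T (fun ε t x => wε ε t x * zε ε t x) (fun t x => w t x * z t x)
      fun t x => ρ t x * z t x + w t x * σ t x where
  at_zero t ht x := by rw [h.at_zero t ht, h'.at_zero t ht]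
  expand t ht x := by
    have := (h.expand t ht x).fun_mul (h'.expand t ht x)
    rwa [h.at_zero t ht, h'.at_zero t ht] at this
  bdd := h.bdd.mul h'.bdd
  lip := by
    obtain ⟨M, L, ε₀, hM, hL, hε₀, hlip⟩ := h.exists_bound
    obtain ⟨M', L', ε₀', hM', hL', hε₀', hlip'⟩ := h'.exists_bound
    refine ⟨L * M' + M * L', min ε₀ ε₀', by positivity, lt_min hε₀ hε₀', fun ε hε t ht => ?_⟩
    obtain ⟨c1, a1⟩ := hlip ε (hε.trans_le (min_le_left _ _)) t ht
    obtain ⟨c2, a2⟩ := hlip' ε (hε.trans_le (min_le_right _ _)) t ht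
    refine ⟨c1.mul c2, fun x => ?_⟩
    obtain ⟨b1, b2, b3⟩ := a1 x
    obtain ⟨b4, b5, b6⟩ := a2 x
    calc |wε ε t x * zε ε t x - w t x * z t x|
        = |(wε ε t x - w t x) * zε ε t x + w t x * (zε ε t x - z t x)| := by congr 1; ring
      _ ≤ |wε ε t x - w t x| * |zε ε t x| + |w t x| * |zε ε t x - z t x| := by
          rw [← abs_mul, ← abs_mul]; exact abs_add_le _ _
      _ ≤ L * |ε| * M' + M * (L' * |ε|) := by gcongr
      _ = _ := by ring

/-- Expansion of an integral operator whose kernel is dominated by `e^{-|x - y|}`. -/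
lemma hasDerivAt_kernel (h : UniformExpansion T wε w ρ) {k : ℝ → ℝ → ℝ}
    (hk : ∀ x, Measurable (k x)) (hk1 : ∀ x y, |k x y| ≤ 1) {t : ℝ} (ht : t ∈ Icc (-T) T)
    (x : ℝ) :
    HasDerivAt (fun ε => (1 / 2) * ∫ y, k x y * (Real.exp (-|x - y|) * wε ε t y))
      ((1 / 2) * ∫ y, k x y * (Real.exp (-|x - y|) * ρ t y)) 0 := by
  obtain ⟨M, L, ε₀, hM, hL, hε₀, hlip⟩ := h.exists_bound
  refine HasDerivAt.const_mul _ (hasDerivAt_integral_of_lip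
    (bound := fun y => Real.exp (-|x - y|) * L) hε₀ (fun ε hε => ?_) ?_ (fun ε hε => ?_) ?_)
  · obtain ⟨c, b⟩ := hlip ε hε t ht
    exact ((Admissible.of_bounded c fun y => (b y).1).integrable_kernel x).bdd_mul (c := 1)
      (hk x).aestronglyMeasurable (Filter.Eventually.of_forall (hk1 x))
  · exact (Admissible.of_bounded continuous_const fun _ => le_rfl).integrable_kernel x
  · filter_upwards with y
    have b := ((hlip ε hε t ht).2 y).2.2
    rw [h.at_zero t ht, ← mul_sub, ← mul_sub, abs_mul, abs_mul, abs_of_pos (Real.exp_pos _)]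
    calc _ ≤ 1 * (Real.exp (-|x - y|) * (L * |ε|)) := by
          have := hk1 x y
          gcongr
      _ = _ := by ring
  · filter_upwards with y
    exact ((h.expand t ht y).const_mul _).const_mul _

lemma lip_of_linear (h : UniformExpansion T wε w ρ) (hw : SmoothOnStrip T w)
    {A : (ℝ → ℝ) → ℝ → ℝ} (hA : ∀ p, Admissible p → Continuous (A p))
    (hsub : ∀ p q, Admissible p → Admissible q → ∀ x,
      A (fun y => p y - q y) x = A p x - A q x)
    (hle : ∀ p q, Admissible p → Admissible q → (∀ x, |q x| ≤ p x) → ∀ x,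
      |A q x| ≤ Novikov.invHelmholtz p x) :
    ∃ L ε₀ : ℝ, 0 ≤ L ∧ 0 < ε₀ ∧ ∀ ε, |ε| < ε₀ → ∀ t ∈ Icc (-T) T,
      Continuous (A (wε ε t)) ∧ ∀ x, |A (wε ε t) x - A (w t) x| ≤ L * |ε| := by
  obtain ⟨M, L, ε₀, hM, hL, hε₀, hlip⟩ := h.exists_bound
  refine ⟨L, ε₀, hL, hε₀, fun ε hε t ht => ?_⟩
  obtain ⟨c, b⟩ := hlip ε hε t ht
  have A1 := Admissible.of_bounded c fun y => (b y).1
  have A2 := h.bdd.admissible hw ht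
  refine ⟨hA _ A1, fun x => ?_⟩
  rw [← hsub _ _ A1 A2, ← invHelmholtz_const (L * |ε|) x]
  exact hle _ _ (Admissible.of_bounded continuous_const fun _ => le_rfl) (A1.sub A2)
    (fun y => (b y).2.2) x

lemma invHelmholtz (h : UniformExpansion T wε w ρ) (hw : SmoothOnStrip T w) :
    UniformExpansion T (fun ε t => invHelmholtz (wε ε t)) (fun t => invHelmholtz (w t))
      fun t => invHelmholtz (ρ t) where
  at_zero t ht x := by rw [show wε 0 t = w t from funext (h.at_zero t ht)]
  expand t ht x := by
    have := h.hasDerivAt_kernel (k := fun _ _ => 1) (fun _ => measurable_const)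
      (fun _ _ => by simp) ht x
    simp only [one_mul] at this
    exact this
  bdd := h.bdd.invHelmholtz hw
  lip := h.lip_of_linear hw (fun p hp => hp.continuous_invHelmholtz)
    (fun p q hp hq => hp.invHelmholtz_sub hq) fun p q hp hq => hp.abs_invHelmholtz_le hq

lemma dxInvHelmholtz (h : UniformExpansion T wε w ρ) (hw : SmoothOnStrip T w) :
    UniformExpansion T (fun ε t => dxInvHelmholtz (wε ε t)) (fun t => dxInvHelmholtz (w t))
      fun t => dxInvHelmholtz (ρ t) where
  at_zero t ht x := by rw [show wε 0 t = w t from funext (h.at_zero t ht)]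
  expand t ht x := h.hasDerivAt_kernel (k := fun x y => if y ≤ x then -1 else 1)
    (fun _ => Measurable.ite measurableSet_Iic measurable_const measurable_const)
    (fun _ _ => by split_ifs <;> simp) ht x
  bdd := h.bdd.dxInvHelmholtz hw
  lip := h.lip_of_linear hw (fun p hp => hp.continuous_dxInvHelmholtz)
    (fun p q hp hq => hp.dxInvHelmholtz_sub hq) fun p q hp hq => hp.abs_dxInvHelmholtz_le hq

end UniformExpansion

lemma continuousOn_time_kernel {T : ℝ} {w : ℝ → ℝ → ℝ} (hw : SmoothOnStrip T w)
    (hb : BoundedOnStrip T w) {k : ℝ → ℝ → ℝ} (hk : ∀ x, Measurable (k x))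
    (hk1 : ∀ x y, |k x y| ≤ 1) (x : ℝ) :
    ContinuousOn (fun t => (1 / 2) * ∫ y, k x y * (Real.exp (-|x - y|) * w t y))
      (Icc (-T) T) := by
  obtain ⟨M, hM⟩ := id hb
  refine continuousOn_const.mul (continuousOn_of_dominated
    (bound := fun y => Real.exp (-|x - y|) * M) (fun t ht => ?_) (fun t ht => ?_) ?_ ?_)
  · exact (((hb.admissible hw ht).integrable_kernel x).bdd_mul (c := 1)
      (hk x).aestronglyMeasurable
      (Filter.Eventually.of_forall (hk1 x))).aestronglyMeasurable
  · filter_upwards with y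
    rw [norm_mul, norm_mul, Real.norm_eq_abs, Real.norm_eq_abs, Real.norm_eq_abs,
      abs_of_pos (Real.exp_pos _)]
    have h1 := hk1 x y
    have h2 := hM t ht y
    calc _ ≤ 1 * (Real.exp (-|x - y|) * M) := by gcongr
      _ = _ := one_mul _
  · exact (Admissible.of_bounded continuous_const fun _ => le_rfl).integrable_kernel x
  · filter_upwards with y
    exact continuousOn_const.mul (continuousOn_const.mul (hw.continuousOn_time y))

lemma continuousOn_time_invHelmholtz {T : ℝ} {w : ℝ → ℝ → ℝ} (hw : SmoothOnStrip T w)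
    (hb : BoundedOnStrip T w) (x : ℝ) :
    ContinuousOn (fun t => invHelmholtz (w t) x) (Icc (-T) T) := by
  have := continuousOn_time_kernel hw hb (k := fun _ _ => 1) (fun _ => measurable_const)
    (fun _ _ => by simp) x
  simp only [one_mul] at this
  exact this

lemma continuousOn_time_dxInvHelmholtz {T : ℝ} {w : ℝ → ℝ → ℝ} (hw : SmoothOnStrip T w)
    (hb : BoundedOnStrip T w) (x : ℝ) :
    ContinuousOn (fun t => dxInvHelmholtz (w t) x) (Icc (-T) T) :=
  continuousOn_time_kernel hw hb (k := fun x y => if y ≤ x then -1 else 1)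
    (fun _ => Measurable.ite measurableSet_Iic measurable_const measurable_const)
    (fun _ _ => by split_ifs <;> simp) x

/-- The linearization of `source1` at `(u, v)` in the direction `(r, s)`. -/
def linSource1 (u v r s : ℝ → ℝ) (y : ℝ) : ℝ :=
  2 * u y * v y * r y + u y ^ 2 * s y + r y * deriv u y * deriv v y + u y * deriv r y * deriv v y
    + u y * deriv u y * deriv s y + (1 / 2) * s y * deriv u y ^ 2 + v y * deriv u y * deriv r y

/-- The linearization of `source2` at `(u, v)` in the direction `(r, s)`. -/
def linSource2 (u v r s : ℝ → ℝ) (y : ℝ) : ℝ :=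
  2 * deriv u y * deriv v y * deriv r y + deriv u y ^ 2 * deriv s y

lemma HasExpansion.uniformExpansion {T : ℝ} {wε : ℝ → ℝ → ℝ → ℝ} {w ρ : ℝ → ℝ → ℝ} {ε₀ : ℝ}
    (h : HasExpansion T wε w ρ) (hε₀ : 0 < ε₀) (hb : BoundedOnStrip T w)
    (hs : ∀ ε, |ε| < ε₀ → SmoothOnStrip T (wε ε)) : UniformExpansion T wε w ρ where
  at_zero := h.at_zero
  expand := h.expand
  bdd := hb
  lip := by
    obtain ⟨L, ε₁, hε₁, hq⟩ := h.quotient_bdd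
    refine ⟨|L|, min ε₀ ε₁, abs_nonneg L, lt_min hε₀ hε₁, fun ε hε t ht =>
      ⟨(hs ε (hε.trans_le (min_le_left _ _))).continuous ht, fun x => ?_⟩⟩
    exact (hq ε (hε.trans_le (min_le_right _ _)) t ht x).1.trans
      (mul_le_mul_of_nonneg_right (le_abs_self L) (abs_nonneg ε))

lemma HasExpansion.uniformExpansion_dx {T : ℝ} (hT : 0 < T) {wε : ℝ → ℝ → ℝ → ℝ}
    {w ρ : ℝ → ℝ → ℝ} {ε₀ : ℝ}
    (h : HasExpansion T wε w ρ) (hε₀ : 0 < ε₀) (hb : BoundedOnStrip T fun t => deriv (w t))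
    (hs : ∀ ε, |ε| < ε₀ → SmoothOnStrip T (wε ε)) :
    UniformExpansion T (fun ε t => deriv (wε ε t)) (fun t => deriv (w t))
      fun t => deriv (ρ t) where
  at_zero t ht x := by rw [show wε 0 t = w t from funext (h.at_zero t ht)]
  expand := h.expand_deriv
  bdd := hb
  lip := by
    obtain ⟨L, ε₁, hε₁, hq⟩ := h.quotient_bdd
    refine ⟨|L|, min ε₀ ε₁, abs_nonneg L, lt_min hε₀ hε₁, fun ε hε t ht =>
      ⟨((hs ε (hε.trans_le (min_le_left _ _))).dx hT).continuous ht, fun x => ?_⟩⟩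
    exact (hq ε (hε.trans_le (min_le_right _ _)) t ht x).2.trans
      (mul_le_mul_of_nonneg_right (le_abs_self L) (abs_nonneg ε))

namespace IsTangentVector

variable {T : ℝ} {u₀ v₀ : ℝ → ℝ} {u v r s : ℝ → ℝ → ℝ}

lemma symm (h : IsTangentVector T u v r s) : IsTangentVector T v u s r where
  smooth_r := h.smooth_s
  smooth_s := h.smooth_r
  family := by
    obtain ⟨ε₀, uε, vε, hε₀, hsol, hu, hv⟩ := h.family
    exact ⟨ε₀, vε, uε, hε₀, fun ε hε => (hsol ε hε).symm, hv, hu⟩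

lemma bdd (h : IsTangentVector T u v r s) (hT : 0 < T) (hsol : IsSmoothSolution T u₀ v₀ u v) :
    BoundedOnStrip T r ∧ BoundedOnStrip T fun t => deriv (r t) := by
  obtain ⟨ε₀, uε, vε, hε₀, hε, hu, hv⟩ := h.family
  exact ⟨(hu.uniformExpansion hε₀ hsol.bdd_u fun ε h => (hε ε h).smooth_u).bdd_right,
    (hu.uniformExpansion_dx hT hε₀ hsol.bdd_ux fun ε h => (hε ε h).smooth_u).bdd_right⟩

lemma smooth_linSource1 (h : IsTangentVector T u v r s) (hT : 0 < T)
    (hsol : IsSmoothSolution T u₀ v₀ u v) :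
    SmoothOnStrip T fun t => linSource1 (u t) (v t) (r t) (s t) := by
  have su := hsol.smooth_u
  have sv := hsol.smooth_v
  have sr := h.smooth_r
  have ss := h.smooth_s
  have c2 : SmoothOnStrip T fun _ _ => (2 : ℝ) := SmoothOnStrip.const 2
  have c1 : SmoothOnStrip T fun _ _ => (1 / 2 : ℝ) := SmoothOnStrip.const _
  exact (((((((c2.mul su).mul sv).mul sr).add ((su.pow 2).mul ss)).add
    ((sr.mul (su.dx hT)).mul (sv.dx hT))).add ((su.mul (sr.dx hT)).mul (sv.dx hT))).add
    ((su.mul (su.dx hT)).mul (ss.dx hT))).add ((c1.mul ss).mul ((su.dx hT).pow 2)) |>.add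
    ((sv.mul (su.dx hT)).mul (sr.dx hT))

lemma bdd_linSource1 (h : IsTangentVector T u v r s) (hT : 0 < T)
    (hsol : IsSmoothSolution T u₀ v₀ u v) :
    BoundedOnStrip T fun t => linSource1 (u t) (v t) (r t) (s t) := by
  obtain ⟨br, brx⟩ := h.bdd hT hsol
  obtain ⟨bs, bsx⟩ := h.symm.bdd hT hsol.symm
  have c2 : BoundedOnStrip T fun _ _ => (2 : ℝ) := BoundedOnStrip.const 2
  have c1 : BoundedOnStrip T fun _ _ => (1 / 2 : ℝ) := BoundedOnStrip.const _
  have bu := hsol.bdd_u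
  have bv := hsol.bdd_v
  have bux := hsol.bdd_ux
  have bvx := hsol.bdd_vx
  exact (((((((c2.mul bu).mul bv).mul br).add ((bu.pow 2).mul bs)).add
    ((br.mul bux).mul bvx)).add ((bu.mul brx).mul bvx)).add
    ((bu.mul bux).mul bsx)).add ((c1.mul bs).mul (bux.pow 2)) |>.add
    ((bv.mul bux).mul brx)

lemma smooth_linSource2 (h : IsTangentVector T u v r s) (hT : 0 < T)
    (hsol : IsSmoothSolution T u₀ v₀ u v) :
    SmoothOnStrip T fun t => linSource2 (u t) (v t) (r t) (s t) := by
  have su := hsol.smooth_u.dx hT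
  have sv := hsol.smooth_v.dx hT
  exact ((((SmoothOnStrip.const 2).mul su).mul sv).mul (h.smooth_r.dx hT)).add
    ((su.pow 2).mul (h.smooth_s.dx hT))

lemma bdd_linSource2 (h : IsTangentVector T u v r s) (hT : 0 < T)
    (hsol : IsSmoothSolution T u₀ v₀ u v) :
    BoundedOnStrip T fun t => linSource2 (u t) (v t) (r t) (s t) := by
  obtain ⟨-, brx⟩ := h.bdd hT hsol
  obtain ⟨-, bsx⟩ := h.symm.bdd hT hsol.symm
  exact ((((BoundedOnStrip.const 2).mul hsol.bdd_ux).mul hsol.bdd_vx).mul brx).add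
    ((hsol.bdd_ux.pow 2).mul bsx)

/-- The linearized system, obtained by differentiating the time-integrated equations of the
family at `ε = 0`. -/
lemma materialDeriv (h : IsTangentVector T u v r s) (hT : 0 < T)
    (hsol : IsSmoothSolution T u₀ v₀ u v) :
    HasMaterialDeriv T (velocity u v) r fun t x =>
      -((u t x * s t x + v t x * r t x) * deriv (u t) x)
        - dxInvHelmholtz (linSource1 (u t) (v t) (r t) (s t)) x
        - (1 / 2) * invHelmholtz (linSource2 (u t) (v t) (r t) (s t)) x := by
  obtain ⟨ε₀, uε, vε, hε₀, hε, hue, hve⟩ := h.family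
  have xu := hue.uniformExpansion hε₀ hsol.bdd_u fun ε h => (hε ε h).smooth_u
  have xv := hve.uniformExpansion hε₀ hsol.bdd_v fun ε h => (hε ε h).smooth_v
  have xux := hue.uniformExpansion_dx hT hε₀ hsol.bdd_ux fun ε h => (hε ε h).smooth_u
  have xvx := hve.uniformExpansion_dx hT hε₀ hsol.bdd_vx fun ε h => (hε ε h).smooth_v
  have x1 := (((xu.mul xu).mul xv).add ((xu.mul xux).mul xvx)).add
    (((UniformExpansion.const (1 / 2)).mul xv).mul (xux.mul xux))
  have x2 := (xux.mul xux).mul xvx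
  have su := hsol.smooth_u
  have sv := hsol.smooth_v
  have y1 := x1.dxInvHelmholtz ((((su.mul su).mul sv).add
    ((su.mul (su.dx hT)).mul (sv.dx hT))).add
    (((SmoothOnStrip.const (1 / 2)).mul sv).mul ((su.dx hT).mul (su.dx hT))))
  have y2 := x2.invHelmholtz (((su.dx hT).mul (su.dx hT)).mul (sv.dx hT))
  have X := (((xu.mul xv).mul xux).add y1).add ((UniformExpansion.const (1 / 2)).mul y2)
  -- the right-hand side of the linearized equation
  set E : ℝ → ℝ → ℝ := fun t x =>
    u t x * v t x * deriv (r t) x + (u t x * s t x + v t x * r t x) * deriv (u t) x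
      + dxInvHelmholtz (linSource1 (u t) (v t) (r t) (s t)) x
      + (1 / 2) * invHelmholtz (linSource2 (u t) (v t) (r t) (s t)) x with hE
  have hX := X.congr (ρ' := E) (by
    intro t ht x
    have e1 : linSource1 (u t) (v t) (r t) (s t) = fun x =>
        (r t x * u t x + u t x * r t x) * v t x + u t x * u t x * s t x
        + ((r t x * deriv (u t) x + u t x * deriv (r t) x) * deriv (v t) x
          + u t x * deriv (u t) x * deriv (s t) x)
        + ((0 * v t x + 1 / 2 * s t x) * (deriv (u t) x * deriv (u t) x)
          + 1 / 2 * v t x * (deriv (r t) x * deriv (u t) x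
            + deriv (u t) x * deriv (r t) x)) := by
      ext y
      rw [linSource1]
      ring
    have e2 : linSource2 (u t) (v t) (r t) (s t) = fun x =>
        (deriv (r t) x * deriv (u t) x + deriv (u t) x * deriv (r t) x) * deriv (v t) x
          + deriv (u t) x * deriv (u t) x * deriv (s t) x := by
      ext y
      rw [linSource2]
      ring
    simp only [hE]
    rw [e1, e2]
    ring)
  have hEc : ∀ x, ContinuousOn (fun t => E t x) (Icc (-T) T) := by
    intro x
    have k1 := continuousOn_time_dxInvHelmholtz (h.smooth_linSource1 hT hsol)
      (h.bdd_linSource1 hT hsol) x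
    have k2 := continuousOn_time_invHelmholtz (h.smooth_linSource2 hT hsol)
      (h.bdd_linSource2 hT hsol) x
    have k3 := su.continuousOn_time x
    have k4 := sv.continuousOn_time x
    have k5 := (su.dx hT).continuousOn_time x
    have k6 := (h.smooth_r.dx hT).continuousOn_time x
    have k7 := h.smooth_r.continuousOn_time x
    have k8 := h.smooth_s.continuousOn_time x
    fun_prop
  -- the equations of the family, integrated in time
  obtain ⟨M, L, ε₁, hM, hL, hε₁, hlip⟩ := hX.exists_bound
  set ε₂ := min ε₀ ε₁ with hε₂
  have hε₂0 : 0 < ε₂ := lt_min hε₀ hε₁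
  have hTm : -T ∈ Icc (-T) T := ⟨le_rfl, by linarith⟩
  set Fε : ℝ → ℝ → ℝ → ℝ := fun ε t x => uε ε t x * vε ε t x * deriv (uε ε t) x
    + dxInvHelmholtz (fun x => uε ε t x * uε ε t x * vε ε t x
        + uε ε t x * deriv (uε ε t) x * deriv (vε ε t) x
        + 1 / 2 * vε ε t x * (deriv (uε ε t) x * deriv (uε ε t) x)) x
    + 1 / 2 * invHelmholtz (fun x => deriv (uε ε t) x * deriv (uε ε t) x
        * deriv (vε ε t) x) x with hFε
  have hder : ∀ ε, |ε| < ε₂ → ∀ t ∈ Icc (-T) T, ∀ x,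
      HasDerivWithinAt (fun τ => uε ε τ x) (-Fε ε t x) (Icc (-T) T) t := by
    intro ε he t ht x
    refine (((hε ε (he.trans_le (min_le_left _ _))).materialDeriv hT).hasDerivWithinAt
      t ht x).congr_deriv ?_
    have e1 : source1 (uε ε t) (vε ε t) = fun x => uε ε t x * uε ε t x * vε ε t x
        + uε ε t x * deriv (uε ε t) x * deriv (vε ε t) x
        + 1 / 2 * vε ε t x * (deriv (uε ε t) x * deriv (uε ε t) x) := by
      ext y
      rw [source1]
      ring
    have e2 : source2 (uε ε t) (vε ε t) = fun x => deriv (uε ε t) x * deriv (uε ε t) x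
        * deriv (vε ε t) x := by
      ext y
      rw [source2]
      ring
    simp only [hFε]
    rw [nonlocalU, velocity, e1, e2]
    ring
  have hFc : ∀ ε, |ε| < ε₂ → ∀ x, ContinuousOn (fun t => -Fε ε t x) (Icc (-T) T) :=
    fun ε he x => (SmoothOnStrip.of_hasDerivWithinAt hT
      (hε ε (he.trans_le (min_le_left _ _))).smooth_u (hder ε he)).continuousOn_time x
  have hint : ∀ t ∈ Icc (-T) T, ∀ x, r t x - r (-T) x = ∫ τ in (-T)..t, -E τ x := by
    intro t ht x
    have hIoc : Ioc (-T) t ⊆ Icc (-T) T := fun τ hτ => ⟨hτ.1.le, hτ.2.trans ht.2⟩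
    have hd : HasDerivAt (fun ε => ∫ τ in Ioc (-T) t, -Fε ε τ x)
        (∫ τ in Ioc (-T) t, -E τ x) 0 := by
      refine hasDerivAt_integral_of_lip (bound := fun _ => L) hε₂0 (fun ε he => ?_) ?_
        (fun ε he => ?_) ?_
      · exact ((hFc ε he x).integrableOn_compact isCompact_Icc).mono_set hIoc
      · exact integrableOn_const (by simp)
      · filter_upwards [ae_restrict_mem measurableSet_Ioc] with τ hτ
        have e0 : Fε 0 τ x = _ := hX.at_zero τ (hIoc hτ) x
        have := ((hlip ε (he.trans_le (min_le_right _ _)) τ (hIoc hτ)).2 x).2.2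
        rw [e0, neg_sub_neg, abs_sub_comm]
        exact this
      · filter_upwards [ae_restrict_mem measurableSet_Ioc] with τ hτ
        exact (hX.expand τ (hIoc hτ) x).fun_neg
    have hd2 := (hue.expand t ht x).fun_sub (hue.expand (-T) hTm x)
    have heq : (fun ε => uε ε t x - uε ε (-T) x) =ᶠ[nhds 0]
        fun ε => ∫ τ in Ioc (-T) t, -Fε ε τ x := by
      filter_upwards [Metric.ball_mem_nhds (0 : ℝ) hε₂0] with ε he
      have he' : |ε| < ε₂ := by simpa using he
      rw [← intervalIntegral.integral_of_le ht.1]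
      exact (integral_time_eq_sub (fun τ hτ => hder ε he' τ hτ x) (hFc ε he' x) hTm ht).symm
    rw [intervalIntegral.integral_of_le ht.1]
    exact (hd2.congr_of_eventuallyEq heq.symm).unique hd
  refine ⟨h.smooth_r, fun t ht x => ?_⟩
  -- differentiate in time
  have hle : -T ≤ T := by linarith
  set g : ℝ → ℝ := IccExtend hle ((Icc (-T) T).domRestrict fun τ => -E τ x) with hg
  have hgc : Continuous g := (continuousOn_iff_continuous_domRestrict.1 (hEc x).neg).Icc_extend'
  have hge : ∀ τ ∈ Icc (-T) T, g τ = -E τ x := fun τ hτ => by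
    rw [hg, IccExtend_of_mem hle _ hτ]; rfl
  have h1 : HasDerivWithinAt (fun t => r (-T) x + ∫ τ in (-T)..t, g τ) (g t) (Icc (-T) T) t :=
    ((hgc.integral_hasStrictDerivAt (-T) t).hasDerivAt.const_add _).hasDerivWithinAt
  have h2 : ∀ t ∈ Icc (-T) T, r t x = r (-T) x + ∫ τ in (-T)..t, g τ := by
    intro t ht
    have e : ∫ τ in (-T)..t, g τ = ∫ τ in (-T)..t, -E τ x := by
      refine intervalIntegral.integral_congr fun τ hτ => hge τ ?_
      rw [uIcc_of_le ht.1] at hτ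
      exact ⟨hτ.1, hτ.2.trans ht.2⟩
    rw [e, ← hint t ht x]
    ring
  refine (h1.congr h2 (h2 t ht)).congr_deriv ?_
  rw [hge t ht, hE, velocity]
  ring

end IsTangentVector

/-! ### Propagation of weighted integrability -/

/-- The bounded truncation `y ↦ N √(1 + y²) / (N + √(1 + y²))` of `|y|`. -/
def truncAbs (N y : ℝ) : ℝ := N * √(1 + y ^ 2) / (N + √(1 + y ^ 2))

/-- The derivative of `truncAbs N`. -/
def truncAbsDeriv (N y : ℝ) : ℝ :=
  N ^ 2 / (N + √(1 + y ^ 2)) ^ 2 * (y / √(1 + y ^ 2))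

lemma contDiff_truncAbs {N : ℝ} (hN : 0 < N) : ContDiff ℝ ∞ (truncAbs N) := by
  have h1 : ContDiff ℝ ∞ fun y : ℝ => √(1 + y ^ 2) :=
    ContDiff.sqrt (by fun_prop) fun y => by positivity
  exact (contDiff_const.mul h1).div (contDiff_const.add h1) fun y => by positivity

lemma hasDerivAt_truncAbs {N : ℝ} (hN : 0 < N) (y : ℝ) :
    HasDerivAt (truncAbs N) (truncAbsDeriv N y) y := by
  have h1 : HasDerivAt (fun y : ℝ => 1 + y ^ 2) (2 * y) y := by
    simpa using (hasDerivAt_pow 2 y).const_add 1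
  have h2 := h1.sqrt (by positivity)
  have hs : 0 < √(1 + y ^ 2) := by positivity
  refine ((h2.const_mul N).div (h2.const_add N) (by positivity)).congr_deriv ?_
  rw [truncAbsDeriv]
  field_simp
  ring

lemma abs_truncAbsDeriv_le {N : ℝ} (hN : 0 < N) (y : ℝ) : |truncAbsDeriv N y| ≤ 1 := by
  have hs : 0 < √(1 + y ^ 2) := by positivity
  rw [truncAbsDeriv, abs_mul]
  refine mul_le_one₀ ?_ (abs_nonneg _) ?_
  · rw [abs_of_nonneg (by positivity), div_le_one (by positivity)]
    gcongr
    linarith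
  · rw [abs_div, abs_of_pos hs]
    exact div_le_one_of_le₀ (abs_le_sqrt_one_add_sq y) hs.le

lemma truncAbs_nonneg {N : ℝ} (hN : 0 < N) (y : ℝ) : 0 ≤ truncAbs N y := by
  unfold truncAbs
  positivity

lemma truncAbs_le_left {N : ℝ} (hN : 0 < N) (y : ℝ) : truncAbs N y ≤ N := by
  have hs : 0 < √(1 + y ^ 2) := by positivity
  rw [truncAbs, div_le_iff₀ (by positivity)]
  nlinarith

lemma truncAbs_le_right {N : ℝ} (hN : 0 < N) (y : ℝ) : truncAbs N y ≤ 1 + |y| := by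
  have hs : 0 < √(1 + y ^ 2) := by positivity
  refine le_trans ?_ (sqrt_one_add_sq_le y)
  rw [truncAbs, div_le_iff₀ (by positivity)]
  nlinarith

lemma tendsto_truncAbs (y : ℝ) :
    Filter.Tendsto (fun n : ℕ => truncAbs ((n : ℝ) + 1) y) Filter.atTop
      (nhds √(1 + y ^ 2)) := by
  have hs : 0 < √(1 + y ^ 2) := by positivity
  set c := √(1 + y ^ 2) with hc
  have h1 : Filter.Tendsto (fun n : ℕ => ((n : ℝ) + 1)) Filter.atTop Filter.atTop :=
    Filter.tendsto_atTop_add_const_right _ _ tendsto_natCast_atTop_atTop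
  have h2 : Filter.Tendsto (fun n : ℕ => c / ((n : ℝ) + 1)) Filter.atTop (nhds 0) :=
    Filter.Tendsto.const_div_atTop h1 c
  have h3 : Filter.Tendsto (fun n : ℕ => c / (1 + c / ((n : ℝ) + 1))) Filter.atTop
      (nhds (c / (1 + 0))) :=
    Filter.Tendsto.div tendsto_const_nhds (h2.const_add 1) (by norm_num)
  rw [add_zero, div_one] at h3
  refine h3.congr fun n => ?_
  rw [truncAbs, ← hc]
  have : (0 : ℝ) < (n : ℝ) + 1 := by positivity
  field_simp

/-- If `k_t + a k_x` is bounded, then integrability of `k` against an exponential weight propagates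
from the initial time to the strip, although `k` itself may be unbounded. The truncated moduli
`truncAbs N ∘ k` satisfy estimates that do not depend on `N`. -/
lemma HasMaterialDeriv.integrable_weight_of_bounded {T δ : ℝ} (hT : 0 < T) (hδ : 0 < δ)
    {a k b : ℝ → ℝ → ℝ} (hk : HasMaterialDeriv T a k b) (ha : SmoothOnStrip T a)
    (hab : BoundedOnStrip T a) (hax : BoundedOnStrip T fun t => deriv (a t))
    (hb : BoundedOnStrip T b) (h0 : Integrable fun x => k 0 x * weight δ x) :
    ∃ S, ∀ t ∈ Icc (-T) T, Integrable (fun x => k t x * weight δ x) ∧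
      ∫ x, |k t x| * weight δ x ≤ S := by
  obtain ⟨A₀, hA₀1, hA₀⟩ := hab.exists_one_le
  obtain ⟨A₁, hA₁1, hA₁⟩ := hax.exists_one_le
  obtain ⟨M, hM1, hM⟩ := hb.exists_one_le
  have hωi := integrable_weight hδ
  set I := ∫ x, weight δ x with hI
  have hI0 : 0 ≤ I := integral_nonneg fun x => (weight_pos δ x).le
  set C := δ * A₀ + M + A₁ with hC
  have hC0 : 0 ≤ C := by positivity
  obtain ⟨n, hn⟩ := exists_nat_ge (2 * C * T + 1)
  have hn0 : 0 < n := by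
    have : (0 : ℝ) < n := lt_of_lt_of_le (by positivity) hn
    exact_mod_cast this
  have h0mem : (0 : ℝ) ∈ Icc (-T) T := ⟨by linarith, hT.le⟩
  set J := ∫ x, (1 + |k 0 x|) * weight δ x with hJ
  have hJi : Integrable fun x => (1 + |k 0 x|) * weight δ x := by
    simp only [add_mul, one_mul]
    exact hωi.add (integrable_abs_mul_weight h0)
  have hFi : ∀ N : ℝ, 0 < N → ∀ t ∈ Icc (-T) T,
      Integrable fun x => truncAbs N (k t x) * weight δ x := fun N hN t ht =>
    integrable_mul_weight_of_bounded hδ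
      ((contDiff_truncAbs hN).continuous.comp (hk.smooth.continuous ht)) (M := N) fun x => by
        rw [abs_of_nonneg (truncAbs_nonneg hN _)]
        exact truncAbs_le_left hN _
  -- the truncated moduli
  have key : ∀ N : ℝ, 0 < N → ∀ t ∈ Icc (-T) T,
      (∫ x, truncAbs N (k t x) * weight δ x) + I ≤ 2 ^ n * (J + I) := by
    intro N hN
    have hF := hk.comp (contDiff_truncAbs hN) (hasDerivAt_truncAbs hN)
    have hstep := le_two_pow_mul_of_le_add (C := C) (n := n) (T := T)
      (N := fun t => (∫ x, truncAbs N (k t x) * weight δ x) + I) (S₀ := N * I + I) hC0 hn0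
      (by linarith) ?_ ?_ ?_
    · intro t ht
      refine (hstep t ht).trans ?_
      have : ∫ x, truncAbs N (k 0 x) * weight δ x ≤ J :=
        integral_mul_weight_mono (hFi N hN 0 h0mem) hJi fun x => truncAbs_le_right hN _
      gcongr
    · intro t ht
      have : ∫ x, truncAbs N (k t x) * weight δ x ≤ N * I := by
        rw [hI, ← integral_const_mul]
        exact integral_mul_weight_mono (hFi N hN t ht) (hωi.const_mul N)
          fun x => truncAbs_le_left hN _
      linarith
    · intro t ht
      have : 0 ≤ ∫ x, truncAbs N (k t x) * weight δ x := integral_nonneg fun x =>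
        mul_nonneg (truncAbs_nonneg hN _) (weight_pos δ x).le
      linarith
    · intro s hs t ht S hS
      have hsub : uIcc s t ⊆ Icc (-T) T := ordConnected_Icc.uIcc_subset hs ht
      have hF0 : ∀ τ, 0 ≤ ∫ x, truncAbs N (k τ x) * weight δ x := fun τ =>
        integral_nonneg fun x => mul_nonneg (truncAbs_nonneg hN _) (weight_pos δ x).le
      have hle := hF.abs_integral_weight_sub_le (S := S) (B := M * S + A₁ * S) hT hδ.le ha hA₀
        (hFi N hN) hs ht ?_ ?_
      · have := (abs_le.1 hle).2
        have e : δ * (A₀ * S) + (M * S + A₁ * S) = C * S := by rw [hC]; ring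
        rw [e] at this
        linarith
      · intro τ hτ
        simp only [abs_of_nonneg (truncAbs_nonneg hN _)]
        linarith [hS τ hτ]
      · intro τ hτ
        have hτ' := hsub hτ
        have hri : Integrable fun x => (M + A₁ * truncAbs N (k τ x)) * weight δ x := by
          simp only [add_mul, mul_assoc]
          exact (hωi.const_mul M).add ((hFi N hN τ hτ').const_mul A₁)
        have hbound : ∀ x, |truncAbsDeriv N (k τ x) * b τ x
            + deriv (a τ) x * truncAbs N (k τ x)| ≤ M + A₁ * truncAbs N (k τ x) := by
          intro x
          refine (abs_add_le _ _).trans (add_le_add ?_ ?_)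
          · rw [abs_mul]
            have h1 := abs_truncAbsDeriv_le hN (k τ x)
            calc _ ≤ 1 * M := mul_le_mul h1 (hM τ hτ' x) (abs_nonneg _) zero_le_one
              _ = M := one_mul M
          · rw [abs_mul, abs_of_nonneg (truncAbs_nonneg hN _)]
            exact mul_le_mul_of_nonneg_right (hA₁ τ hτ' x) (truncAbs_nonneg hN _)
        have hGi := integrable_mul_weight_of_le (p := fun x => truncAbsDeriv N (k τ x) * b τ x
            + deriv (a τ) x * truncAbs N (k τ x))
          (((hF.smooth_right hT ha).add ((ha.dx hT).mul hF.smooth)).continuous hτ') hri hbound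
        refine ⟨hGi, (integral_mul_weight_mono (integrable_abs_mul_weight hGi) hri
          hbound).trans ?_⟩
        have e : ∫ x, (M + A₁ * truncAbs N (k τ x)) * weight δ x
            = M * I + A₁ * ∫ x, truncAbs N (k τ x) * weight δ x := by
          rw [hI, ← integral_const_mul, ← integral_const_mul,
            ← integral_add (hωi.const_mul M) ((hFi N hN τ hτ').const_mul A₁)]
          simp only [add_mul, mul_assoc]
        rw [e]
        have h1 := hS τ hτ
        have h2 := hF0 τ
        gcongr <;> linarith
  refine ⟨2 ^ n * (J + I), fun t ht => ?_⟩
  -- remove the truncation by Fatou's lemma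
  have hkc := hk.smooth.continuous ht
  have hfat : ∫⁻ x, ENNReal.ofReal (|k t x| * weight δ x)
      ≤ ENNReal.ofReal (2 ^ n * (J + I)) := by
    calc ∫⁻ x, ENNReal.ofReal (|k t x| * weight δ x)
        ≤ ∫⁻ x, Filter.liminf (fun m : ℕ =>
            ENNReal.ofReal (truncAbs ((m : ℝ) + 1) (k t x) * weight δ x)) Filter.atTop := by
          refine lintegral_mono fun x => ?_
          have hl := ENNReal.tendsto_ofReal ((tendsto_truncAbs (k t x)).mul_const (weight δ x))
          rw [hl.liminf_eq]
          refine ENNReal.ofReal_le_ofReal ?_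
          exact mul_le_mul_of_nonneg_right (abs_le_sqrt_one_add_sq _) (weight_pos δ x).le
      _ ≤ Filter.liminf (fun m : ℕ => ∫⁻ x,
            ENNReal.ofReal (truncAbs ((m : ℝ) + 1) (k t x) * weight δ x)) Filter.atTop := by
          refine lintegral_liminf_le fun m => ?_
          have hc : Continuous (truncAbs ((m : ℝ) + 1)) :=
            (contDiff_truncAbs (by positivity)).continuous
          fun_prop
      _ ≤ ENNReal.ofReal (2 ^ n * (J + I)) := by
          refine Filter.liminf_le_of_le (by isBoundedDefault) fun c hc => ?_
          obtain ⟨m, hm⟩ := hc.exists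
          refine hm.trans ?_
          have hm0 : (0 : ℝ) < (m : ℝ) + 1 := by positivity
          rw [← ofReal_integral_eq_lintegral_ofReal (hFi _ hm0 t ht)
            (Filter.Eventually.of_forall fun x =>
              mul_nonneg (truncAbs_nonneg hm0 _) (weight_pos δ x).le)]
          exact ENNReal.ofReal_le_ofReal (by linarith [key _ hm0 t ht])
  have hnn : ∀ x, 0 ≤ |k t x| * weight δ x := fun x =>
    mul_nonneg (abs_nonneg _) (weight_pos δ x).le
  have hint : Integrable fun x => |k t x| * weight δ x := by
    refine ⟨by fun_prop, ?_⟩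
    rw [hasFiniteIntegral_iff_ofReal (Filter.Eventually.of_forall hnn)]
    exact hfat.trans_lt ENNReal.ofReal_lt_top
  refine ⟨integrable_mul_weight_of_le hkc hint fun x => le_rfl, ?_⟩
  rw [← ofReal_integral_eq_lintegral_ofReal hint (Filter.Eventually.of_forall hnn)] at hfat
  refine (ENNReal.ofReal_le_ofReal_iff ?_).1 hfat
  have : 0 ≤ J := integral_nonneg fun x =>
    mul_nonneg (add_nonneg zero_le_one (abs_nonneg _)) (weight_pos δ x).le
  positivity

/-! ### Tangent vectors in shifted variables -/

/-- The variation `r + uₓ h` of `u` along the horizontally shifted position. -/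
def shiftedVar (u r h : ℝ → ℝ) (x : ℝ) : ℝ := r x + deriv u x * h x

/-- The variation `r_x + u_xx h` of `uₓ` along the horizontally shifted position. -/
def shiftedDeriv (u r h : ℝ → ℝ) (x : ℝ) : ℝ := deriv r x + deriv (deriv u) x * h x

/-- The variation of the density `source1` in shifted variables, the deformation `h_x` of the
line element included. -/
def shiftedSource1 (u v r s h : ℝ → ℝ) (x : ℝ) : ℝ :=
  2 * u x * v x * shiftedVar u r h x + u x ^ 2 * shiftedVar v s h x
    + shiftedVar u r h x * deriv u x * deriv v x + u x * shiftedDeriv u r h x * deriv v x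
    + u x * deriv u x * shiftedDeriv v s h x + (1 / 2) * shiftedVar v s h x * deriv u x ^ 2
    + v x * deriv u x * shiftedDeriv u r h x + deriv h x * source1 u v x

/-- The variation of the density `source2` in shifted variables, the deformation `h_x` of the
line element included. -/
def shiftedSource2 (u v r s h : ℝ → ℝ) (x : ℝ) : ℝ :=
  2 * deriv u x * deriv v x * shiftedDeriv u r h x + deriv u x ^ 2 * shiftedDeriv v s h x
    + deriv h x * source2 u v x

/-- The variation of `nonlocalU` in shifted variables. The terms in `h * source1`, `h * source2`
come from the shift of the argument of the kernel under the integral sign. -/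
def shiftedNonlocalU (u v r s h : ℝ → ℝ) (x : ℝ) : ℝ :=
  h x * nonlocalV u v x + dxInvHelmholtz (shiftedSource1 u v r s h) x
    - invHelmholtz (fun y => h y * source1 u v y) x
    + (1 / 2) * invHelmholtz (shiftedSource2 u v r s h) x
    - (1 / 2) * dxInvHelmholtz (fun y => h y * source2 u v y) x

/-- The variation of `nonlocalV` in shifted variables. -/
def shiftedNonlocalV (u v r s h : ℝ → ℝ) (x : ℝ) : ℝ :=
  h x * nonlocalU u v x + invHelmholtz (shiftedSource1 u v r s h) x
    - dxInvHelmholtz (fun y => h y * source1 u v y) x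
    + (1 / 2) * dxInvHelmholtz (shiftedSource2 u v r s h) x
    - (1 / 2) * invHelmholtz (fun y => h y * source2 u v y) x

lemma HasMaterialDeriv.congr_left {T : ℝ} {a w g z : ℝ → ℝ → ℝ} (h : HasMaterialDeriv T a w g)
    (hz : ∀ t ∈ Icc (-T) T, ∀ x, z t x = w t x) : HasMaterialDeriv T a z g where
  smooth := h.smooth.congr hz
  hasDerivWithinAt t ht x := by
    refine ((h.hasDerivWithinAt t ht x).congr (fun τ hτ => hz τ hτ x) (hz t ht x)).congr_deriv ?_
    rw [show z t = w t from funext (hz t ht)]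

/-- A smooth solution with a tangent vector `(r, s)` and a horizontal shift `h` for which `h_x` is
initially integrable against the weight `weight α`. -/
structure ShiftedTangent (T α : ℝ) (u₀ v₀ : ℝ → ℝ) (u v r s h : ℝ → ℝ → ℝ) : Prop where
  T_pos : 0 < T
  α_pos : 0 < α
  α_lt_one : α < 1
  sol : IsSmoothSolution T u₀ v₀ u v
  tangent : IsTangentVector T u v r s
  mem_shifts : h ∈ shifts T u v r s
  integrable_zero : Integrable fun x => deriv (h 0) x * weight α x

namespace ShiftedTangent

variable {T α : ℝ} {u₀ v₀ : ℝ → ℝ} {u v r s h : ℝ → ℝ → ℝ}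

lemma symm (H : ShiftedTangent T α u₀ v₀ u v r s h) :
    ShiftedTangent T α v₀ u₀ v u s r h where
  T_pos := H.T_pos
  α_pos := H.α_pos
  α_lt_one := H.α_lt_one
  sol := H.sol.symm
  tangent := H.tangent.symm
  mem_shifts := ⟨H.mem_shifts.1, H.mem_shifts.2.1, fun t ht x =>
    (H.mem_shifts.2.2 t ht x).congr_deriv (by ring)⟩
  integrable_zero := H.integrable_zero

lemma smooth_shiftedVar (H : ShiftedTangent T α u₀ v₀ u v r s h) :
    SmoothOnStrip T fun t => shiftedVar (u t) (r t) (h t) :=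
  H.tangent.smooth_r.add ((H.sol.smooth_u.dx H.T_pos).mul H.mem_shifts.1)

lemma smooth_shiftedDeriv (H : ShiftedTangent T α u₀ v₀ u v r s h) :
    SmoothOnStrip T fun t => shiftedDeriv (u t) (r t) (h t) :=
  (H.tangent.smooth_r.dx H.T_pos).add
    (((H.sol.smooth_u.dx H.T_pos).dx H.T_pos).mul H.mem_shifts.1)

lemma bdd_shiftedVar (H : ShiftedTangent T α u₀ v₀ u v r s h) :
    BoundedOnStrip T fun t => shiftedVar (u t) (r t) (h t) :=
  (H.tangent.bdd H.T_pos H.sol).1.add (H.sol.bdd_ux.mul H.mem_shifts.2.1)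

lemma bdd_shiftedDeriv (H : ShiftedTangent T α u₀ v₀ u v r s h) :
    BoundedOnStrip T fun t => shiftedDeriv (u t) (r t) (h t) :=
  (H.tangent.bdd H.T_pos H.sol).2.add (H.sol.bdd_uxx.mul H.mem_shifts.2.1)

/-- Transport of the shift: `h` moves with the variation of the velocity `u v`. -/
lemma materialDeriv_shift (H : ShiftedTangent T α u₀ v₀ u v r s h) :
    HasMaterialDeriv T (velocity u v) h fun t x =>
      v t x * shiftedVar (u t) (r t) (h t) x + u t x * shiftedVar (v t) (s t) (h t) x where
  smooth := H.mem_shifts.1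
  hasDerivWithinAt t ht x := (H.mem_shifts.2.2 t ht x).congr_deriv (by
    rw [velocity, shiftedVar, shiftedVar]
    ring)

lemma hasDerivAt_shiftedVar (H : ShiftedTangent T α u₀ v₀ u v r s h) {t : ℝ}
    (ht : t ∈ Icc (-T) T) (x : ℝ) :
    HasDerivAt (shiftedVar (u t) (r t) (h t))
      (shiftedDeriv (u t) (r t) (h t) x + deriv (u t) x * deriv (h t) x) x := by
  refine ((H.tangent.smooth_r.hasDerivAt ht x).fun_add
    (((H.sol.smooth_u.dx H.T_pos).hasDerivAt ht x).fun_mul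
      (H.mem_shifts.1.hasDerivAt ht x))).congr_deriv ?_
  rw [shiftedDeriv]
  ring

/-- The material derivative of `h_x` does not involve `h_x`, because `u v` is also the velocity of
the flow. -/
lemma materialDeriv_shift_dx (H : ShiftedTangent T α u₀ v₀ u v r s h) :
    HasMaterialDeriv T (velocity u v) (fun t => deriv (h t)) fun t x =>
      deriv (v t) x * shiftedVar (u t) (r t) (h t) x
        + v t x * shiftedDeriv (u t) (r t) (h t) x
        + deriv (u t) x * shiftedVar (v t) (s t) (h t) x
        + u t x * shiftedDeriv (v t) (s t) (h t) x := by
  refine (H.materialDeriv_shift.dx H.T_pos H.sol.smooth_velocity).congr fun t ht x => ?_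
  rw [H.sol.deriv_velocity ht,
    (((H.sol.smooth_v.hasDerivAt ht x).fun_mul (H.hasDerivAt_shiftedVar ht x)).fun_add
      ((H.sol.smooth_u.hasDerivAt ht x).fun_mul (H.symm.hasDerivAt_shiftedVar ht x))).deriv]
  ring

lemma bdd_velocity (H : ShiftedTangent T α u₀ v₀ u v r s h) :
    BoundedOnStrip T (velocity u v) := H.sol.bdd_u.mul H.sol.bdd_v

lemma bdd_velocity_dx (H : ShiftedTangent T α u₀ v₀ u v r s h) :
    BoundedOnStrip T fun t => deriv (velocity u v t) := by
  obtain ⟨M, hM⟩ := (H.sol.bdd_ux.mul H.sol.bdd_v).add (H.sol.bdd_u.mul H.sol.bdd_vx)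
  exact ⟨M, fun t ht x => (congrArg abs (H.sol.deriv_velocity ht x)).trans_le (hM t ht x)⟩

lemma integrable_shift_dx (H : ShiftedTangent T α u₀ v₀ u v r s h) :
    ∃ S, ∀ t ∈ Icc (-T) T, Integrable (fun x => deriv (h t) x * weight α x) ∧
      ∫ x, |deriv (h t) x| * weight α x ≤ S :=
  H.materialDeriv_shift_dx.integrable_weight_of_bounded H.T_pos H.α_pos H.sol.smooth_velocity
    H.bdd_velocity H.bdd_velocity_dx
    ((((H.sol.bdd_vx.mul H.bdd_shiftedVar).add (H.sol.bdd_v.mul H.bdd_shiftedDeriv)).add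
      (H.sol.bdd_ux.mul H.symm.bdd_shiftedVar)).add (H.sol.bdd_u.mul H.symm.bdd_shiftedDeriv))
    H.integrable_zero

lemma admissible_shift_dx (H : ShiftedTangent T α u₀ v₀ u v r s h) {t : ℝ}
    (ht : t ∈ Icc (-T) T) : Admissible (deriv (h t)) := by
  obtain ⟨S, hS⟩ := H.integrable_shift_dx
  exact Admissible.of_integrable_weight H.α_pos.le H.α_lt_one.le
    ((H.mem_shifts.1.dx H.T_pos).continuous ht) (hS t ht).1

lemma admissible_shift_mul_source1 (H : ShiftedTangent T α u₀ v₀ u v r s h) {t : ℝ}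
    (ht : t ∈ Icc (-T) T) : Admissible fun y => h t y * source1 (u t) (v t) y :=
  (H.mem_shifts.2.1.mul H.sol.bdd_source1).admissible
    (H.mem_shifts.1.mul (H.sol.smooth_source1 H.T_pos)) ht

lemma admissible_shift_mul_source2 (H : ShiftedTangent T α u₀ v₀ u v r s h) {t : ℝ}
    (ht : t ∈ Icc (-T) T) : Admissible fun y => h t y * source2 (u t) (v t) y :=
  (H.mem_shifts.2.1.mul H.sol.bdd_source2).admissible
    (H.mem_shifts.1.mul (H.sol.smooth_source2 H.T_pos)) ht

lemma admissible_shiftedSource1 (H : ShiftedTangent T α u₀ v₀ u v r s h) {t : ℝ}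
    (ht : t ∈ Icc (-T) T) : Admissible (shiftedSource1 (u t) (v t) (r t) (s t) (h t)) := by
  have hT := H.T_pos
  have su := H.sol.smooth_u
  have sv := H.sol.smooth_v
  have sux := su.dx hT
  have svx := sv.dx hT
  have sw := H.smooth_shiftedVar
  have sz := H.symm.smooth_shiftedVar
  have sw' := H.smooth_shiftedDeriv
  have sz' := H.symm.smooth_shiftedDeriv
  have bu := H.sol.bdd_u
  have bv := H.sol.bdd_v
  have bux := H.sol.bdd_ux
  have bvx := H.sol.bdd_vx
  have bw := H.bdd_shiftedVar
  have bz := H.symm.bdd_shiftedVar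
  have bw' := H.bdd_shiftedDeriv
  have bz' := H.symm.bdd_shiftedDeriv
  have c2 : SmoothOnStrip T fun _ _ => (2 : ℝ) := SmoothOnStrip.const 2
  have c1 : SmoothOnStrip T fun _ _ => (1 / 2 : ℝ) := SmoothOnStrip.const _
  have b2 : BoundedOnStrip T fun _ _ => (2 : ℝ) := BoundedOnStrip.const 2
  have b1 : BoundedOnStrip T fun _ _ => (1 / 2 : ℝ) := BoundedOnStrip.const _
  have A1 := ((((((((b2.mul bu).mul bv).mul bw).add ((bu.pow 2).mul bz)).add
    ((bw.mul bux).mul bvx)).add ((bu.mul bw').mul bvx)).add ((bu.mul bux).mul bz')).add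
    ((b1.mul bz).mul (bux.pow 2))).add ((bv.mul bux).mul bw') |>.admissible
    (((((((((c2.mul su).mul sv).mul sw).add ((su.pow 2).mul sz)).add
    ((sw.mul sux).mul svx)).add ((su.mul sw').mul svx)).add ((su.mul sux).mul sz')).add
    ((c1.mul sz).mul (sux.pow 2))).add ((sv.mul sux).mul sw')) ht
  obtain ⟨M, hM⟩ := H.sol.bdd_source1
  exact A1.add ((H.admissible_shift_dx ht).mul_bounded
    ((H.sol.smooth_source1 hT).continuous ht) (hM t ht))

lemma admissible_shiftedSource2 (H : ShiftedTangent T α u₀ v₀ u v r s h) {t : ℝ}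
    (ht : t ∈ Icc (-T) T) : Admissible (shiftedSource2 (u t) (v t) (r t) (s t) (h t)) := by
  have hT := H.T_pos
  have A1 := (((((BoundedOnStrip.const 2).mul H.sol.bdd_ux).mul H.sol.bdd_vx).mul
    H.bdd_shiftedDeriv).add ((H.sol.bdd_ux.pow 2).mul H.symm.bdd_shiftedDeriv)).admissible
    (((((SmoothOnStrip.const 2).mul (H.sol.smooth_u.dx hT)).mul (H.sol.smooth_v.dx hT)).mul
    H.smooth_shiftedDeriv).add
      (((H.sol.smooth_u.dx hT).pow 2).mul H.symm.smooth_shiftedDeriv)) ht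
  obtain ⟨M, hM⟩ := H.sol.bdd_source2
  exact A1.add ((H.admissible_shift_dx ht).mul_bounded
    ((H.sol.smooth_source2 hT).continuous ht) (hM t ht))

/-- The linearized density differs from the shifted one by an exact derivative. -/
lemma hasDerivAt_shift_mul_source1 (H : ShiftedTangent T α u₀ v₀ u v r s h) {t : ℝ}
    (ht : t ∈ Icc (-T) T) (y : ℝ) :
    HasDerivAt (fun y => h t y * source1 (u t) (v t) y)
      (shiftedSource1 (u t) (v t) (r t) (s t) (h t) y
        - linSource1 (u t) (v t) (r t) (s t) y) y := by
  have du := H.sol.smooth_u.hasDerivAt ht y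
  have dv := H.sol.smooth_v.hasDerivAt ht y
  have dux := (H.sol.smooth_u.dx H.T_pos).hasDerivAt ht y
  have dvx := (H.sol.smooth_v.dx H.T_pos).hasDerivAt ht y
  have dh := H.mem_shifts.1.hasDerivAt ht y
  have d1 := (((du.fun_pow 2).fun_mul dv).fun_add ((du.fun_mul dux).fun_mul dvx)).fun_add
    ((dv.const_mul (1 / 2)).fun_mul (dux.fun_pow 2))
  refine (dh.fun_mul d1).congr_deriv ?_
  rw [shiftedSource1, linSource1, source1]
  simp only [shiftedVar, shiftedDeriv]
  push_cast
  ring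

lemma hasDerivAt_shift_mul_source2 (H : ShiftedTangent T α u₀ v₀ u v r s h) {t : ℝ}
    (ht : t ∈ Icc (-T) T) (y : ℝ) :
    HasDerivAt (fun y => h t y * source2 (u t) (v t) y)
      (shiftedSource2 (u t) (v t) (r t) (s t) (h t) y
        - linSource2 (u t) (v t) (r t) (s t) y) y := by
  have dux := (H.sol.smooth_u.dx H.T_pos).hasDerivAt ht y
  have dvx := (H.sol.smooth_v.dx H.T_pos).hasDerivAt ht y
  have dh := H.mem_shifts.1.hasDerivAt ht y
  refine (dh.fun_mul ((dux.fun_pow 2).fun_mul dvx)).congr_deriv ?_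
  rw [shiftedSource2, linSource2, source2]
  simp only [shiftedDeriv]
  push_cast
  ring

lemma dxInvHelmholtz_linSource1 (H : ShiftedTangent T α u₀ v₀ u v r s h) {t : ℝ}
    (ht : t ∈ Icc (-T) T) (x : ℝ) :
    dxInvHelmholtz (linSource1 (u t) (v t) (r t) (s t)) x
      = dxInvHelmholtz (shiftedSource1 (u t) (v t) (r t) (s t) (h t)) x
        - invHelmholtz (fun y => h t y * source1 (u t) (v t) y) x
        + h t x * source1 (u t) (v t) x := by
  have A1 := H.admissible_shiftedSource1 ht
  have A2 := (H.tangent.bdd_linSource1 H.T_pos H.sol).admissible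
    (H.tangent.smooth_linSource1 H.T_pos H.sol) ht
  have e1 := (H.admissible_shift_mul_source1 ht).dxInvHelmholtz_deriv (A1.sub A2)
    (H.hasDerivAt_shift_mul_source1 ht) x
  rw [A1.dxInvHelmholtz_sub A2] at e1
  linarith

lemma invHelmholtz_linSource2 (H : ShiftedTangent T α u₀ v₀ u v r s h) {t : ℝ}
    (ht : t ∈ Icc (-T) T) (x : ℝ) :
    invHelmholtz (linSource2 (u t) (v t) (r t) (s t)) x
      = invHelmholtz (shiftedSource2 (u t) (v t) (r t) (s t) (h t)) x
        - dxInvHelmholtz (fun y => h t y * source2 (u t) (v t) y) x := by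
  have A1 := H.admissible_shiftedSource2 ht
  have A2 := (H.tangent.bdd_linSource2 H.T_pos H.sol).admissible
    (H.tangent.smooth_linSource2 H.T_pos H.sol) ht
  have e1 := (H.admissible_shift_mul_source2 ht).invHelmholtz_deriv (A1.sub A2)
    (H.hasDerivAt_shift_mul_source2 ht) x
  rw [A1.invHelmholtz_sub A2] at e1
  linarith

/-- In shifted variables the linearized equation for `u` contains no
derivative of the unknowns outside the nonlocal term. -/
lemma materialDeriv_shiftedVar (H : ShiftedTangent T α u₀ v₀ u v r s h) :
    HasMaterialDeriv T (velocity u v) (fun t => shiftedVar (u t) (r t) (h t)) fun t x =>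
      -shiftedNonlocalU (u t) (v t) (r t) (s t) (h t) x := by
  refine ((H.tangent.materialDeriv H.T_pos H.sol).add
    ((H.sol.materialDeriv_dx H.T_pos).mul H.materialDeriv_shift)).congr fun t ht x => ?_
  rw [H.dxInvHelmholtz_linSource1 ht, H.invHelmholtz_linSource2 ht, shiftedNonlocalU, source1,
    shiftedVar, shiftedVar]
  ring

lemma hasDerivAt_shiftedNonlocalU (H : ShiftedTangent T α u₀ v₀ u v r s h) {t : ℝ}
    (ht : t ∈ Icc (-T) T) (x : ℝ) :
    HasDerivAt (shiftedNonlocalU (u t) (v t) (r t) (s t) (h t))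
      (shiftedNonlocalV (u t) (v t) (r t) (s t) (h t) x
        + deriv (h t) x * nonlocalV (u t) (v t) x
        - shiftedSource1 (u t) (v t) (r t) (s t) (h t) x) x := by
  have d1 := (H.mem_shifts.1.hasDerivAt ht x).fun_mul (hasDerivAt_nonlocalV
    (H.sol.admissible_source1 H.T_pos ht) (H.sol.admissible_source2 H.T_pos ht) x)
  refine ((((d1.fun_add ((H.admissible_shiftedSource1 ht).hasDerivAt_dxInvHelmholtz x)).fun_sub
    ((H.admissible_shift_mul_source1 ht).hasDerivAt_invHelmholtz x)).fun_add
    (((H.admissible_shiftedSource2 ht).hasDerivAt_invHelmholtz x).const_mul (1 / 2))).fun_sub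
    (((H.admissible_shift_mul_source2 ht).hasDerivAt_dxInvHelmholtz x).const_mul
      (1 / 2))).congr_deriv ?_
  rw [shiftedNonlocalV]
  ring

/-- In shifted variables the linearized equation for `uₓ` contains no derivative of the unknowns
outside the nonlocal term. -/
lemma materialDeriv_shiftedDeriv (H : ShiftedTangent T α u₀ v₀ u v r s h) :
    HasMaterialDeriv T (velocity u v) (fun t => shiftedDeriv (u t) (r t) (h t)) fun t x =>
      2 * u t x * v t x * shiftedVar (u t) (r t) (h t) x
        + u t x ^ 2 * shiftedVar (v t) (s t) (h t) x
        - (1 / 2) * shiftedVar (v t) (s t) (h t) x * deriv (u t) x ^ 2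
        - v t x * deriv (u t) x * shiftedDeriv (u t) (r t) (h t) x
        - shiftedNonlocalV (u t) (v t) (r t) (s t) (h t) x := by
  refine (((H.materialDeriv_shiftedVar.dx H.T_pos H.sol.smooth_velocity).sub
    ((H.sol.materialDeriv_dx H.T_pos).mul H.materialDeriv_shift_dx)).congr_left
    fun t ht x => ?_).congr fun t ht x => ?_
  · rw [(H.hasDerivAt_shiftedVar ht x).deriv]
    ring
  · rw [(H.hasDerivAt_shiftedNonlocalU ht x).fun_neg.deriv, H.sol.deriv_velocity ht,
      (H.hasDerivAt_shiftedVar ht x).deriv, shiftedSource1, source1]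
    ring

end ShiftedTangent

/-! ### Pointwise estimates -/

lemma abs_mul_le_mul {x y M N : ℝ} (hx : |x| ≤ M) (hy : |y| ≤ N) : |x * y| ≤ M * N := by
  rw [abs_mul]
  exact mul_le_mul hx hy (abs_nonneg _) ((abs_nonneg _).trans hx)

lemma abs_le_one_add_sq (p : ℝ) : |p| ≤ 1 + p ^ 2 := by
  nlinarith [sq_nonneg (|p| - 1), sq_abs p]

lemma abs_sq_le_one_add_sq (p : ℝ) : |p ^ 2| ≤ 1 + p ^ 2 := by
  rw [abs_of_nonneg (sq_nonneg p)]
  linarith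

lemma abs_one_le_one_add_sq (p : ℝ) : |(1 : ℝ)| ≤ 1 + p ^ 2 := by
  rw [abs_one]
  nlinarith [sq_nonneg p]

lemma abs_one_sub_sq_le (p : ℝ) : |1 - p ^ 2| ≤ 1 + p ^ 2 :=
  abs_le.2 ⟨by nlinarith [sq_nonneg p], by nlinarith [sq_nonneg p]⟩

lemma abs_source1_le_mul {m a b p q : ℝ} (hm : 1 ≤ m) (ha : |a| ≤ m) (hb : |b| ≤ m) :
    |a ^ 2 * b + a * p * q + (1 / 2) * b * p ^ 2| ≤ 3 * m ^ 3 * ((1 + p ^ 2) * (1 + q ^ 2)) := by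
  have ha2 : |a ^ 2| ≤ m ^ 2 := by rw [abs_pow]; gcongr
  have t1 := abs_mul_le_mul (abs_mul_le_mul ha2 hb)
    (abs_mul_le_mul (abs_one_le_one_add_sq p) (abs_one_le_one_add_sq q))
  have t2 := abs_mul_le_mul ha (abs_mul_le_mul (abs_le_one_add_sq p) (abs_le_one_add_sq q))
  have t3 := abs_mul_le_mul hb
    (abs_mul_le_mul (abs_sq_le_one_add_sq p) (abs_one_le_one_add_sq q))
  set d := (1 + p ^ 2) * (1 + q ^ 2) with hd
  have hd0 : 0 ≤ d := by positivity
  have hmd : m * d ≤ m ^ 3 * d := by gcongr; exact le_self_pow₀ hm (by norm_num)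
  have hmd0 : 0 ≤ m * d := by positivity
  have k1 := abs_le.1 t1
  have k2 := abs_le.1 t2
  have k3 := abs_le.1 t3
  exact abs_le.2 ⟨by linarith, by linarith⟩

lemma abs_source2_le_mul (p q : ℝ) : |p ^ 2 * q| ≤ (1 + p ^ 2) * (1 + q ^ 2) :=
  abs_mul_le_mul (abs_sq_le_one_add_sq p) (abs_le_one_add_sq q)

/-- The bound for `shiftedSource1`, in real variables: `a, b, p, q` stand for `u, v, uₓ, vₓ`, the
letters `w, w'` and `z, z'` for the shifted variables of the two components, and `k` for `h_x`.
Eliminating `k` in favour of the sixth density cancels the terms of highest order in `p` and `q`. -/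
lemma abs_shiftedSource1_le_aux {m a b p q w z w' z' k : ℝ} (hm : 1 ≤ m) (ha : |a| ≤ m)
    (hb : |b| ≤ m) :
    |2 * a * b * w + a ^ 2 * z + w * p * q + a * w' * q + a * p * z' + (1 / 2) * z * p ^ 2
        + b * p * w' + k * (a ^ 2 * b + a * p * q + (1 / 2) * b * p ^ 2)|
      ≤ 4 * m ^ 3 * (|w * ((1 + p ^ 2) * (1 + q ^ 2))| + |z * ((1 + p ^ 2) * (1 + q ^ 2))|
        + |w' * (1 + q ^ 2)| + |z' * (1 + p ^ 2)|
        + |2 * p * (1 + q ^ 2) * w' + 2 * q * (1 + p ^ 2) * z'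
          + k * ((1 + p ^ 2) * (1 + q ^ 2))|) := by
  have ha2 : |a ^ 2| ≤ m ^ 2 := by rw [abs_pow]; gcongr
  have h11 := abs_mul_le_mul (abs_one_le_one_add_sq p) (abs_one_le_one_add_sq q)
  have hp1 := abs_mul_le_mul (abs_le_one_add_sq p) (abs_one_le_one_add_sq q)
  have h1q := abs_mul_le_mul (abs_one_le_one_add_sq p) (abs_le_one_add_sq q)
  have hpq := abs_mul_le_mul (abs_le_one_add_sq p) (abs_le_one_add_sq q)
  have h2p := abs_mul_le_mul (abs_sq_le_one_add_sq p) (abs_one_le_one_add_sq q)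
  have h2q := abs_mul_le_mul (abs_sq_le_one_add_sq p) (abs_le_one_add_sq q)
  have hsq := abs_mul_le_mul (abs_one_sub_sq_le p) (abs_le_one_add_sq q)
  have hsp := abs_mul_le_mul (abs_le_one_add_sq p) (abs_one_sub_sq_le q)
  have hc6 := abs_source1_le_mul (p := p) (q := q) hm ha hb
  set F6 := 2 * p * (1 + q ^ 2) * w' + 2 * q * (1 + p ^ 2) * z'
          + k * ((1 + p ^ 2) * (1 + q ^ 2)) with hF6
  set d := (1 + p ^ 2) * (1 + q ^ 2) with hd
  have hd0 : 0 < d := by positivity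
  have hmd : m * d ≤ m ^ 3 * d := by gcongr; exact le_self_pow₀ hm (by norm_num)
  have hmd2 : m ^ 2 * d ≤ m ^ 3 * d := 
    mul_le_mul_of_nonneg_right (pow_le_pow_right₀ hm (by norm_num)) hd0.le
  have hmd0 : d ≤ m ^ 3 * d := le_mul_of_one_le_left hd0.le (one_le_pow₀ hm)
  -- the coefficients of the five densities
  have c2 : |2 * (a * b) + p * q| ≤ 4 * m ^ 3 * d := by
    have k1 := abs_le.1 (abs_mul_le_mul (abs_mul_le_mul ha hb) h11)
    have k2 := abs_le.1 hpq
    exact abs_le.2 ⟨by linarith, by linarith⟩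
  have c3 : |a ^ 2 + (1 / 2) * p ^ 2| ≤ 4 * m ^ 3 * d := by
    have k1 := abs_le.1 (abs_mul_le_mul ha2 h11)
    have k2 := abs_le.1 h2p
    exact abs_le.2 ⟨by linarith, by linarith⟩
  have c4 : |a * (q * (1 - p ^ 2)) + b * p - 2 * (a ^ 2 * b * p)| ≤ 4 * m ^ 3 * d := by
    have k1 := abs_le.1 (abs_mul_le_mul ha hsq)
    have k2 := abs_le.1 (abs_mul_le_mul hb hp1)
    have k3 := abs_le.1 (abs_mul_le_mul (abs_mul_le_mul ha2 hb) hp1)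
    exact abs_le.2 ⟨by linarith, by linarith⟩
  have c5 : |a * (p * (1 - q ^ 2)) - 2 * (a ^ 2 * b * q) - b * (p ^ 2 * q)| ≤ 4 * m ^ 3 * d := by
    have k1 := abs_le.1 (abs_mul_le_mul ha hsp)
    have k2 := abs_le.1 (abs_mul_le_mul hb h2q)
    have k3 := abs_le.1 (abs_mul_le_mul (abs_mul_le_mul ha2 hb) h1q)
    exact abs_le.2 ⟨by linarith, by linarith⟩
  have c6 : |a ^ 2 * b + a * p * q + (1 / 2) * b * p ^ 2| ≤ 4 * m ^ 3 * d := by linarith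
  have k2 := abs_le.1 (abs_mul_le_mul (le_refl |w * d|) c2)
  have k3 := abs_le.1 (abs_mul_le_mul (le_refl |z * d|) c3)
  have k4 := abs_le.1 (abs_mul_le_mul (le_refl |w' * (1 + q ^ 2)|) c4)
  have k5 := abs_le.1 (abs_mul_le_mul (le_refl |z' * (1 + p ^ 2)|) c5)
  have k6 := abs_le.1 (abs_mul_le_mul (le_refl |F6|) c6)
  refine le_of_mul_le_mul_left ?_ hd0
  rw [← abs_of_pos hd0, ← abs_mul, abs_of_pos hd0]
  have e : d * (2 * a * b * w + a ^ 2 * z + w * p * q + a * w' * q + a * p * z'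
        + (1 / 2) * z * p ^ 2
        + b * p * w' + k * (a ^ 2 * b + a * p * q + (1 / 2) * b * p ^ 2))
      = w * d * (2 * (a * b) + p * q) + z * d * (a ^ 2 + (1 / 2) * p ^ 2)
        + w' * (1 + q ^ 2) * (a * (q * (1 - p ^ 2)) + b * p - 2 * (a ^ 2 * b * p))
        + z' * (1 + p ^ 2) * (a * (p * (1 - q ^ 2)) - 2 * (a ^ 2 * b * q) - b * (p ^ 2 * q))
        + F6 * (a ^ 2 * b + a * p * q + (1 / 2) * b * p ^ 2) := by
    rw [hF6, hd]
    ring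
  rw [e]
  generalize |w * d| = y2 at *
  generalize |z * d| = y3 at *
  generalize |w' * (1 + q ^ 2)| = y4 at *
  generalize |z' * (1 + p ^ 2)| = y5 at *
  generalize |F6| = y6 at *
  clear e hF6
  exact abs_le.2 ⟨by linarith only [k2.1, k3.1, k4.1, k5.1, k6.1],
    by linarith only [k2.2, k3.2, k4.2, k5.2, k6.2]⟩

/-- The bound for `shiftedSource2`, in the notation of `abs_shiftedSource1_le_aux`. -/
lemma abs_shiftedSource2_le_aux {p q w' z' k : ℝ} :
    |2 * p * q * w' + p ^ 2 * z' + k * (p ^ 2 * q)|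
      ≤ 2 * (|w' * (1 + q ^ 2)| + |z' * (1 + p ^ 2)|
        + |2 * p * (1 + q ^ 2) * w' + 2 * q * (1 + p ^ 2) * z'
          + k * ((1 + p ^ 2) * (1 + q ^ 2))|) := by
  have c4 := abs_mul_le_mul (abs_le_one_add_sq p) (abs_le_one_add_sq q)
  have c5 := abs_mul_le_mul (abs_sq_le_one_add_sq p) (abs_one_sub_sq_le q)
  have c6 := abs_source2_le_mul p q
  set F6 := 2 * p * (1 + q ^ 2) * w' + 2 * q * (1 + p ^ 2) * z'
          + k * ((1 + p ^ 2) * (1 + q ^ 2)) with hF6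
  set d := (1 + p ^ 2) * (1 + q ^ 2) with hd
  have hd0 : 0 < d := by positivity
  have k4 := abs_le.1 (abs_mul_le_mul (le_refl |w' * (1 + q ^ 2)|) c4)
  have k5 := abs_le.1 (abs_mul_le_mul (le_refl |z' * (1 + p ^ 2)|) c5)
  have k6 := abs_le.1 (abs_mul_le_mul (le_refl |F6|) c6)
  have n5 : 0 ≤ |z' * (1 + p ^ 2)| * d := by positivity
  have n6 : 0 ≤ |F6| * d := by positivity
  refine le_of_mul_le_mul_left ?_ hd0
  rw [← abs_of_pos hd0, ← abs_mul, abs_of_pos hd0]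
  have e : d * (2 * p * q * w' + p ^ 2 * z' + k * (p ^ 2 * q))
      = 2 * (w' * (1 + q ^ 2) * (p * q)) + z' * (1 + p ^ 2) * (p ^ 2 * (1 - q ^ 2))
        + F6 * (p ^ 2 * q) := by
    rw [hF6, hd]
    ring
  rw [e]
  generalize |w' * (1 + q ^ 2)| = y4 at *
  generalize |z' * (1 + p ^ 2)| = y5 at *
  generalize |F6| = y6 at *
  clear e hF6
  exact abs_le.2 ⟨by linarith only [k4.1, k5.1, k6.1, n5, n6],
    by linarith only [k4.2, k5.2, k6.2, n5, n6]⟩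

lemma abs_add_two_mul_le {m a b V : ℝ} (hm : 1 ≤ m) (ha : |a| ≤ m) (hb : |b| ≤ m)
    (hV : |V| ≤ m) : |b + 2 * (a ^ 2 * b - V)| ≤ 5 * m ^ 3 := by
  have ha2 : |a ^ 2| ≤ m ^ 2 := by rw [abs_pow]; gcongr
  have k1 := abs_le.1 (abs_mul_le_mul ha2 hb)
  have k2 := abs_le.1 hb
  have k3 := abs_le.1 hV
  have hmd : m ≤ m ^ 3 := le_self_pow₀ hm (by norm_num)
  exact abs_le.2 ⟨by linarith, by linarith⟩

/-- The bound for `balanceD`; the numbers `c` and `e` stand for the factors `compression` of the two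
components. -/
lemma abs_balanceD_le_aux {M p q c e : ℝ} (hc : |c| ≤ M) (he : |e| ≤ M) :
    |p * c * (1 + q ^ 2) + q * e * (1 + p ^ 2)|
      ≤ 2 * M * ((1 + p ^ 2) * (1 + q ^ 2)) := by
  have h1 : |1 + q ^ 2| ≤ 1 + q ^ 2 := (abs_of_pos (by positivity)).le
  have h2 : |1 + p ^ 2| ≤ 1 + p ^ 2 := (abs_of_pos (by positivity)).le
  have k1 := abs_le.1 (abs_mul_le_mul (abs_mul_le_mul (abs_le_one_add_sq p) hc) h1)
  have k2 := abs_le.1 (abs_mul_le_mul (abs_mul_le_mul (abs_le_one_add_sq q) he) h2)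
  exact abs_le.2 ⟨by linarith, by linarith⟩

lemma abs_balance_shift_le_aux {m a b p q w z h c e : ℝ} (hm : 1 ≤ m) (ha : |a| ≤ m) (hb : |b| ≤ m)
    (hc : |c| ≤ 5 * m ^ 3) (he : |e| ≤ 5 * m ^ 3) :
    |(b * w + a * z) * ((1 + p ^ 2) * (1 + q ^ 2))
        + h * (p * c * (1 + q ^ 2) + q * e * (1 + p ^ 2))|
      ≤ 10 * m ^ 3 * (|h * ((1 + p ^ 2) * (1 + q ^ 2))| + |w * ((1 + p ^ 2) * (1 + q ^ 2))|
        + |z * ((1 + p ^ 2) * (1 + q ^ 2))|) := by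
  have k3 := abs_mul_le_mul (le_refl |h|) (abs_balanceD_le_aux (p := p) (q := q) hc he)
  set d := (1 + p ^ 2) * (1 + q ^ 2) with hd
  have hd0 : 0 < d := by positivity
  have hmd : m ≤ 10 * m ^ 3 := by
    have := le_self_pow₀ hm (n := 3) (by norm_num)
    linarith
  have k1 := abs_le.1 ((abs_mul_le_mul (hb.trans hmd) (le_refl |w * d|)))
  have k2 := abs_le.1 ((abs_mul_le_mul (ha.trans hmd) (le_refl |z * d|)))
  have e1 : |h * d| = |h| * d := by rw [abs_mul, abs_of_pos hd0]
  rw [e1]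
  have k3 := abs_le.1 k3
  generalize |h| = y1 at *
  generalize |w * d| = y2 at *
  generalize |z * d| = y3 at *
  exact abs_le.2 ⟨by linarith only [k1.1, k2.1, k3.1], by linarith only [k1.2, k2.2, k3.2]⟩

lemma abs_balanceVar_le_aux {m p q w X c e : ℝ} (hc : |c| ≤ 5 * m ^ 3) (he : |e| ≤ 5 * m ^ 3) :
    |-X * ((1 + p ^ 2) * (1 + q ^ 2)) + w * (p * c * (1 + q ^ 2) + q * e * (1 + p ^ 2))|
      ≤ 10 * m ^ 3 * |w * ((1 + p ^ 2) * (1 + q ^ 2))|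
        + (1 + p ^ 2) * (1 + q ^ 2) * |X| := by
  have k3 := abs_mul_le_mul (le_refl |w|) (abs_balanceD_le_aux (p := p) (q := q) hc he)
  set d := (1 + p ^ 2) * (1 + q ^ 2) with hd
  have hd0 : 0 < d := by positivity
  have e1 : |w * d| = |w| * d := by rw [abs_mul, abs_of_pos hd0]
  have e2 : |-X * d| = d * |X| := by rw [abs_mul, abs_neg, abs_of_pos hd0, mul_comm]
  rw [e1]
  refine (abs_add_le _ _).trans ?_
  rw [e2]
  linarith

lemma abs_variation_le {m a b w z Y : ℝ} (ha : |a| ≤ m) (hb : |b| ≤ m) :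
    |2 * a * b * w + a ^ 2 * z - Y| ≤ 2 * m ^ 2 * |w| + m ^ 2 * |z| + |Y| := by
  have ha2 : |a ^ 2| ≤ m ^ 2 := by rw [abs_pow]; gcongr
  have k1 := abs_le.1 (abs_mul_le_mul (abs_mul_le_mul ha hb) (le_refl |w|))
  have k2 := abs_le.1 (abs_mul_le_mul ha2 (le_refl |z|))
  have k3 := abs_le.1 (le_refl |Y|)
  exact abs_le.2 ⟨by linarith, by linarith⟩

lemma abs_balanceDeriv_le_aux {m a b p q w z w' Y e : ℝ} (hm : 1 ≤ m) (ha : |a| ≤ m) (hb : |b| ≤ m)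
    (he : |e| ≤ 5 * m ^ 3) :
    |(1 + q ^ 2) * (2 * a * b * w + a ^ 2 * z - (1 / 2) * z * p ^ 2 - Y) + w' * q * e|
      ≤ 5 * m ^ 3 * (|w * ((1 + p ^ 2) * (1 + q ^ 2))| + |z * ((1 + p ^ 2) * (1 + q ^ 2))|
        + |w' * (1 + q ^ 2)|) + (1 + p ^ 2) * (1 + q ^ 2) * |Y| := by
  have h1 : |1 + q ^ 2| ≤ 1 + q ^ 2 := (abs_of_pos (by positivity)).le
  have k1 := abs_mul_le_mul h1 (abs_variation_le (w := w) (z := z) (Y := Y) ha hb)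
  have k2 := abs_mul_le_mul (abs_mul_le_mul (le_refl |z|) (abs_sq_le_one_add_sq p)) h1
  have k3 := abs_mul_le_mul (abs_mul_le_mul (le_refl |w'|) (abs_le_one_add_sq q)) he
  have e0 : ∀ y : ℝ, |y * ((1 + p ^ 2) * (1 + q ^ 2))| = |y| * ((1 + p ^ 2) * (1 + q ^ 2)) :=
    fun y => by
      rw [abs_mul, abs_of_pos (show 0 < (1 + p ^ 2) * (1 + q ^ 2) by positivity)]
  have e1 : |w' * (1 + q ^ 2)| = |w'| * (1 + q ^ 2) := by
    rw [abs_mul, abs_of_pos (show 0 < 1 + q ^ 2 by positivity)]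
  rw [e0, e0, e1]
  have hm2 : m ^ 2 ≤ m ^ 3 := pow_le_pow_right₀ hm (by norm_num)
  have hm3 : 1 ≤ m ^ 3 := one_le_pow₀ hm
  have hβ : 1 + q ^ 2 ≤ (1 + p ^ 2) * (1 + q ^ 2) := by nlinarith [sq_nonneg p, sq_nonneg q]
  set d := (1 + p ^ 2) * (1 + q ^ 2) with hd
  have hd0 : 0 < d := by positivity
  have j1 : (1 + q ^ 2) * (2 * m ^ 2 * |w| + m ^ 2 * |z| + |Y|)
      ≤ d * (2 * m ^ 3 * |w| + m ^ 3 * |z| + |Y|) := by gcongr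
  have j2 : |z| * d ≤ m ^ 3 * (|z| * d) := le_mul_of_one_le_left (by positivity) hm3
  have j3 : |z| * (1 + p ^ 2) * (1 + q ^ 2) = |z| * d := by rw [hd]; ring
  have j4 : 0 ≤ m ^ 3 * (|w| * d) := by positivity
  have j5 : 0 ≤ m ^ 3 * (|z| * d) := by positivity
  have k1 := abs_le.1 k1
  have k2 := abs_le.1 k2
  have k3 := abs_le.1 k3
  exact abs_le.2 ⟨by linarith, by linarith⟩

/-- The bound for the balance law of the sixth density, in which `Y, Y'` stand for the variations
`shiftedNonlocalV` of the two components. As in `abs_shiftedSource1_le_aux`, expressing `k = h_x` by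
the sixth density cancels the terms of highest order. -/
lemma abs_balance_dx_le_aux {m a b p q w z w' z' k Y Y' c e : ℝ} (hm : 1 ≤ m) (ha : |a| ≤ m)
    (hb : |b| ≤ m) (hc : |c| ≤ 5 * m ^ 3) (he : |e| ≤ 5 * m ^ 3) :
    |2 * q * z' * p * c + (1 + q ^ 2) * w' * c
        + (1 + q ^ 2) * p * (z + 2 * (2 * a * b * w + a ^ 2 * z - Y))
        + 2 * p * w' * q * e + (1 + p ^ 2) * z' * e
        + (1 + p ^ 2) * q * (w + 2 * (2 * b * a * z + b ^ 2 * w - Y'))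
        + k * (p * c * (1 + q ^ 2) + q * e * (1 + p ^ 2))|
      ≤ 10 * m ^ 3 * (|w * ((1 + p ^ 2) * (1 + q ^ 2))| + |z * ((1 + p ^ 2) * (1 + q ^ 2))|
        + |w' * (1 + q ^ 2)| + |z' * (1 + p ^ 2)|
        + |2 * p * (1 + q ^ 2) * w' + 2 * q * (1 + p ^ 2) * z'
          + k * ((1 + p ^ 2) * (1 + q ^ 2))|)
        + 2 * ((1 + p ^ 2) * (1 + q ^ 2)) * (|Y| + |Y'|) := by
  have h1 : |1 + q ^ 2| ≤ 1 + q ^ 2 := (abs_of_pos (by positivity)).le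
  have h2 : |1 + p ^ 2| ≤ 1 + p ^ 2 := (abs_of_pos (by positivity)).le
  have hc6 := abs_balanceD_le_aux (p := p) (q := q) hc he
  have hc4 := abs_mul_le_mul hc (abs_mul_le_mul (abs_one_sub_sq_le p) h1)
  have hc5 := abs_mul_le_mul he (abs_mul_le_mul h2 (abs_one_sub_sq_le q))
  have hcp := abs_mul_le_mul (abs_le_one_add_sq p) h1
  have hcq := abs_mul_le_mul h2 (abs_le_one_add_sq q)
  have v1 := abs_variation_le (w := w) (z := z) (Y := Y) ha hb
  have v2 := abs_variation_le (w := z) (z := w) (Y := Y') hb ha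
  set F6 := 2 * p * (1 + q ^ 2) * w' + 2 * q * (1 + p ^ 2) * z'
          + k * ((1 + p ^ 2) * (1 + q ^ 2)) with hF6
  have e0 : ∀ y : ℝ, |y * ((1 + p ^ 2) * (1 + q ^ 2))| = |y| * ((1 + p ^ 2) * (1 + q ^ 2)) :=
    fun y => by
      rw [abs_mul, abs_of_pos (show 0 < (1 + p ^ 2) * (1 + q ^ 2) by positivity)]
  rw [e0, e0]
  have hm2 : m ^ 2 ≤ m ^ 3 := pow_le_pow_right₀ hm (by norm_num)
  have hm3 : 1 ≤ m ^ 3 := one_le_pow₀ hm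
  set d := (1 + p ^ 2) * (1 + q ^ 2) with hd
  have hd0 : 0 < d := by positivity
  have v3 : |z + 2 * (2 * a * b * w + a ^ 2 * z - Y)|
      ≤ 4 * m ^ 3 * |w| + 3 * m ^ 3 * |z| + 2 * |Y| := by
    have i1 : m ^ 2 * |w| ≤ m ^ 3 * |w| := by gcongr
    have i2 : m ^ 2 * |z| ≤ m ^ 3 * |z| := by gcongr
    have i3 : |z| ≤ m ^ 3 * |z| := le_mul_of_one_le_left (abs_nonneg z) hm3
    have i4 := abs_le.1 v1
    have i5 := abs_le.1 (le_refl |z|)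
    exact abs_le.2 ⟨by linarith, by linarith⟩
  have v4 : |w + 2 * (2 * b * a * z + b ^ 2 * w - Y')|
      ≤ 4 * m ^ 3 * |z| + 3 * m ^ 3 * |w| + 2 * |Y'| := by
    have i1 : m ^ 2 * |w| ≤ m ^ 3 * |w| := by gcongr
    have i2 : m ^ 2 * |z| ≤ m ^ 3 * |z| := by gcongr
    have i3 : |w| ≤ m ^ 3 * |w| := le_mul_of_one_le_left (abs_nonneg w) hm3
    have i4 := abs_le.1 v2
    have i5 := abs_le.1 (le_refl |w|)
    exact abs_le.2 ⟨by linarith, by linarith⟩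
  have n1 : 0 ≤ m ^ 3 * (|w| * d) := by positivity
  have n2 : 0 ≤ m ^ 3 * (|z| * d) := by positivity
  -- the terms other than the last two, multiplied by `d`
  have main : |2 * q * z' * p * c + (1 + q ^ 2) * w' * c + 2 * p * w' * q * e
        + (1 + p ^ 2) * z' * e + k * (p * c * (1 + q ^ 2) + q * e * (1 + p ^ 2))|
      ≤ 10 * m ^ 3 * (|w' * (1 + q ^ 2)| + |z' * (1 + p ^ 2)| + |F6|) := by
    refine le_of_mul_le_mul_left ?_ hd0
    rw [← abs_of_pos hd0, ← abs_mul, abs_of_pos hd0]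
    have e : d * (2 * q * z' * p * c + (1 + q ^ 2) * w' * c + 2 * p * w' * q * e
        + (1 + p ^ 2) * z' * e + k * (p * c * (1 + q ^ 2) + q * e * (1 + p ^ 2)))
        = w' * (1 + q ^ 2) * (c * ((1 - p ^ 2) * (1 + q ^ 2)))
          + z' * (1 + p ^ 2) * (e * ((1 + p ^ 2) * (1 - q ^ 2)))
          + F6 * (p * c * (1 + q ^ 2) + q * e * (1 + p ^ 2)) := by
      rw [hF6, hd]
      ring
    rw [e]
    have k4 := abs_le.1 (abs_mul_le_mul (le_refl |w' * (1 + q ^ 2)|) hc4)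
    have k5 := abs_le.1 (abs_mul_le_mul (le_refl |z' * (1 + p ^ 2)|) hc5)
    have k6 := abs_le.1 (abs_mul_le_mul (le_refl |F6|) hc6)
    have n4 : 0 ≤ |w' * (1 + q ^ 2)| * (5 * m ^ 3 * d) := by positivity
    have n5 : 0 ≤ |z' * (1 + p ^ 2)| * (5 * m ^ 3 * d) := by positivity
    generalize |w' * (1 + q ^ 2)| = y4 at *
    generalize |z' * (1 + p ^ 2)| = y5 at *
    generalize |F6| = y6 at *
    exact abs_le.2 ⟨by linarith only [k4.1, k5.1, k6.1, n4, n5],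
      by linarith only [k4.2, k5.2, k6.2, n4, n5]⟩
  have k1 := abs_le.1 (abs_mul_le_mul hcp v3)
  have k2 := abs_le.1 (abs_mul_le_mul hcq v4)
  have k3 := abs_le.1 main
  generalize |w' * (1 + q ^ 2)| = y4 at *
  generalize |z' * (1 + p ^ 2)| = y5 at *
  generalize |F6| = y6 at *
  exact abs_le.2 ⟨by linarith only [k1.1, k2.1, k3.1, n1, n2],
    by linarith only [k1.2, k2.2, k3.2, n1, n2]⟩

/-! ### Transport of the densities -/

/-- The integrand `∑ᵢ |fᵢ|` of the norm. -/
def totalDensity (u v r s h : ℝ → ℝ) (x : ℝ) : ℝ := ∑ i, |f u v r s h i x|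

lemma totalDensity_eq (u v r s h : ℝ → ℝ) (x : ℝ) :
    totalDensity u v r s h x
      = |h x * ((1 + deriv u x ^ 2) * (1 + deriv v x ^ 2))|
        + |shiftedVar u r h x * ((1 + deriv u x ^ 2) * (1 + deriv v x ^ 2))|
        + |shiftedVar v s h x * ((1 + deriv u x ^ 2) * (1 + deriv v x ^ 2))|
        + |shiftedDeriv u r h x * (1 + deriv v x ^ 2)|
        + |shiftedDeriv v s h x * (1 + deriv u x ^ 2)|
        + |2 * deriv u x * (1 + deriv v x ^ 2) * shiftedDeriv u r h x
            + 2 * deriv v x * (1 + deriv u x ^ 2) * shiftedDeriv v s h x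
            + deriv h x * ((1 + deriv u x ^ 2) * (1 + deriv v x ^ 2))| := by
  rw [totalDensity, Fin.sum_univ_six]
  rfl

lemma totalDensity_comm (u v r s h : ℝ → ℝ) :
    totalDensity v u s r h = totalDensity u v r s h := by
  ext x
  rw [totalDensity_eq, totalDensity_eq, mul_comm (1 + deriv v x ^ 2) (1 + deriv u x ^ 2),
    add_comm (2 * deriv v x * (1 + deriv u x ^ 2) * shiftedDeriv v s h x)]
  ring

lemma totalDensity_nonneg (u v r s h : ℝ → ℝ) (x : ℝ) : 0 ≤ totalDensity u v r s h x :=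
  Finset.sum_nonneg fun _ _ => abs_nonneg _

lemma abs_f_le_totalDensity (u v r s h : ℝ → ℝ) (i : Fin 6) (x : ℝ) :
    |f u v r s h i x| ≤ totalDensity u v r s h x :=
  Finset.single_le_sum (f := fun i => |f u v r s h i x|) (fun _ _ => abs_nonneg _)
    (Finset.mem_univ i)

lemma f_two (u v r s h : ℝ → ℝ) : f u v r s h 2 = f v u s r h 1 := by
  ext x
  simp only [f, D, Matrix.cons_val]
  ring

/-- The coefficient `v + 2 (u² v - P₁ - ∂ₓP₂)`, which governs the compression of `1 + uₓ²` along
the flow: `(1 + uₓ²)_t + (u v (1 + uₓ²))_x = uₓ (v + 2 (u² v - P₁ - ∂ₓP₂)) + u vₓ (1 + uₓ²)`. -/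
def compression (u v : ℝ → ℝ) (x : ℝ) : ℝ := v x + 2 * (u x ^ 2 * v x - nonlocalV u v x)

/-- The right-hand side of the balance law `D_t + (u v D)_x = …`. -/
def balanceD (u v : ℝ → ℝ) (x : ℝ) : ℝ :=
  deriv u x * compression u v x * (1 + deriv v x ^ 2)
    + deriv v x * compression v u x * (1 + deriv u x ^ 2)

/-- The right-hand side of the balance law `(f₂)_t + (u v f₂)_x = …`; that of `f₃` is obtained by
exchanging the two components. -/
def balanceVar (u v r s h : ℝ → ℝ) (x : ℝ) : ℝ :=
  -shiftedNonlocalU u v r s h x * ((1 + deriv u x ^ 2) * (1 + deriv v x ^ 2))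
    + shiftedVar u r h x * balanceD u v x

/-- The right-hand side of the balance law `(f₄)_t + (u v f₄)_x = …`; that of `f₅` is obtained by
exchanging the two components. -/
def balanceDeriv (u v r s h : ℝ → ℝ) (x : ℝ) : ℝ :=
  (1 + deriv v x ^ 2) * (2 * u x * v x * shiftedVar u r h x + u x ^ 2 * shiftedVar v s h x
      - (1 / 2) * shiftedVar v s h x * deriv u x ^ 2 - shiftedNonlocalV u v r s h x)
    + shiftedDeriv u r h x * deriv v x * compression v u x

/-- The right-hand sides of the balance laws `(fᵢ)_t + (u v fᵢ)_x = …` for the six densities,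
indexed from `0` as in `f`. -/
def balance (u v r s h : ℝ → ℝ) : Fin 6 → ℝ → ℝ :=
  ![fun x => (v x * shiftedVar u r h x + u x * shiftedVar v s h x)
        * ((1 + deriv u x ^ 2) * (1 + deriv v x ^ 2)) + h x * balanceD u v x,
    balanceVar u v r s h,
    balanceVar v u s r h,
    balanceDeriv u v r s h,
    balanceDeriv v u s r h,
    fun x => 2 * deriv v x * shiftedDeriv v s h x * deriv u x * compression u v x
      + (1 + deriv v x ^ 2) * shiftedDeriv u r h x * compression u v x
      + (1 + deriv v x ^ 2) * deriv u x * (shiftedVar v s h x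
        + 2 * (2 * u x * v x * shiftedVar u r h x + u x ^ 2 * shiftedVar v s h x
          - shiftedNonlocalV u v r s h x))
      + 2 * deriv u x * shiftedDeriv u r h x * deriv v x * compression v u x
      + (1 + deriv u x ^ 2) * shiftedDeriv v s h x * compression v u x
      + (1 + deriv u x ^ 2) * deriv v x * (shiftedVar u r h x
        + 2 * (2 * v x * u x * shiftedVar v s h x + v x ^ 2 * shiftedVar u r h x
          - shiftedNonlocalV v u s r h x))
      + deriv h x * balanceD u v x]

namespace ShiftedTangent

variable {T α : ℝ} {u₀ v₀ : ℝ → ℝ} {u v r s h : ℝ → ℝ → ℝ}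

lemma materialDeriv_one_add_sq (H : ShiftedTangent T α u₀ v₀ u v r s h) :
    HasMaterialDeriv T (velocity u v) (fun t x => 1 + deriv (u t) x ^ 2) fun t x =>
      2 * deriv (u t) x * (u t x ^ 2 * v t x - (1 / 2) * v t x * deriv (u t) x ^ 2
        - nonlocalV (u t) (v t) x) := by
  have h1 := H.sol.materialDeriv_dx H.T_pos
  refine (((HasMaterialDeriv.const 1).add (h1.mul h1)).congr_left
    fun t _ x => ?_).congr fun t _ x => ?_
  · ring
  · ring

lemma materialDeriv_f0 (H : ShiftedTangent T α u₀ v₀ u v r s h) :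
    HasMaterialDeriv T (velocity u v) (fun t => f (u t) (v t) (r t) (s t) (h t) 0) fun t x =>
      balance (u t) (v t) (r t) (s t) (h t) 0 x
        - deriv (velocity u v t) x * f (u t) (v t) (r t) (s t) (h t) 0 x := by
  have h2 := H.symm.materialDeriv_one_add_sq
  rw [velocity_comm] at h2
  refine (H.materialDeriv_shift.mul (H.materialDeriv_one_add_sq.mul h2)).congr fun t ht x => ?_
  rw [H.sol.deriv_velocity ht]
  simp only [balance, f, D, Matrix.cons_val, balanceD, compression]
  ring

lemma materialDeriv_f1 (H : ShiftedTangent T α u₀ v₀ u v r s h) :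
    HasMaterialDeriv T (velocity u v) (fun t => f (u t) (v t) (r t) (s t) (h t) 1) fun t x =>
      balance (u t) (v t) (r t) (s t) (h t) 1 x
        - deriv (velocity u v t) x * f (u t) (v t) (r t) (s t) (h t) 1 x := by
  have h2 := H.symm.materialDeriv_one_add_sq
  rw [velocity_comm] at h2
  refine (H.materialDeriv_shiftedVar.mul (H.materialDeriv_one_add_sq.mul h2)).congr
    fun t ht x => ?_
  rw [H.sol.deriv_velocity ht]
  simp only [balance, f, D, Matrix.cons_val, balanceVar, balanceD, compression, shiftedVar]
  ring

lemma materialDeriv_f3 (H : ShiftedTangent T α u₀ v₀ u v r s h) :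
    HasMaterialDeriv T (velocity u v) (fun t => f (u t) (v t) (r t) (s t) (h t) 3) fun t x =>
      balance (u t) (v t) (r t) (s t) (h t) 3 x
        - deriv (velocity u v t) x * f (u t) (v t) (r t) (s t) (h t) 3 x := by
  have h2 := H.symm.materialDeriv_one_add_sq
  rw [velocity_comm] at h2
  refine (H.materialDeriv_shiftedDeriv.mul h2).congr fun t ht x => ?_
  rw [H.sol.deriv_velocity ht]
  simp only [balance, f, Matrix.cons_val, balanceDeriv, compression, shiftedDeriv]
  ring

lemma materialDeriv_f5 (H : ShiftedTangent T α u₀ v₀ u v r s h) :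
    HasMaterialDeriv T (velocity u v) (fun t => f (u t) (v t) (r t) (s t) (h t) 5) fun t x =>
      balance (u t) (v t) (r t) (s t) (h t) 5 x
        - deriv (velocity u v t) x * f (u t) (v t) (r t) (s t) (h t) 5 x := by
  have p1 := H.sol.materialDeriv_dx H.T_pos
  have q1 := H.sol.symm.materialDeriv_dx H.T_pos
  have p2 := H.materialDeriv_one_add_sq
  have q2 := H.symm.materialDeriv_one_add_sq
  have w1 := H.materialDeriv_shiftedDeriv
  have z1 := H.symm.materialDeriv_shiftedDeriv
  rw [velocity_comm] at q1 q2 z1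
  have c2 : HasMaterialDeriv T (velocity u v) (fun _ _ => (2 : ℝ)) fun _ _ => 0 :=
    HasMaterialDeriv.const 2
  refine (((((c2.mul p1).mul q2).mul w1).add (((c2.mul q1).mul p2).mul z1)).add
    (H.materialDeriv_shift_dx.mul (p2.mul q2))).congr fun t ht x => ?_
  rw [H.sol.deriv_velocity ht]
  simp only [balance, f, D, Matrix.cons_val, balanceD, compression, shiftedDeriv]
  ring

lemma materialDeriv_f (H : ShiftedTangent T α u₀ v₀ u v r s h) (i : Fin 6) :
    HasMaterialDeriv T (velocity u v) (fun t => f (u t) (v t) (r t) (s t) (h t) i) fun t x =>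
      balance (u t) (v t) (r t) (s t) (h t) i x
        - deriv (velocity u v t) x * f (u t) (v t) (r t) (s t) (h t) i x := by
  fin_cases i
  · exact H.materialDeriv_f0
  · exact H.materialDeriv_f1
  · have := H.symm.materialDeriv_f1
    rw [velocity_comm] at this
    simp only [← f_two] at this
    exact this
  · exact H.materialDeriv_f3
  · have := H.symm.materialDeriv_f3
    rw [velocity_comm] at this
    exact this
  · exact H.materialDeriv_f5

end ShiftedTangent

/-! ### The weighted estimate -/

lemma abs_shiftedSource1_le {m x : ℝ} {u v r s h : ℝ → ℝ} (hm : 1 ≤ m) (hu : |u x| ≤ m)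
    (hv : |v x| ≤ m) :
    |shiftedSource1 u v r s h x| ≤ 4 * m ^ 3 * totalDensity u v r s h x := by
  refine (abs_shiftedSource1_le_aux hm hu hv).trans ?_
  rw [totalDensity_eq]
  have := abs_nonneg (h x * ((1 + deriv u x ^ 2) * (1 + deriv v x ^ 2)))
  gcongr
  linarith

lemma abs_shiftedSource2_le {x : ℝ} {u v r s h : ℝ → ℝ} :
    |shiftedSource2 u v r s h x| ≤ 2 * totalDensity u v r s h x := by
  refine abs_shiftedSource2_le_aux.trans ?_
  rw [totalDensity_eq]
  have := abs_nonneg (h x * ((1 + deriv u x ^ 2) * (1 + deriv v x ^ 2)))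
  have := abs_nonneg (shiftedVar u r h x * ((1 + deriv u x ^ 2) * (1 + deriv v x ^ 2)))
  have := abs_nonneg (shiftedVar v s h x * ((1 + deriv u x ^ 2) * (1 + deriv v x ^ 2)))
  linarith

lemma abs_shift_mul_source1_le {m x : ℝ} {u v r s h : ℝ → ℝ} (hm : 1 ≤ m) (hu : |u x| ≤ m)
    (hv : |v x| ≤ m) :
    |h x * source1 u v x| ≤ 3 * m ^ 3 * totalDensity u v r s h x := by
  have h1 := abs_f_le_totalDensity u v r s h 0 x
  have h2 := abs_mul_le_mul (le_refl |h x|)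
    (abs_source1_le_mul (p := deriv u x) (q := deriv v x) hm hu hv)
  have e : |f u v r s h 0 x| = |h x| * ((1 + deriv u x ^ 2) * (1 + deriv v x ^ 2)) := by
    rw [← abs_of_pos (show 0 < (1 + deriv u x ^ 2) * (1 + deriv v x ^ 2) by positivity),
      ← abs_mul]
    rfl
  calc |h x * source1 u v x|
      ≤ 3 * m ^ 3 * |f u v r s h 0 x| := by rw [e]; exact h2.trans_eq (by ring)
    _ ≤ _ := by gcongr

lemma abs_shift_mul_source2_le {x : ℝ} {u v r s h : ℝ → ℝ} :
    |h x * source2 u v x| ≤ totalDensity u v r s h x := by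
  refine (abs_mul_le_mul (le_refl |h x|) (abs_source2_le_mul (deriv u x) (deriv v x))).trans ?_
  refine le_trans (le_of_eq ?_) (abs_f_le_totalDensity u v r s h 0 x)
  rw [← abs_of_pos (show 0 < (1 + deriv u x ^ 2) * (1 + deriv v x ^ 2) by positivity), ← abs_mul]
  rfl

namespace HasUniformBounds

lemma symm {T m Q : ℝ} {u v : ℝ → ℝ → ℝ} (h : HasUniformBounds T m Q u v) :
    HasUniformBounds T m Q v u where
  u_le := h.v_le
  v_le := h.u_le
  U_le := h.U_le'
  V_le := h.V_le'
  U_le' := h.U_le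
  V_le' := h.V_le
  integrable t ht := (h.integrable t ht).congr (Filter.Eventually.of_forall fun x => by
    simp only
    ring)
  integral_le t ht := by
    refine le_of_eq_of_le (integral_congr_ae (Filter.Eventually.of_forall fun x => ?_))
      (h.integral_le t ht)
    simp only
    ring

lemma abs_compression_le {T m Q t : ℝ} {u v : ℝ → ℝ → ℝ} (h : HasUniformBounds T m Q u v)
    (hm : 1 ≤ m) (ht : t ∈ Icc (-T) T) (x : ℝ) : |compression (u t) (v t) x| ≤ 5 * m ^ 3 :=
  abs_add_two_mul_le hm (h.u_le t ht x) (h.v_le t ht x) (h.V_le t ht x)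

end HasUniformBounds

namespace ShiftedTangent

variable {T α : ℝ} {u₀ v₀ : ℝ → ℝ} {u v r s h : ℝ → ℝ → ℝ}

lemma continuous_totalDensity (H : ShiftedTangent T α u₀ v₀ u v r s h) {t : ℝ}
    (ht : t ∈ Icc (-T) T) : Continuous (totalDensity (u t) (v t) (r t) (s t) (h t)) :=
  continuous_finsetSum _ fun i _ => ((H.materialDeriv_f i).smooth.continuous ht).abs

/-- The weighted norm is finite, uniformly in time; its value is not controlled by the energies. -/
lemma exists_integral_totalDensity_le (H : ShiftedTangent T α u₀ v₀ u v r s h) :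
    ∃ S₀, ∀ t ∈ Icc (-T) T,
      Integrable (fun x => totalDensity (u t) (v t) (r t) (s t) (h t) x * weight α x) ∧
      ∫ x, totalDensity (u t) (v t) (r t) (s t) (h t) x * weight α x ≤ S₀ := by
  have hT := H.T_pos
  have c1 : BoundedOnStrip T fun _ _ => (1 : ℝ) := BoundedOnStrip.const 1
  have c2 : BoundedOnStrip T fun _ _ => (2 : ℝ) := BoundedOnStrip.const 2
  have bp := H.sol.bdd_ux
  have bq := H.sol.bdd_vx
  have bα := c1.add (bp.pow 2)
  have bβ := c1.add (bq.pow 2)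
  have bD := bα.mul bβ
  have bw := H.bdd_shiftedVar
  have bz := H.symm.bdd_shiftedVar
  have bw' := H.bdd_shiftedDeriv
  have bz' := H.symm.bdd_shiftedDeriv
  obtain ⟨M, hM1, hM⟩ := ((((((H.mem_shifts.2.1.mul bD).abs.add (bw.mul bD).abs).add
    (bz.mul bD).abs).add (bw'.mul bβ).abs).add (bz'.mul bα).abs).add
    ((((c2.mul bp).mul bβ).mul bw').add (((c2.mul bq).mul bα).mul bz')).abs).exists_one_le
  obtain ⟨N, hN1, hN⟩ := bD.exists_one_le
  obtain ⟨S, hS⟩ := H.integrable_shift_dx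
  have hωi := integrable_weight H.α_pos
  refine ⟨M * (∫ x, weight α x) + N * S, fun t ht => ?_⟩
  obtain ⟨hi, hSt⟩ := hS t ht
  have hle : ∀ x, totalDensity (u t) (v t) (r t) (s t) (h t) x ≤ M + N * |deriv (h t) x| := by
    intro x
    have h1 := (le_abs_self _).trans (hM t ht x)
    have h2 : |deriv (h t) x * ((1 + deriv (u t) x ^ 2) * (1 + deriv (v t) x ^ 2))|
        ≤ |deriv (h t) x| * N := abs_mul_le_mul le_rfl (hN t ht x)
    have h3 := abs_add_le (2 * deriv (u t) x * (1 + deriv (v t) x ^ 2)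
        * shiftedDeriv (u t) (r t) (h t) x
      + 2 * deriv (v t) x * (1 + deriv (u t) x ^ 2) * shiftedDeriv (v t) (s t) (h t) x)
      (deriv (h t) x * ((1 + deriv (u t) x ^ 2) * (1 + deriv (v t) x ^ 2)))
    rw [totalDensity_eq]
    linarith
  have hq : Integrable fun x => (M + N * |deriv (h t) x|) * weight α x := by
    simp only [add_mul, mul_assoc]
    exact (hωi.const_mul M).add ((integrable_abs_mul_weight hi).const_mul N)
  have hint := integrable_mul_weight_of_le (H.continuous_totalDensity ht) hq fun x => by
    rw [abs_of_nonneg (totalDensity_nonneg _ _ _ _ _ x)]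
    exact hle x
  refine ⟨hint, (integral_mul_weight_mono hint hq hle).trans ?_⟩
  have e : ∫ x, (M + N * |deriv (h t) x|) * weight α x
      = M * (∫ x, weight α x) + N * ∫ x, |deriv (h t) x| * weight α x := by
    rw [← integral_const_mul, ← integral_const_mul,
      ← integral_add (hωi.const_mul M) ((integrable_abs_mul_weight hi).const_mul N)]
    simp only [add_mul, mul_assoc]
  rw [e]
  gcongr

lemma admissible_totalDensity (H : ShiftedTangent T α u₀ v₀ u v r s h) {t : ℝ}
    (ht : t ∈ Icc (-T) T) : Admissible (totalDensity (u t) (v t) (r t) (s t) (h t)) := by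
  obtain ⟨S, hS⟩ := H.exists_integral_totalDensity_le
  exact Admissible.of_integrable_weight H.α_pos.le H.α_lt_one.le
    (H.continuous_totalDensity ht) (hS t ht).1

/-- The variations of the nonlocal terms are controlled by `h` and by the resolvent of the
integrand of the norm. -/
lemma abs_shiftedNonlocal_le (H : ShiftedTangent T α u₀ v₀ u v r s h) {m Q t : ℝ} (hm : 1 ≤ m)
    (hb : HasUniformBounds T m Q u v) (ht : t ∈ Icc (-T) T) (x : ℝ) :
    |shiftedNonlocalU (u t) (v t) (r t) (s t) (h t) x|
      ≤ m * |h t x| + 9 * m ^ 3 * invHelmholtz (totalDensity (u t) (v t) (r t) (s t) (h t)) x ∧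
    |shiftedNonlocalV (u t) (v t) (r t) (s t) (h t) x|
      ≤ m * |h t x|
        + 9 * m ^ 3 * invHelmholtz (totalDensity (u t) (v t) (r t) (s t) (h t)) x := by
  have hA := H.admissible_totalDensity ht
  have a1 := hA.const_mul (4 * m ^ 3)
  have a2 := hA.const_mul 2
  have a3 := hA.const_mul (3 * m ^ 3)
  have b1 := fun y => abs_shiftedSource1_le (r := r t) (s := s t) (h := h t) hm
    (hb.u_le t ht y) (hb.v_le t ht y)
  have b3 := fun y => abs_shift_mul_source1_le (r := r t) (s := s t) (h := h t) hm
    (hb.u_le t ht y) (hb.v_le t ht y)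
  have A1 := H.admissible_shiftedSource1 ht
  have A2 := H.admissible_shiftedSource2 ht
  have A3 := H.admissible_shift_mul_source1 ht
  have A4 := H.admissible_shift_mul_source2 ht
  have k1 := a1.abs_invHelmholtz_le A1 b1 x
  have k1' := a1.abs_dxInvHelmholtz_le A1 b1 x
  have k2 := a2.abs_invHelmholtz_le A2 (fun y => abs_shiftedSource2_le) x
  have k2' := a2.abs_dxInvHelmholtz_le A2 (fun y => abs_shiftedSource2_le) x
  have k3 := a3.abs_invHelmholtz_le A3 b3 x
  have k3' := a3.abs_dxInvHelmholtz_le A3 b3 x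
  have k4 := hA.abs_invHelmholtz_le A4 (fun y => abs_shift_mul_source2_le) x
  have k4' := hA.abs_dxInvHelmholtz_le A4 (fun y => abs_shift_mul_source2_le) x
  rw [invHelmholtz_const_mul] at k1 k1' k2 k2' k3 k3'
  have hI := invHelmholtz_nonneg (totalDensity_nonneg (u t) (v t) (r t) (s t) (h t)) x
  set I := invHelmholtz (totalDensity (u t) (v t) (r t) (s t) (h t)) x with hIdef
  have hmI : I ≤ m ^ 3 * I := le_mul_of_one_le_left hI (one_le_pow₀ hm)
  have kU := abs_mul_le_mul (le_refl |h t x|) (hb.U_le t ht x)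
  have kV := abs_mul_le_mul (le_refl |h t x|) (hb.V_le t ht x)
  rw [abs_le] at k1 k1' k2 k2' k3 k3' k4 k4' kU kV
  rw [shiftedNonlocalU, shiftedNonlocalV]
  exact ⟨abs_le.2 ⟨by linarith, by linarith⟩, abs_le.2 ⟨by linarith, by linarith⟩⟩

/-- The right-hand sides of the balance laws are controlled by the integrand of the norm and by
`D` times its resolvent, with a constant that depends on the uniform bounds only. -/
lemma abs_balance_le (H : ShiftedTangent T α u₀ v₀ u v r s h) {m Q t : ℝ} (hm : 1 ≤ m)
    (hb : HasUniformBounds T m Q u v) (ht : t ∈ Icc (-T) T) (x : ℝ) (i : Fin 6) :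
    |balance (u t) (v t) (r t) (s t) (h t) i x|
      ≤ 40 * m ^ 3 * (totalDensity (u t) (v t) (r t) (s t) (h t) x
        + (1 + deriv (u t) x ^ 2) * (1 + deriv (v t) x ^ 2)
          * invHelmholtz (totalDensity (u t) (v t) (r t) (s t) (h t)) x) := by
  have hu := hb.u_le t ht x
  have hv := hb.v_le t ht x
  have hc := hb.abs_compression_le hm ht x
  have he := hb.symm.abs_compression_le hm ht x
  obtain ⟨nX, nY⟩ := H.abs_shiftedNonlocal_le hm hb ht x
  obtain ⟨nX', nY'⟩ := H.symm.abs_shiftedNonlocal_le hm hb.symm ht x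
  rw [totalDensity_comm] at nX' nY'
  have hI := invHelmholtz_nonneg (totalDensity_nonneg (u t) (v t) (r t) (s t) (h t)) x
  set I := invHelmholtz (totalDensity (u t) (v t) (r t) (s t) (h t)) x with hIdef
  have e := totalDensity_eq (u t) (v t) (r t) (s t) (h t) x
  have e0 : |h t x * ((1 + deriv (u t) x ^ 2) * (1 + deriv (v t) x ^ 2))|
      = |h t x| * ((1 + deriv (u t) x ^ 2) * (1 + deriv (v t) x ^ 2)) := by
    rw [abs_mul, abs_of_pos (show 0 < (1 + deriv (u t) x ^ 2) * (1 + deriv (v t) x ^ 2) by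
      positivity)]
  have hβ : |(1 + deriv (v t) x ^ 2) * (1 + deriv (u t) x ^ 2)|
      = (1 + deriv (u t) x ^ 2) * (1 + deriv (v t) x ^ 2) := by
    rw [abs_of_pos (by positivity)]
    ring
  have k1 := abs_balance_shift_le_aux (p := deriv (u t) x) (q := deriv (v t) x)
    (w := shiftedVar (u t) (r t) (h t) x) (z := shiftedVar (v t) (s t) (h t) x) (h := h t x)
    hm hu hv hc he
  have k2 := abs_balanceVar_le_aux (p := deriv (u t) x) (q := deriv (v t) x)
    (w := shiftedVar (u t) (r t) (h t) x)
    (X := shiftedNonlocalU (u t) (v t) (r t) (s t) (h t) x) hc he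
  have k3 := abs_balanceVar_le_aux (p := deriv (v t) x) (q := deriv (u t) x)
    (w := shiftedVar (v t) (s t) (h t) x)
    (X := shiftedNonlocalU (v t) (u t) (s t) (r t) (h t) x) he hc
  have k4 := abs_balanceDeriv_le_aux (p := deriv (u t) x) (q := deriv (v t) x)
    (w := shiftedVar (u t) (r t) (h t) x) (z := shiftedVar (v t) (s t) (h t) x)
    (w' := shiftedDeriv (u t) (r t) (h t) x)
    (Y := shiftedNonlocalV (u t) (v t) (r t) (s t) (h t) x) hm hu hv he
  have k5 := abs_balanceDeriv_le_aux (p := deriv (v t) x) (q := deriv (u t) x)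
    (w := shiftedVar (v t) (s t) (h t) x) (z := shiftedVar (u t) (r t) (h t) x)
    (w' := shiftedDeriv (v t) (s t) (h t) x)
    (Y := shiftedNonlocalV (v t) (u t) (s t) (r t) (h t) x) hm hv hu hc
  have k6 := abs_balance_dx_le_aux (p := deriv (u t) x) (q := deriv (v t) x)
    (w := shiftedVar (u t) (r t) (h t) x) (z := shiftedVar (v t) (s t) (h t) x)
    (w' := shiftedDeriv (u t) (r t) (h t) x) (z' := shiftedDeriv (v t) (s t) (h t) x)
    (k := deriv (h t) x) (Y := shiftedNonlocalV (u t) (v t) (r t) (s t) (h t) x)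
    (Y' := shiftedNonlocalV (v t) (u t) (s t) (r t) (h t) x) hm hu hv hc he
  rw [mul_comm (1 + deriv (v t) x ^ 2) (1 + deriv (u t) x ^ 2)] at k3 k5
  rw [e0] at k1 e
  have hm1 : 0 ≤ m := by linarith
  have hm3 : m ≤ m ^ 3 := le_self_pow₀ hm (by norm_num)
  have hd0 : 0 < (1 + deriv (u t) x ^ 2) * (1 + deriv (v t) x ^ 2) := by positivity
  -- the nonlocal terms, multiplied by `D`
  have nD : ∀ y : ℝ, y ≤ m * |h t x| + 9 * m ^ 3 * I →
      (1 + deriv (u t) x ^ 2) * (1 + deriv (v t) x ^ 2) * y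
        ≤ m ^ 3 * (|h t x| * ((1 + deriv (u t) x ^ 2) * (1 + deriv (v t) x ^ 2)))
          + 9 * m ^ 3 * ((1 + deriv (u t) x ^ 2) * (1 + deriv (v t) x ^ 2) * I) := by
    intro y hy
    calc (1 + deriv (u t) x ^ 2) * (1 + deriv (v t) x ^ 2) * y
        ≤ (1 + deriv (u t) x ^ 2) * (1 + deriv (v t) x ^ 2)
          * (m ^ 3 * |h t x| + 9 * m ^ 3 * I) := by
          refine mul_le_mul_of_nonneg_left (hy.trans ?_) hd0.le
          gcongr
      _ = _ := by ring
  have nX := nD _ nX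
  have nY := nD _ nY
  have nX' := nD _ nX'
  have nY' := nD _ nY'
  set d := (1 + deriv (u t) x ^ 2) * (1 + deriv (v t) x ^ 2) with hd
  have hM : 0 ≤ m ^ 3 := by positivity
  have y0 : 0 ≤ m ^ 3 * (|h t x| * d) := by positivity
  have y1 : 0 ≤ m ^ 3 * |shiftedVar (u t) (r t) (h t) x * d| := by positivity
  have y2 : 0 ≤ m ^ 3 * |shiftedVar (v t) (s t) (h t) x * d| := by positivity
  have y3 : 0 ≤ m ^ 3 * |shiftedDeriv (u t) (r t) (h t) x * (1 + deriv (v t) x ^ 2)| := by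
    positivity
  have y4 : 0 ≤ m ^ 3 * |shiftedDeriv (v t) (s t) (h t) x * (1 + deriv (u t) x ^ 2)| := by
    positivity
  have y5 := mul_nonneg hM (abs_nonneg (2 * deriv (u t) x * (1 + deriv (v t) x ^ 2)
      * shiftedDeriv (u t) (r t) (h t) x
    + 2 * deriv (v t) x * (1 + deriv (u t) x ^ 2) * shiftedDeriv (v t) (s t) (h t) x
    + deriv (h t) x * d))
  have y6 : 0 ≤ m ^ 3 * (d * I) := by positivity
  rw [e]
  fin_cases i
  · refine k1.trans ?_
    linarith
  · refine k2.trans ?_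
    linarith
  · have e3 : balance (u t) (v t) (r t) (s t) (h t) 2 x
        = -shiftedNonlocalU (v t) (u t) (s t) (r t) (h t) x * d
          + shiftedVar (v t) (s t) (h t) x
            * (deriv (v t) x * compression (v t) (u t) x * (1 + deriv (u t) x ^ 2)
              + deriv (u t) x * compression (u t) (v t) x * (1 + deriv (v t) x ^ 2)) := by
      simp only [balance, Matrix.cons_val, balanceVar, balanceD, hd]
      ring
    refine (congrArg abs e3).trans_le (k3.trans ?_)
    linarith
  · refine k4.trans ?_
    linarith
  · refine k5.trans ?_
    linarith
  · refine k6.trans ?_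
    linarith

lemma continuous_balance (H : ShiftedTangent T α u₀ v₀ u v r s h) {t : ℝ}
    (ht : t ∈ Icc (-T) T) (i : Fin 6) : Continuous (balance (u t) (v t) (r t) (s t) (h t) i) := by
  have hf := H.materialDeriv_f i
  have h1 := ((hf.smooth_right H.T_pos H.sol.smooth_velocity).add
    ((H.sol.smooth_velocity.dx H.T_pos).mul hf.smooth)).continuous ht
  simpa only [sub_add_cancel] using h1

/-- The right-hand sides of the balance laws, integrated against the weight. The nonlocal part
uses the bound for `∫ (D - 1) dx` furnished by the energies. -/
lemma integral_abs_balance_le (H : ShiftedTangent T α u₀ v₀ u v r s h) {m Q t : ℝ} (hm : 1 ≤ m)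
    (hb : HasUniformBounds T m Q u v) (ht : t ∈ Icc (-T) T) (i : Fin 6) :
    Integrable (fun x => balance (u t) (v t) (r t) (s t) (h t) i x * weight α x) ∧
    ∫ x, |balance (u t) (v t) (r t) (s t) (h t) i x| * weight α x
      ≤ 40 * m ^ 3 * (1 + (2 / (1 - α) + Q) / 2)
        * ∫ x, totalDensity (u t) (v t) (r t) (s t) (h t) x * weight α x := by
  obtain ⟨S, hS⟩ := H.exists_integral_totalDensity_le
  have hN := (hS t ht).1
  have hc1 := (H.sol.smooth_u.dx H.T_pos).continuous ht
  have hc2 := (H.sol.smooth_v.dx H.T_pos).continuous ht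
  obtain ⟨kI, kle⟩ := integral_mul_invHelmholtz_weight_le H.α_pos.le H.α_lt_one
    (d := fun x => deriv (u t) x ^ 2 + deriv (v t) x ^ 2
      + deriv (u t) x ^ 2 * deriv (v t) x ^ 2) (by fun_prop) (fun x => by positivity)
    (hb.integrable t ht) (hb.integral_le t ht) (H.continuous_totalDensity ht)
    (totalDensity_nonneg _ _ _ _ _) hN
  have hq : Integrable fun x => 40 * m ^ 3 * (totalDensity (u t) (v t) (r t) (s t) (h t) x
      + (1 + deriv (u t) x ^ 2) * (1 + deriv (v t) x ^ 2)
        * invHelmholtz (totalDensity (u t) (v t) (r t) (s t) (h t)) x) * weight α x := by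
    refine ((hN.add kI).const_mul (40 * m ^ 3)).congr (Filter.Eventually.of_forall fun x => ?_)
    simp only [Pi.add_apply]
    ring
  have hi := integrable_mul_weight_of_le (H.continuous_balance ht i) hq
    fun x => H.abs_balance_le hm hb ht x i
  refine ⟨hi, (integral_mul_weight_mono (integrable_abs_mul_weight hi) hq
    fun x => H.abs_balance_le hm hb ht x i).trans ?_⟩
  have e : ∫ x, 40 * m ^ 3 * (totalDensity (u t) (v t) (r t) (s t) (h t) x
      + (1 + deriv (u t) x ^ 2) * (1 + deriv (v t) x ^ 2)
        * invHelmholtz (totalDensity (u t) (v t) (r t) (s t) (h t)) x) * weight α x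
      = 40 * m ^ 3 * ((∫ x, totalDensity (u t) (v t) (r t) (s t) (h t) x * weight α x)
        + ∫ x, (1 + (deriv (u t) x ^ 2 + deriv (v t) x ^ 2
            + deriv (u t) x ^ 2 * deriv (v t) x ^ 2))
          * invHelmholtz (totalDensity (u t) (v t) (r t) (s t) (h t)) x * weight α x) := by
    rw [← integral_add hN kI, ← integral_const_mul]
    refine integral_congr_ae (Filter.Eventually.of_forall fun x => ?_)
    simp only
    ring
  rw [e, mul_assoc (40 * m ^ 3), add_mul, one_mul]
  gcongr

lemma integral_totalDensity_eq_sum (H : ShiftedTangent T α u₀ v₀ u v r s h) {t : ℝ}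
    (ht : t ∈ Icc (-T) T) :
    (∀ i, Integrable fun x => f (u t) (v t) (r t) (s t) (h t) i x * weight α x) ∧
    ∫ x, totalDensity (u t) (v t) (r t) (s t) (h t) x * weight α x
      = ∑ i, ∫ x, |f (u t) (v t) (r t) (s t) (h t) i x| * weight α x := by
  obtain ⟨S₀, hS₀⟩ := H.exists_integral_totalDensity_le
  have hfi : ∀ i, Integrable fun x => f (u t) (v t) (r t) (s t) (h t) i x * weight α x :=
    fun i => integrable_mul_weight_of_le ((H.materialDeriv_f i).smooth.continuous ht)
      (hS₀ t ht).1 (abs_f_le_totalDensity _ _ _ _ _ i)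
  refine ⟨hfi, ?_⟩
  rw [← integral_finsetSum _ fun i _ => integrable_abs_mul_weight (hfi i)]
  simp only [totalDensity, Finset.sum_mul]

/-- Growth of the weighted norm along the flow, with a constant that depends on the uniform
bounds only. -/
lemma integral_totalDensity_le_add (H : ShiftedTangent T α u₀ v₀ u v r s h) {m Q : ℝ}
    (hm : 1 ≤ m) (hQ : 0 ≤ Q) (hb : HasUniformBounds T m Q u v) {t₁ t₂ : ℝ}
    (ht₁ : t₁ ∈ Icc (-T) T) (ht₂ : t₂ ∈ Icc (-T) T) {S : ℝ}
    (hS : ∀ τ ∈ uIcc t₁ t₂,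
      ∫ x, totalDensity (u τ) (v τ) (r τ) (s τ) (h τ) x * weight α x ≤ S) :
    ∫ x, totalDensity (u t₂) (v t₂) (r t₂) (s t₂) (h t₂) x * weight α x
      ≤ (∫ x, totalDensity (u t₁) (v t₁) (r t₁) (s t₁) (h t₁) x * weight α x)
        + |t₂ - t₁|
          * (6 * (α * (m * m) + 40 * m ^ 3 * (1 + (2 / (1 - α) + Q) / 2)) * S) := by
  obtain ⟨S₀, hS₀⟩ := H.exists_integral_totalDensity_le
  have hsub : uIcc t₁ t₂ ⊆ Icc (-T) T := ordConnected_Icc.uIcc_subset ht₁ ht₂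
  have hα : 0 < 1 - α := by linarith [H.α_lt_one]
  have hfi : ∀ i, ∀ t ∈ Icc (-T) T,
      Integrable fun x => f (u t) (v t) (r t) (s t) (h t) i x * weight α x := fun i t ht =>
    (H.integral_totalDensity_eq_sum ht).1 i
  obtain ⟨A₁, hA₁⟩ := H.bdd_velocity_dx
  have key : ∀ i, ∫ x, |f (u t₂) (v t₂) (r t₂) (s t₂) (h t₂) i x| * weight α x
      ≤ (∫ x, |f (u t₁) (v t₁) (r t₁) (s t₁) (h t₁) i x| * weight α x)
        + |t₂ - t₁| * (α * (m * m * S) + 40 * m ^ 3 * (1 + (2 / (1 - α) + Q) / 2) * S) := by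
    intro i
    refine (H.materialDeriv_f i).integral_abs_weight_le H.T_pos H.α_pos H.sol.smooth_velocity
      (fun t ht x => abs_mul_le_mul (hb.u_le t ht x) (hb.v_le t ht x)) hA₁ (hfi i) ht₁ ht₂
      (fun τ hτ => ?_) fun τ hτ => ?_
    · exact (integral_mul_weight_mono (integrable_abs_mul_weight (hfi i τ (hsub hτ)))
        (hS₀ τ (hsub hτ)).1 (abs_f_le_totalDensity _ _ _ _ _ i)).trans (hS τ hτ)
    · simp only [sub_add_cancel]
      obtain ⟨b1, b2⟩ := H.integral_abs_balance_le hm hb (hsub hτ) i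
      refine ⟨b1, b2.trans ?_⟩
      have := hS τ hτ
      gcongr
  rw [(H.integral_totalDensity_eq_sum ht₁).2, (H.integral_totalDensity_eq_sum ht₂).2]
  refine (Finset.sum_le_sum fun i _ => key i).trans_eq ?_
  rw [Finset.sum_add_distrib, Finset.sum_const, Finset.card_univ, Fintype.card_fin]
  simp only [nsmul_eq_mul]
  push_cast
  ring

end ShiftedTangent

/-! ### The norm of tangent vectors -/

section Ialpha

variable {α : ℝ} {g : ℝ → ℝ}

lemma Ialpha_le_ofReal (hα : 0 ≤ α) (hi : Integrable fun x => g x * weight α x) :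
    Ialpha α g ≤ ENNReal.ofReal (Real.exp α * ∫ x, |g x| * weight α x) := by
  have hi' := integrable_abs_mul_weight hi
  rw [← integral_const_mul, ofReal_integral_eq_lintegral_ofReal (hi'.const_mul _)
    (Filter.Eventually.of_forall fun x => mul_nonneg (Real.exp_pos _).le
      (mul_nonneg (abs_nonneg _) (weight_pos α x).le))]
  refine lintegral_mono fun x => ENNReal.ofReal_le_ofReal ?_
  rw [mul_left_comm]
  exact mul_le_mul_of_nonneg_left (le_weight hα x) (abs_nonneg _)

lemma lintegral_le_Ialpha (hα : 0 ≤ α) :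
    ∫⁻ x, ENNReal.ofReal (|g x| * weight α x) ≤ Ialpha α g :=
  lintegral_mono fun x => ENNReal.ofReal_le_ofReal
    (mul_le_mul_of_nonneg_left (weight_le hα x) (abs_nonneg _))

lemma ofReal_integral_le_Ialpha (hα : 0 ≤ α) (hi : Integrable fun x => g x * weight α x) :
    ENNReal.ofReal (∫ x, |g x| * weight α x) ≤ Ialpha α g := by
  rw [ofReal_integral_eq_lintegral_ofReal (integrable_abs_mul_weight hi)
    (Filter.Eventually.of_forall fun x => mul_nonneg (abs_nonneg _) (weight_pos α x).le)]
  exact lintegral_le_Ialpha hα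

lemma integrable_mul_weight_of_Ialpha_ne_top (hα : 0 ≤ α) (hg : Continuous g)
    (h : Ialpha α g ≠ ⊤) : Integrable fun x => g x * weight α x := by
  refine ⟨by fun_prop, ?_⟩
  rw [hasFiniteIntegral_iff_norm]
  refine lt_of_le_of_lt (lintegral_mono fun x => ENNReal.ofReal_le_ofReal ?_)
    ((lintegral_le_Ialpha hα).trans_lt (lt_top_iff_ne_top.2 h))
  rw [norm_mul, Real.norm_eq_abs, Real.norm_eq_abs, abs_of_pos (weight_pos α x)]

end Ialpha

lemma continuous_f {u v r s h : ℝ → ℝ} (hu : Continuous (deriv u)) (hv : Continuous (deriv v))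
    (hu' : Continuous (deriv (deriv u))) (hv' : Continuous (deriv (deriv v)))
    (hr : Continuous r) (hs : Continuous s) (hr' : Continuous (deriv r))
    (hs' : Continuous (deriv s)) (hh : Continuous h) (hh' : Continuous (deriv h)) (i : Fin 6) :
    Continuous (f u v r s h i) := by
  have hD : Continuous (D u v) := by
    unfold D
    fun_prop
  fin_cases i <;> simp only [f, Fin.zero_eta, Fin.mk_one, Fin.reduceFinMk, Matrix.cons_val] <;>
    fun_prop

/-- `h_x` is a combination of the fourth, fifth and sixth densities, whose coefficients are bounded
by those of the first derivatives of the solution. -/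
lemma abs_deriv_le_totalDensity {M x : ℝ} {u v r s h : ℝ → ℝ} (hu : |deriv u x| ≤ M)
    (hv : |deriv v x| ≤ M) : |deriv h x| ≤ (1 + 4 * M) * totalDensity u v r s h x := by
  have h3 := abs_mul_le_mul hu (abs_f_le_totalDensity u v r s h 3 x)
  have h4 := abs_mul_le_mul hv (abs_f_le_totalDensity u v r s h 4 x)
  have h5 := abs_f_le_totalDensity u v r s h 5 x
  have hD : 1 ≤ D u v x := by
    unfold D
    nlinarith [sq_nonneg (deriv u x), sq_nonneg (deriv v x),
      mul_nonneg (sq_nonneg (deriv u x)) (sq_nonneg (deriv v x))]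
  have e : deriv h x * D u v x = f u v r s h 5 x - 2 * (deriv u x * f u v r s h 3 x)
      - 2 * (deriv v x * f u v r s h 4 x) := by
    simp only [f, Matrix.cons_val]
    ring
  have h1 : |deriv h x| ≤ |deriv h x * D u v x| := by
    rw [abs_mul, abs_of_pos (by linarith : 0 < D u v x)]
    exact le_mul_of_one_le_right (abs_nonneg _) hD
  refine h1.trans ?_
  rw [e]
  rw [abs_le] at h3 h4 h5
  exact abs_le.2 ⟨by linarith, by linarith⟩

/-- Finiteness of the initial norm makes `h_x` integrable against the weight at the initial time. -/
lemma ShiftedTangent.of_ne_top {T α : ℝ} (hT : 0 < T) (hα0 : 0 < α) (hα1 : α < 1)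
    {u₀ v₀ : ℝ → ℝ} {u v r s h : ℝ → ℝ → ℝ} (hsol : IsSmoothSolution T u₀ v₀ u v)
    (htan : IsTangentVector T u v r s) (hh : h ∈ shifts T u v r s)
    (hfin : ∑ i, Ialpha α (f (u 0) (v 0) (r 0) (s 0) (h 0) i) ≠ ⊤) :
    ShiftedTangent T α u₀ v₀ u v r s h where
  T_pos := hT
  α_pos := hα0
  α_lt_one := hα1
  sol := hsol
  tangent := htan
  mem_shifts := hh
  integrable_zero := by
    have h0 : (0 : ℝ) ∈ Icc (-T) T := ⟨by linarith, hT.le⟩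
    have sux := hsol.smooth_u.dx hT
    have svx := hsol.smooth_v.dx hT
    have hf := continuous_f (sux.continuous h0) (svx.continuous h0)
      ((sux.dx hT).continuous h0) ((svx.dx hT).continuous h0) (htan.smooth_r.continuous h0)
      (htan.smooth_s.continuous h0) ((htan.smooth_r.dx hT).continuous h0)
      ((htan.smooth_s.dx hT).continuous h0) (hh.1.continuous h0) ((hh.1.dx hT).continuous h0)
    have hi : ∀ i, Integrable fun x =>
        |f (u 0) (v 0) (r 0) (s 0) (h 0) i x| * weight α x := fun i =>
      integrable_abs_mul_weight (integrable_mul_weight_of_Ialpha_ne_top hα0.le (hf i)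
        (ENNReal.sum_ne_top.1 hfin i (Finset.mem_univ i)))
    have hN : Integrable fun x =>
        totalDensity (u 0) (v 0) (r 0) (s 0) (h 0) x * weight α x := by
      simp only [totalDensity, Finset.sum_mul]
      exact integrable_finsetSum _ fun i _ => hi i
    obtain ⟨M, -, hM⟩ := (hsol.bdd_ux.abs.add hsol.bdd_vx.abs).exists_one_le
    refine integrable_mul_weight_of_le (q := fun x => (1 + 4 * M)
        * totalDensity (u 0) (v 0) (r 0) (s 0) (h 0) x) ((hh.1.dx hT).continuous h0)
      ((hN.const_mul (1 + 4 * M)).congr (Filter.Eventually.of_forall fun x => by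
        simp only
        ring)) fun x => ?_
    have h1 := (le_abs_self _).trans (hM 0 h0 x)
    have h2 := abs_nonneg (deriv (u 0) x)
    have h3 := abs_nonneg (deriv (v 0) x)
    exact abs_deriv_le_totalDensity (by linarith) (by linarith)

namespace ShiftedTangent

variable {T α : ℝ} {u₀ v₀ : ℝ → ℝ} {u v r s h : ℝ → ℝ → ℝ}

/-- Propagation of the norm for a fixed shift. -/
lemma sum_Ialpha_le (H : ShiftedTangent T α u₀ v₀ u v r s h) {m Q : ℝ} (hm : 1 ≤ m)
    (hQ : 0 ≤ Q) (hb : HasUniformBounds T m Q u v) {n : ℕ} (hn : 0 < n)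
    (hCn : 2 * (6 * (α * (m * m) + 40 * m ^ 3 * (1 + (2 / (1 - α) + Q) / 2))) * T ≤ n)
    {t : ℝ} (ht : t ∈ Icc (-T) T) :
    ∑ i, Ialpha α (f (u t) (v t) (r t) (s t) (h t) i)
      ≤ ENNReal.ofReal (Real.exp α * 2 ^ n)
        * ∑ i, Ialpha α (f (u 0) (v 0) (r 0) (s 0) (h 0) i) := by
  have hα0 := H.α_pos
  have hα1 : 0 < 1 - α := by linarith [H.α_lt_one]
  have h0 : (0 : ℝ) ∈ Icc (-T) T := ⟨by linarith [H.T_pos], H.T_pos.le⟩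
  obtain ⟨S₀, hS₀⟩ := H.exists_integral_totalDensity_le
  have hgron := le_two_pow_mul_of_le_add (T := T)
    (N := fun t => ∫ x, totalDensity (u t) (v t) (r t) (s t) (h t) x * weight α x)
    (by positivity) hn hCn (fun t ht => (hS₀ t ht).2)
    (fun t _ => integral_nonneg fun x =>
      mul_nonneg (totalDensity_nonneg _ _ _ _ _ x) (weight_pos α x).le)
    (fun t₁ ht₁ t₂ ht₂ S hS => H.integral_totalDensity_le_add hm hQ hb ht₁ ht₂ hS) t ht
  obtain ⟨it, et⟩ := H.integral_totalDensity_eq_sum ht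
  obtain ⟨i0, e0⟩ := H.integral_totalDensity_eq_sum h0
  simp only [et, e0] at hgron
  have hnn : ∀ t, ∀ i ∈ (Finset.univ : Finset (Fin 6)),
      0 ≤ ∫ x, |f (u t) (v t) (r t) (s t) (h t) i x| * weight α x := fun t i _ =>
    integral_nonneg fun x => mul_nonneg (abs_nonneg _) (weight_pos α x).le
  calc ∑ i, Ialpha α (f (u t) (v t) (r t) (s t) (h t) i)
      ≤ ∑ i, ENNReal.ofReal (Real.exp α
          * ∫ x, |f (u t) (v t) (r t) (s t) (h t) i x| * weight α x) :=
        Finset.sum_le_sum fun i _ => Ialpha_le_ofReal hα0.le (it i)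
    _ = ENNReal.ofReal (Real.exp α
          * ∑ i, ∫ x, |f (u t) (v t) (r t) (s t) (h t) i x| * weight α x) := by
        rw [← ENNReal.ofReal_sum_of_nonneg fun i hi =>
          mul_nonneg (Real.exp_pos _).le (hnn t i hi), Finset.mul_sum]
    _ ≤ ENNReal.ofReal (Real.exp α * 2 ^ n
          * ∑ i, ∫ x, |f (u 0) (v 0) (r 0) (s 0) (h 0) i x| * weight α x) := by
        rw [mul_assoc]
        gcongr
    _ = ENNReal.ofReal (Real.exp α * 2 ^ n)
          * ∑ i, ENNReal.ofReal (∫ x, |f (u 0) (v 0) (r 0) (s 0) (h 0) i x| * weight α x) := by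
        rw [ENNReal.ofReal_mul (by positivity), ENNReal.ofReal_sum_of_nonneg (hnn 0)]
    _ ≤ _ := by
        gcongr with i _
        exact ofReal_integral_le_Ialpha hα0.le (i0 i)

end ShiftedTangent

end Novikov

end

theorem mainTheorem5 (T : ℝ) (hT : 0 < T) (α : ℝ) (hα : α ∈ Set.Ioo (0 : ℝ) 1)
    (Eu Ev H : ℝ) :
    ∃ C : ℝ, 0 < C ∧
      ∀ (u₀ v₀ : ℝ → ℝ) (u v r s : ℝ → ℝ → ℝ),
        Novikov.IsSmoothSolution T u₀ v₀ u v →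
        Novikov.energy u₀ = Eu → Novikov.energy v₀ = Ev → Novikov.energyH u₀ v₀ = H →
        Novikov.IsTangentVector T u v r s →
        ∀ t ∈ Set.Icc (-T) T,
          Novikov.tangentNorm α T u v r s t
            ≤ ENNReal.ofReal C * Novikov.tangentNorm α T u v r s 0 := by
  set L := 1 + |Eu| + |Ev| + |H| with hL
  have hL1 : 1 ≤ L := by
    have := abs_nonneg Eu
    have := abs_nonneg Ev
    have := abs_nonneg H
    linarith
  have hm : 1 ≤ 20 * L ^ 2 := by nlinarith
  have hQ : 0 ≤ 41 * L ^ 2 := by positivity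
  obtain ⟨n, hn⟩ := exists_nat_ge (2 * (6 * (α * (20 * L ^ 2 * (20 * L ^ 2))
    + 40 * (20 * L ^ 2) ^ 3 * (1 + (2 / (1 - α) + 41 * L ^ 2) / 2))) * T)
  have hC : 0 < Real.exp α * 2 ^ (n + 1) := by positivity
  refine ⟨Real.exp α * 2 ^ (n + 1), hC, ?_⟩
  intro u₀ v₀ u v r s hsol hEu hEv hEH htan t ht
  have hb := hsol.hasUniformBounds hT hL1
    (by rw [hEu]; linarith [le_abs_self Eu, abs_nonneg Ev, abs_nonneg H])
    (by rw [hEv]; linarith [le_abs_self Ev, abs_nonneg Eu, abs_nonneg H])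
    (by rw [hEH]; linarith [neg_le_abs H, abs_nonneg Eu, abs_nonneg Ev])
  have hne : ENNReal.ofReal (Real.exp α * 2 ^ (n + 1)) ≠ 0 := (ENNReal.ofReal_pos.2 hC).ne'
  unfold Novikov.tangentNorm
  simp only [ENNReal.mul_iInf_of_ne hne ENNReal.ofReal_ne_top]
  refine le_iInf₂ fun h hh => iInf₂_le_of_le h hh ?_
  by_cases hfin : ∑ i, Novikov.Ialpha α (Novikov.f (u 0) (v 0) (r 0) (s 0) (h 0) i) = ⊤
  · rw [hfin, ENNReal.mul_top hne]
    exact le_top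
  · refine (Novikov.ShiftedTangent.of_ne_top hT hα.1 hα.2 hsol htan hh hfin).sum_Ialpha_le hm hQ
      hb n.succ_pos ?_ ht
    push_cast
    linarith
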